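/- Let $G=(V,E)$ be a simple graph whose vertex degrees $d_x$ satisfy $d_x\le d$ for some $d<\infty$ and all $x\in V$. Let $D$ be the set of directed edges, each edge $\{x,y\}$ giving the two directed edges $(xy)$ (from $y$ to $x$) and $(yx)$ (from $x$ to $y$), and let $|xy\rangle$, $(xy)\in D$, be the canonical orthonormal basis of $\mathcal H=\ell^2(D)$. For a family $\mathcal S=(S(x))_{x\in V}$ of unitary matrices $S(x)\in\mathcal U(d_x)$, with entries $S_{zy}(x)$ labelled by the neighbours $z,y$ of $x$, the scattering quantum walk $U_{\mathcal S}$ is the unitary operator on $\mathcal H$ with $$U_{\mathcal S}|xy\rangle=\sum_{z\sim x}S_{zy}(x)\,|zx\rangle .$$ Let $\mathcal I$ be the family of identity matrices and $\|\mathcal S-\mathcal I\|=\sup_{x\in V}\|S(x)-\mathbb 1\|_{HS}$, where $\|\cdot\|_{HS}$ is the Hilbert–Schmidt norm. Let $(\omega_x)_{x\in V}$ be independent random variables in $\mathbb T=\mathbb R/2\pi\mathbb Z$ with common law $d\mu(\theta)=\tau(\theta)\,d\theta$, $\tau\in L^\infty(\mathbb T)$, and let $U=U_\omega$ be the random scattering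 quantum walk with scattering matrices $S_\omega(x)=e^{i\omega_x}S(x)$. For a Borel set $I$ of the unit circle $S^1\subset\mathbb C$ let $P_I(U)$ be the spectral projection of $U$ for $I$. Let $d(x,x')$ be the graph distance in $G$, with $d(x,x')=\infty$ and $e^{-\infty}=0$ if $x,x'$ lie in different connected components. Then for every $g>0$ there are $\varphi,c>0$ such that for every family of scattering matrices $\mathcal S$ with $\|\mathcal S-\mathcal I\|\le\varphi$, all $(xy),(x'y')\in D$ and every Borel set $I\subset S^1$ (in particular every arc), the supremum below is a measurable function of the randomness up to a null set and $$\mathbb E\Big(\sup_{n\in\mathbb Z}\big|\langle xy\,|\,U^n P_I(U)\,x'y'\rangle\big|\Big)\le c\,e^{-g\,d(x,x')} .$$ The constants $\varphi,c$ do not depend on $\mathcal S$, $(xy)$, $(x'y')$ or $I$. -/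

import Mathlib

open MeasureTheory ProbabilityTheory
open scoped ENNReal

namespace ScatteringWalk

/-! ### Spectral projections of a unitary operator -/

section Spectral

variable {H : Type*} [NormedAddCommGroup H] [InnerProductSpace ℂ H] [CompleteSpace H]

/-- The unit circle carries its Borel sets. -/
noncomputable instance instMeasurableSpaceCircle : MeasurableSpace Circle := borel Circle

instance instBorelSpaceCircle : BorelSpace Circle := ⟨rfl⟩

/-- `m` is the spectral measure of the unitary operator `U` in the vector `ψ`: the (unique) finite
Borel measure on the unit circle with `⟨ψ, U ^ n ψ⟩ = ∫ z ^ n dm(z)` for all integers `n`. -/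
def IsSpectralMeasure (U : H ≃ₗᵢ[ℂ] H) (ψ : H) (m : Measure Circle) : Prop :=
  IsFiniteMeasure m ∧ ∀ n : ℤ, inner ℂ ψ ((U ^ n) ψ) = ∫ z : Circle, (z : ℂ) ^ n ∂m

/-- The spectral subspace of `U` for a Borel set `I` of the circle: all vectors whose spectral
measure is carried by `I`. (For Borel `I` these vectors already form a closed subspace; taking the
closed span only spares a proof of that fact.) -/
def spectralSubspace (U : H ≃ₗᵢ[ℂ] H) (I : Set Circle) : Submodule ℂ H :=
  (Submodule.span ℂ
    {ψ : H | ∃ m : Measure Circle, IsSpectralMeasure U ψ m ∧ m Iᶜ = 0}).topologicalClosure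

/-- The spectral projection `P_I(U)`: the orthogonal projection onto the spectral subspace. -/
noncomputable def spectralProjection (U : H ≃ₗᵢ[ℂ] H) (I : Set Circle) : H →L[ℂ] H :=
  haveI : CompleteSpace (spectralSubspace U I) :=
    inferInstanceAs (CompleteSpace (Submodule.topologicalClosure _))
  (spectralSubspace U I).starProjection

end Spectral

/-! ### The digraph of a graph and its Hilbert space -/

variable {V : Type*}

/-- The directed edges of the digraph `(V, D)` of the graph `G`. The pair `(x, y)`, with `x ∼ y`, is
the directed edge `(xy)` *from `y` to `x`*; every edge of `G` gives two directed edges. -/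
abbrev DirEdge (G : SimpleGraph V) : Type _ := {e : V × V // G.Adj e.1 e.2}

/-- The Hilbert space `ℓ²(D)`. -/
abbrev EdgeSpace (G : SimpleGraph V) : Type _ := lp (fun _ : DirEdge G => ℂ) 2

/-- The canonical basis vector `|xy⟩` of `ℓ²(D)`. -/
noncomputable def ket {G : SimpleGraph V} [DecidableEq V] (e : DirEdge G) : EdgeSpace G :=
  lp.single 2 e (1 : ℂ)

/-- The directed edges `(xy)`, `y ∼ x`, arriving at `x`. -/
def inEdge (G : SimpleGraph V) : (Σ x : V, G.neighborSet x) ≃ DirEdge G where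
  toFun p := ⟨(p.1, p.2.1), p.2.2⟩
  invFun e := ⟨e.1.1, ⟨e.1.2, e.2⟩⟩
  left_inv _ := rfl
  right_inv _ := rfl

/-- The directed edges `(zx)`, `z ∼ x`, leaving `x`. -/
def outEdge (G : SimpleGraph V) : (Σ x : V, G.neighborSet x) ≃ DirEdge G where
  toFun p := ⟨(p.2.1, p.1), p.2.2.symm⟩
  invFun e := ⟨e.1.2, ⟨e.1.1, e.2.symm⟩⟩
  left_inv _ := rfl
  right_inv _ := rfl

/-! ### Scattering quantum walks -/

section Walk

variable (G : SimpleGraph V) [G.LocallyFinite] [DecidableEq V]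

/-- A family `𝒮 = (S(x))` of unitary scattering matrices, the entries of `S(x)` being labelled by
the neighbours of `x`. The family `ℐ` of identity matrices is `1`. -/
abbrev ScatteringFamily : Type _ := ∀ x : V, Matrix.unitaryGroup (G.neighborSet x) ℂ

variable {G}

/-- `‖𝒮 - 𝒮'‖ = sup_x ‖S(x) - S'(x)‖_HS`, with the Hilbert-Schmidt norm. -/
noncomputable def scatteringDist (S S' : ScatteringFamily G) : ℝ :=
  ⨆ x : V, Real.sqrt (∑ z : G.neighborSet x, ∑ y : G.neighborSet x,
    ‖(S x).1 z y - (S' x).1 z y‖ ^ 2)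

/-- The action of the walk on functions: the value at `(zx)` is `∑_{y ∼ x} S_{zy}(x) ψ(xy)`. -/
noncomputable def walkFun (S : ScatteringFamily G) (ψ : DirEdge G → ℂ) : DirEdge G → ℂ := fun e =>
  ((S e.1.2).1.mulVec fun y => ψ (inEdge G ⟨e.1.2, y⟩)) ⟨e.1.1, e.2.symm⟩

/-- The inverse action: the value at `(xy)` is `∑_{z ∼ x} conj (S_{zy}(x)) ψ(zx)`. -/
noncomputable def walkInvFun (S : ScatteringFamily G) (ψ : DirEdge G → ℂ) : DirEdge G → ℂ := fun e =>
  ((S e.1.1).1.conjTranspose.mulVec fun z => ψ (outEdge G ⟨e.1.1, z⟩)) ⟨e.1.2, e.2⟩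

theorem walkFun_invFun (S : ScatteringFamily G) (ψ : DirEdge G → ℂ) :
    walkFun S (walkInvFun S ψ) = ψ := by
  funext e
  have h : (S e.1.2).1 * (S e.1.2).1.conjTranspose = 1 :=
    (Matrix.mem_unitaryGroup_iff).1 (S e.1.2).2
  change ((S e.1.2).1.mulVec ((S e.1.2).1.conjTranspose.mulVec
    fun z => ψ (outEdge G ⟨e.1.2, z⟩))) ⟨e.1.1, e.2.symm⟩ = ψ e
  rw [Matrix.mulVec_mulVec, h, Matrix.one_mulVec]
  rfl

theorem walkInvFun_fun (S : ScatteringFamily G) (ψ : DirEdge G → ℂ) :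
    walkInvFun S (walkFun S ψ) = ψ := by
  funext e
  have h : (S e.1.1).1.conjTranspose * (S e.1.1).1 = 1 :=
    (Matrix.mem_unitaryGroup_iff').1 (S e.1.1).2
  change ((S e.1.1).1.conjTranspose.mulVec ((S e.1.1).1.mulVec
    fun z => ψ (inEdge G ⟨e.1.1, z⟩))) ⟨e.1.2, e.2⟩ = ψ e
  rw [Matrix.mulVec_mulVec, h, Matrix.one_mulVec]
  rfl

theorem sum_enorm_mulVec {n : Type*} [Fintype n] [DecidableEq n] (A : Matrix.unitaryGroup n ℂ)
    (v : n → ℂ) : ∑ i, ‖(A.1.mulVec v) i‖ₑ ^ 2 = ∑ i, ‖v i‖ₑ ^ 2 := by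
  have key : ∀ w : n → ℂ, ((∑ i, ‖w i‖ ^ 2 : ℝ) : ℂ) = dotProduct (star w) w := by
    intro w
    simp [dotProduct, RCLike.conj_mul]
  have h : A.1.conjTranspose * A.1 = 1 := (Matrix.mem_unitaryGroup_iff').1 A.2
  have hr : ∑ i, ‖(A.1.mulVec v) i‖ ^ 2 = ∑ i, ‖v i‖ ^ 2 := by
    have : ((∑ i, ‖(A.1.mulVec v) i‖ ^ 2 : ℝ) : ℂ) = ((∑ i, ‖v i‖ ^ 2 : ℝ) : ℂ) := by
      rw [key, key, Matrix.star_mulVec, ← Matrix.dotProduct_mulVec, Matrix.mulVec_mulVec, h,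
        Matrix.one_mulVec]
    exact_mod_cast this
  have e : ∀ w : n → ℂ, ∑ i, ‖w i‖ₑ ^ 2 = ENNReal.ofReal (∑ i, ‖w i‖ ^ 2) := by
    intro w
    rw [ENNReal.ofReal_sum_of_nonneg (fun _ _ => by positivity)]
    refine Finset.sum_congr rfl fun i _ => ?_
    rw [ENNReal.ofReal_pow (norm_nonneg _), ofReal_norm]
  rw [e, e, hr]

theorem tsum_enorm_walkFun (S : ScatteringFamily G) (ψ : DirEdge G → ℂ) :
    ∑' e, ‖walkFun S ψ e‖ₑ ^ 2 = ∑' e, ‖ψ e‖ₑ ^ 2 := by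
  rw [← (outEdge G).tsum_eq, ← (inEdge G).tsum_eq (fun e => ‖ψ e‖ₑ ^ 2),
    ENNReal.tsum_sigma', ENNReal.tsum_sigma']
  refine tsum_congr fun x => ?_
  rw [tsum_fintype, tsum_fintype]
  exact sum_enorm_mulVec (S x) fun y => ψ (inEdge G ⟨x, y⟩)

theorem memℓp_two_iff {ι : Type*} (f : ι → ℂ) : Memℓp f 2 ↔ ∑' i, ‖f i‖ₑ ^ 2 ≠ ∞ := by
  rw [memℓp_gen_iff (by simp)]
  have h : ∀ i, ‖f i‖ₑ ^ 2 = ENNReal.ofReal (‖f i‖ ^ (2 : ℝ≥0∞).toReal) := by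
    intro i
    rw [ENNReal.toReal_ofNat, Real.rpow_two, ENNReal.ofReal_pow (norm_nonneg _),
      ofReal_norm]
  simp_rw [h]
  refine ⟨fun hs => hs.tsum_ofReal_ne_top, fun hs => ?_⟩
  have := ENNReal.summable_toReal hs
  refine this.congr fun i => ?_
  rw [ENNReal.toReal_ofReal (by positivity)]

theorem norm_eq_of_tsum_eq {ι : Type*} (f g : lp (fun _ : ι => ℂ) 2)
    (h : ∑' i, ‖f i‖ₑ ^ 2 = ∑' i, ‖g i‖ₑ ^ 2) : ‖f‖ = ‖g‖ := by
  have e : ∀ k : lp (fun _ : ι => ℂ) 2,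
      ∑' i, ‖k i‖ ^ (2 : ℝ≥0∞).toReal = (∑' i, ‖k i‖ₑ ^ 2).toReal := by
    intro k
    rw [ENNReal.tsum_toReal_eq (fun i => by simp)]
    simp
  rw [lp.norm_eq_tsum_rpow (by simp) f, lp.norm_eq_tsum_rpow (by simp) g, e, e, h]

/-- The scattering quantum walk `U_𝒮` as a unitary operator on `ℓ²(D)`:
`U_𝒮 |xy⟩ = ∑_{z ∼ x} S_{zy}(x) |zx⟩`. -/
noncomputable def walk (S : ScatteringFamily G) : EdgeSpace G ≃ₗᵢ[ℂ] EdgeSpace G where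
  toFun ψ := ⟨walkFun S ψ, by
    have h := (memℓp_two_iff _).1 (lp.memℓp ψ)
    exact (memℓp_two_iff _).2 (by rwa [tsum_enorm_walkFun])⟩
  invFun ψ := ⟨walkInvFun S ψ, by
    have h := (memℓp_two_iff _).1 (lp.memℓp ψ)
    refine (memℓp_two_iff _).2 ?_
    rwa [← tsum_enorm_walkFun S, walkFun_invFun]⟩
  map_add' ψ χ := by
    ext e
    exact congrFun (Matrix.mulVec_add (S e.1.2).1 (fun y => ψ (inEdge G ⟨e.1.2, y⟩))
      (fun y => χ (inEdge G ⟨e.1.2, y⟩))) _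
  map_smul' a ψ := by
    ext e
    exact congrFun (Matrix.mulVec_smul (S e.1.2).1 a (fun y => ψ (inEdge G ⟨e.1.2, y⟩))) _
  left_inv ψ := by
    ext e
    exact congrFun (walkInvFun_fun S ψ) e
  right_inv ψ := by
    ext e
    exact congrFun (walkFun_invFun S ψ) e
  norm_map' ψ := norm_eq_of_tsum_eq _ _ (tsum_enorm_walkFun S ψ)

theorem walk_ket (S : ScatteringFamily G) {x y : V} (h : G.Adj x y) :
    walk S (ket ⟨(x, y), h⟩) =
      ∑ z : G.neighborSet x, (S x).1 z ⟨y, h⟩ • ket (outEdge G ⟨x, z⟩) := by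
  ext e
  obtain ⟨⟨z', x'⟩, hz⟩ := e
  rw [lp.coeFn_sum, Finset.sum_apply]
  change ∑ y' : G.neighborSet x', (S x').1 ⟨z', hz.symm⟩ y' *
    ket ⟨(x, y), h⟩ (inEdge G ⟨x', y'⟩) = _
  simp only [ket, lp.coeFn_smul, Pi.smul_apply, lp.single_apply, smul_eq_mul]
  by_cases hx : x' = x
  · subst hx
    rw [Finset.sum_eq_single (⟨y, h⟩ : G.neighborSet x'),
      Finset.sum_eq_single (⟨z', hz.symm⟩ : G.neighborSet x')]
    · simp [inEdge, outEdge]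
    · intro b _ hb
      have : (⟨(z', x'), hz⟩ : DirEdge G) ≠ outEdge G ⟨x', b⟩ := by
        intro h'
        apply hb
        have := congrArg (fun e : DirEdge G => e.1.1) h'
        exact Subtype.ext this.symm
      simp [this]
    · simp
    · intro b _ hb
      have : inEdge G ⟨x', b⟩ ≠ (⟨(x', y), h⟩ : DirEdge G) := by
        intro h'
        apply hb
        have := congrArg (fun e : DirEdge G => e.1.2) h'
        exact Subtype.ext this
      simp [this]
    · simp
  · rw [Finset.sum_eq_zero, Finset.sum_eq_zero]
    · intro b _
      have : (⟨(z', x'), hz⟩ : DirEdge G) ≠ outEdge G ⟨x, b⟩ := by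
        intro h'
        exact hx (congrArg (fun e : DirEdge G => e.1.2) h')
      simp [this]
    · intro b _
      have : inEdge G ⟨x', b⟩ ≠ (⟨(x, y), h⟩ : DirEdge G) := by
        intro h'
        exact hx (congrArg (fun e : DirEdge G => e.1.1) h')
      simp [this]

/-- The torus `𝕋 = ℝ / 2πℤ`; its `volume` is the Lebesgue measure `dθ`, of total mass `2π`. -/
abbrev Torus : Type := AddCircle (2 * Real.pi)

instance instFactTwoPiPos : Fact (0 < 2 * Real.pi) := ⟨Real.two_pi_pos⟩

/-- The scattering matrices `e^{iθ_x} S(x)` for phases `θ_x ∈ 𝕋`. -/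
noncomputable def phaseFamily (θ : V → Torus) (S : ScatteringFamily G) : ScatteringFamily G :=
  fun x => ⟨((AddCircle.toCircle (θ x) : Circle) : ℂ) • (S x).1, by
    have h : (S x).1 * star (S x).1 = 1 := (Matrix.mem_unitaryGroup_iff).1 (S x).2
    rw [Matrix.mem_unitaryGroup_iff, star_smul, smul_mul_smul_comm, h, RCLike.star_def,
      Complex.mul_conj, Circle.normSq_coe, Complex.ofReal_one, one_smul]⟩

/-- The random scattering quantum walk `U_ω`, at given values `θ` of the random phases. -/
noncomputable def randomWalk (S : ScatteringFamily G) (θ : V → Torus) :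
    EdgeSpace G ≃ₗᵢ[ℂ] EdgeSpace G :=
  walk (phaseFamily θ S)

end Walk

open Classical in
/-- `e^{-g d(x, x')}` for the graph distance `d`, with the usual conventions `d(x, x') = ∞` and
`e^{-∞} = 0` for vertices in different connected components. -/
noncomputable def expDecay (G : SimpleGraph V) (g : ℝ) (x x' : V) : ℝ :=
  if G.Reachable x x' then Real.exp (-g * (G.dist x x' : ℝ)) else 0

end ScatteringWalk

/-! At `S = 1` every vertex reflects: the walk sends `|xy⟩` to `e^{iθ_x}|yx⟩` and splits into one
two-dimensional block per edge, whose resolvent `(1 - ζU)⁻¹` has the denominator `1 - ζ² e^{i(θ_x +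
θ_y)}`. The proof is the fractional moment method around this decoupled walk, with bounds uniform in
`|ζ| < 1`; hence no restriction on `I`.

One step. Following an edge to its reverse and back (`resolventElem_flip`) bounds this denominator
times the resolvent element from `e` to `(xy)` by `φ` times the sum of the elements from `e` to the
edges at `x` and `y` (`norm_resolventElem_mul_le`). These elements depend on the same two phases;
the resolvent identity `resolventElem_change` expresses them by elements at other values of these
phases and a random factor local to `x`, `y`. The factor has finite mean: a common rotation `w` of
both phases enters through functions analytic in the disc with positive real part, and Kolmogorov's
theorem bounds the mean of their square roots by the value at `w = 0`. The bounded density reduces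
two independent phases to such a rotation. Each step gains a multiple of `φ^{1/4}`, and iteration
gives `fracMoment_le_pow`.

Second moments. For unitary `U`, `(1 - |ζ|²)` times a squared resolvent element is at most the real
part of a Herglotz function, which has mean one over a rotation. Interpolating this with the
fractional moments transfers their decay to weighted second moments (`secondMoment_le_of_dist`).

Dynamics. All elements `⟨e, U ^ n P_I f⟩` are bounded by the lower limit, as `r → 1`, of the `L¹`
norms of the Poisson kernel (`inner_zpow_spectralProjection_le`). That kernel is `(1 - |ζ|²)` times
an inner product of two resolvent vectors, so Cauchy–Schwarz, a summation over the graph and Fatou's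
lemma finish the proof. The spectral projection is handled as a strong limit of trigonometric
polynomials in `U`, which also yields measurability. -/

namespace ScatteringWalk
open Filter Topology

/-! ### Trigonometric polynomials -/

section TrigPolynomials

variable {H : Type*} [NormedAddCommGroup H] [InnerProductSpace ℂ H]

/-- The monomial `z ↦ z ^ n` on the circle. -/
noncomputable def circleMonomial (n : ℤ) : C(Circle, ℂ) :=
  ⟨fun z => (z : ℂ) ^ n, by
    have : (fun z : Circle => (z : ℂ) ^ n) = fun z : Circle => ((z ^ n : Circle) : ℂ) := by
      funext z; simp
    rw [this]
    exact continuous_subtype_val.comp (continuous_zpow n)⟩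

@[simp] theorem circleMonomial_apply (n : ℤ) (z : Circle) :
    circleMonomial n z = (z : ℂ) ^ n := rfl

/-- The trigonometric polynomial with given coefficients, as a function on the circle. -/
noncomputable def trigFun : (ℤ →₀ ℂ) →ₗ[ℂ] C(Circle, ℂ) :=
  Finsupp.linearCombination ℂ circleMonomial

/-- The trigonometric polynomial with given coefficients, evaluated at a unitary operator and
applied to a vector. -/
noncomputable def trigVec (U : H ≃ₗᵢ[ℂ] H) (ψ : H) : (ℤ →₀ ℂ) →ₗ[ℂ] H :=
  Finsupp.linearCombination ℂ fun n : ℤ => (U ^ n) ψ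

theorem trigFun_single (n : ℤ) (a : ℂ) (z : Circle) :
    trigFun (Finsupp.single n a) z = a * (z : ℂ) ^ n := by
  simp [trigFun]

theorem trigVec_single (U : H ≃ₗᵢ[ℂ] H) (ψ : H) (n : ℤ) (a : ℂ) :
    trigVec U ψ (Finsupp.single n a) = a • (U ^ n) ψ := by
  simp [trigVec]

theorem zpow_add_apply (U : H ≃ₗᵢ[ℂ] H) (m n : ℤ) (ψ : H) :
    (U ^ (m + n)) ψ = (U ^ m) ((U ^ n) ψ) := by
  rw [zpow_add]
  rfl

theorem inner_zpow_zpow (U : H ≃ₗᵢ[ℂ] H) (ψ χ : H) (m n : ℤ) :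
    inner ℂ ((U ^ m) ψ) ((U ^ n) χ) = inner ℂ ψ ((U ^ (n - m)) χ) := by
  have : (U ^ n) χ = (U ^ m) ((U ^ (n - m)) χ) := by
    rw [← zpow_add_apply, add_sub_cancel]
  rw [this, LinearIsometryEquiv.inner_map_map]

theorem inner_zpow_left (U : H ≃ₗᵢ[ℂ] H) (ψ χ : H) (n : ℤ) :
    inner ℂ ((U ^ n) ψ) χ = inner ℂ ψ ((U ^ (-n)) χ) := by
  simpa using inner_zpow_zpow U ψ χ n 0

theorem conj_circle_zpow (z : Circle) (n : ℤ) :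
    (starRingEnd ℂ) ((z : ℂ) ^ n) = (z : ℂ) ^ (-n) := by
  rw [map_zpow₀, ← Circle.coe_inv_eq_conj, Circle.coe_inv, inv_zpow, zpow_neg]

theorem integrable_continuousMap (m : Measure Circle) [IsFiniteMeasure m] (h : C(Circle, ℂ)) :
    Integrable h m :=
  (BoundedContinuousFunction.mkOfCompact h).integrable m

/-- Sesquilinearity reduces this to monomials, where it is the defining moment identity. It makes `p
↦ p(U)ψ` isometric from `L²(m)`: the functional calculus on which everything spectral rests. -/
theorem IsSpectralMeasure.inner_trigVec {U : H ≃ₗᵢ[ℂ] H} {ψ : H} {m : Measure Circle}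
    (hm : IsSpectralMeasure U ψ m) (a b : ℤ →₀ ℂ) (n : ℤ) :
    inner ℂ (trigVec U ψ a) ((U ^ n) (trigVec U ψ b)) =
      ∫ z : Circle, (starRingEnd ℂ) (trigFun a z) * (z : ℂ) ^ n * trigFun b z ∂m := by
  have := hm.1
  have hint : ∀ a b : ℤ →₀ ℂ, Integrable (fun z : Circle =>
      (starRingEnd ℂ) (trigFun a z) * (z : ℂ) ^ n * trigFun b z) m := fun a b =>
    integrable_continuousMap m (star (trigFun a) * circleMonomial n * trigFun b)
  induction a using Finsupp.induction_linear with
  | zero => simp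
  | add a a' ha ha' =>
    rw [map_add, inner_add_left, ha, ha', ← integral_add (hint _ _) (hint _ _)]
    congr 1; ext z
    simp; ring
  | single k α =>
    induction b using Finsupp.induction_linear with
    | zero => simp
    | add b b' hb hb' =>
      rw [map_add, map_add, inner_add_right, hb, hb', ← integral_add (hint _ _) (hint _ _)]
      congr 1; ext z
      simp; ring
    | single l β =>
      rw [trigVec_single, trigVec_single, map_smul, ← zpow_add_apply,
        inner_smul_left, inner_smul_right, inner_zpow_zpow, hm.2, ← mul_assoc,
        ← integral_const_mul]
      congr 1; ext z
      rw [trigFun_single, trigFun_single, map_mul, conj_circle_zpow,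
        show n + l - k = -k + n + l by ring, zpow_add₀ (Circle.coe_ne_zero z),
        zpow_add₀ (Circle.coe_ne_zero z)]
      ring

theorem IsSpectralMeasure.norm_sq_trigVec {U : H ≃ₗᵢ[ℂ] H} {ψ : H} {m : Measure Circle}
    (hm : IsSpectralMeasure U ψ m) (a : ℤ →₀ ℂ) :
    ‖trigVec U ψ a‖ ^ 2 = ∫ z : Circle, ‖trigFun a z‖ ^ 2 ∂m := by
  have h := hm.inner_trigVec a a 0
  rw [zpow_zero, LinearIsometryEquiv.coe_one, id_eq, inner_self_eq_norm_sq_to_K] at h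
  have h2 : ∀ z : Circle, (starRingEnd ℂ) (trigFun a z) * (z : ℂ) ^ (0 : ℤ) * trigFun a z
      = ((‖trigFun a z‖ ^ 2 : ℝ) : ℂ) := by
    intro z
    rw [zpow_zero, mul_one, Complex.conj_mul']
    simp
  simp_rw [h2] at h
  rw [integral_complex_ofReal] at h
  exact Complex.ofReal_injective (by rw [← h]; simp)

theorem exists_trigFun_near (h : C(Circle, ℂ)) {ε : ℝ} (hε : 0 < ε) :
    ∃ a : ℤ →₀ ℂ, ∀ z : Circle, ‖trigFun a z - h z‖ < ε := by
  let q : C(Torus, ℂ) := h.comp ⟨fun θ : Torus => AddCircle.toCircle θ, AddCircle.continuous_toCircle⟩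
  have hq : q ∈ (Submodule.span ℂ (Set.range (@fourier (2 * Real.pi)))).topologicalClosure := by
    rw [span_fourier_closure_eq_top]; trivial
  obtain ⟨p, hp, hpε⟩ := Metric.mem_closure_iff.1 hq ε hε
  obtain ⟨a, rfl⟩ := (Finsupp.mem_span_range_iff_exists_finsupp).1 hp
  refine ⟨a, fun z => ?_⟩
  obtain ⟨θ, rfl⟩ := (AddCircle.homeomorphCircle (T := 2 * Real.pi) Real.two_pi_pos.ne').surjective z
  have h1 := (ContinuousMap.dist_lt_iff hε).1 hpε θ
  rw [dist_comm, dist_eq_norm] at h1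
  convert h1 using 2
  congr 1
  simp only [trigFun, Finsupp.linearCombination_apply, Finsupp.sum, ContinuousMap.coe_sum,
    Finset.sum_apply, ContinuousMap.coe_smul, Pi.smul_apply, circleMonomial_apply,
    AddCircle.homeomorphCircle_apply, fourier_apply, AddCircle.toCircle_zsmul, Circle.coe_zpow]
  rfl

end TrigPolynomials

end ScatteringWalk

namespace ScatteringWalk
open Filter Topology

/-! ### The spectral projection as a limit of trigonometric polynomials -/

section SpectralProjection

/-- A sequence of trigonometric polynomials, essentially bounded by `1`, that converges in
`L¹(m)` to the indicator function of `I`. -/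
def IndicatorApprox (m : Measure Circle) (I : Set Circle) (c : ℕ → ℤ →₀ ℂ) : Prop :=
  (∀ k z, ‖trigFun (c k) z‖ ≤ 1 + 1 / ((k : ℝ) + 1)) ∧
    Tendsto (fun k => ∫ z, ‖trigFun (c k) z - I.indicator 1 z‖ ∂m) atTop (𝓝 0)

/-- Inner regularity shrinks `I` to a closed set, whose indicator is approximated by a continuous
function of norm at most one, and this one uniformly by a polynomial. -/
theorem exists_trigFun_sub_indicator_le (m : Measure Circle) [IsFiniteMeasure m] {I : Set Circle}
    (hI : MeasurableSet I) {δ : ℝ} (hδ : 0 < δ) :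
    ∃ a : ℤ →₀ ℂ, (∀ z, ‖trigFun a z‖ ≤ 1 + δ) ∧
      ∫ z, ‖trigFun a z - I.indicator 1 z‖ ∂m ≤ δ := by
  set M : ℝ := m.real Set.univ with hM
  have hM0 : 0 ≤ M := measureReal_nonneg
  -- Three errors are paid from `δ`: `η * M` for the uniform approximation, `η` for the continuous
  -- function and `η` for the mass of `I \ F`.
  obtain ⟨η, hη, hηδ, hη2⟩ : ∃ η : ℝ, 0 < η ∧ η ≤ δ ∧ η * M + η + η ≤ δ := by
    refine ⟨δ / (M + 2), by positivity, div_le_self hδ.le (by linarith), ?_⟩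
    have : δ / (M + 2) * M + δ / (M + 2) + δ / (M + 2) = δ := by field_simp; ring
    linarith
  obtain ⟨F, hFI, hF, hFm⟩ := hI.exists_isClosed_sdiff_lt (μ := m) (measure_ne_top m I)
    (ENNReal.ofReal_pos.2 hη).ne'
  obtain ⟨h, hc, hle, hb, -, hmem⟩ := exists_continuous_eLpNorm_sub_le_of_closed (μ := m) (p := 1)
    (by simp) hF isOpen_univ (Set.subset_univ F) (measure_ne_top m F) (1 : ℂ)
    (ENNReal.ofReal_pos.2 hη).ne'
  obtain ⟨a, ha⟩ := exists_trigFun_near ⟨h, hc⟩ hη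
  have hind : ∀ J : Set Circle, MeasurableSet J → Integrable (J.indicator (1 : Circle → ℂ)) m :=
    fun J hJ => (integrable_const (1 : ℂ)).indicator hJ
  have hi1 : Integrable (fun z => trigFun a z - h z) m :=
    (integrable_continuousMap m _).sub (integrable_continuousMap m ⟨h, hc⟩)
  have hi2 : Integrable (fun z => h z - F.indicator 1 z) m :=
    (integrable_continuousMap m ⟨h, hc⟩).sub (hind F hF.measurableSet)
  have hi3 : Integrable (fun z => F.indicator (1 : Circle → ℂ) z - I.indicator 1 z) m :=
    (hind F hF.measurableSet).sub (hind I hI)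
  refine ⟨a, fun z => ?_, ?_⟩
  · have h1 := ha z
    have h2 := hb z
    rw [norm_one] at h2
    have h3 := norm_sub_norm_le (trigFun a z) (h z)
    simp only [ContinuousMap.coe_mk] at h1
    linarith
  · have b1 : ∫ z, ‖trigFun a z - h z‖ ∂m ≤ η * M := by
      calc ∫ z, ‖trigFun a z - h z‖ ∂m ≤ ∫ _, η ∂m :=
            integral_mono hi1.norm (integrable_const _) fun z => (ha z).le
        _ = η * M := by rw [integral_const, smul_eq_mul, mul_comm]
    have b2 : ∫ z, ‖h z - F.indicator 1 z‖ ∂m ≤ η := by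
      rw [integral_norm_eq_lintegral_enorm hi2.1]
      refine ENNReal.toReal_le_of_le_ofReal hη.le ?_
      rw [← eLpNorm_one_eq_lintegral_enorm]
      exact hle
    have b3 : ∫ z, ‖F.indicator (1 : Circle → ℂ) z - I.indicator 1 z‖ ∂m ≤ η := by
      have : ∀ z, ‖F.indicator (1 : Circle → ℂ) z - I.indicator 1 z‖ =
          (I \ F).indicator (1 : Circle → ℝ) z := by
        intro z
        by_cases h1 : z ∈ F
        · simp [h1, hFI h1]
        · by_cases h2 : z ∈ I <;> simp [h1, h2]
      simp_rw [this]
      rw [integral_indicator_one (hI.diff hF.measurableSet)]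
      exact ENNReal.toReal_le_of_le_ofReal hη.le hFm.le
    have : ∀ z, ‖trigFun a z - I.indicator 1 z‖ ≤ ‖trigFun a z - h z‖ +
        ‖h z - F.indicator 1 z‖ + ‖F.indicator (1 : Circle → ℂ) z - I.indicator 1 z‖ := by
      intro z
      refine le_trans (le_of_eq ?_) (norm_add₃_le (a := trigFun a z - h z))
      congr 1; ring
    calc ∫ z, ‖trigFun a z - I.indicator 1 z‖ ∂m ≤ ∫ z, (‖trigFun a z - h z‖ +
        ‖h z - F.indicator 1 z‖ + ‖F.indicator (1 : Circle → ℂ) z - I.indicator 1 z‖) ∂m :=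
          integral_mono ((integrable_continuousMap m _).sub (hind I hI)).norm
            ((hi1.norm.add hi2.norm).add hi3.norm) this
      _ ≤ δ := by
        have e1 := integral_add (hi1.norm.add hi2.norm) hi3.norm
        have e2 := integral_add hi1.norm hi2.norm
        simp only [Pi.add_apply] at e1
        linarith

theorem exists_indicatorApprox (m : Measure Circle) [IsFiniteMeasure m] {I : Set Circle}
    (hI : MeasurableSet I) : ∃ c, IndicatorApprox m I c := by
  have := fun k : ℕ => exists_trigFun_sub_indicator_le m hI (Nat.one_div_pos_of_nat (α := ℝ) (n := k))
  choose c hc using this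
  refine ⟨c, fun k => (hc k).1, ?_⟩
  exact squeeze_zero (fun k => integral_nonneg fun _ => norm_nonneg _) (fun k => (hc k).2)
    tendsto_one_div_add_atTop_nhds_zero_nat

variable {m : Measure Circle} {I : Set Circle} {c c' : ℕ → ℤ →₀ ℂ}

theorem integrable_trigFun_sub_indicator [IsFiniteMeasure m] (hI : MeasurableSet I) (a : ℤ →₀ ℂ) :
    Integrable (fun z => trigFun a z - I.indicator 1 z) m :=
  (integrable_continuousMap m _).sub ((integrable_const (1 : ℂ)).indicator hI)

theorem IndicatorApprox.norm_le_two (hc : IndicatorApprox m I c) (k : ℕ) (z : Circle) :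
    ‖trigFun (c k) z‖ ≤ 2 := by
  refine (hc.1 k z).trans ?_
  have : 1 / ((k : ℝ) + 1) ≤ 1 := by
    rw [div_le_one (by positivity)]
    have : (0 : ℝ) ≤ k := Nat.cast_nonneg k
    linarith
  linarith

theorem IndicatorApprox.mono {m' : Measure Circle} [IsFiniteMeasure m] (hI : MeasurableSet I)
    (hc : IndicatorApprox m I c) (h : m' ≤ m) : IndicatorApprox m' I c := by
  refine ⟨hc.1, squeeze_zero (fun k => integral_nonneg fun _ => norm_nonneg _) (fun k => ?_) hc.2⟩
  exact integral_mono_measure h (ae_of_all _ fun _ => norm_nonneg _)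
    (integrable_trigFun_sub_indicator hI _).norm

/-- Integrals against a bounded continuous factor converge. -/
theorem IndicatorApprox.tendsto_integral [IsFiniteMeasure m] (hI : MeasurableSet I)
    (hc : IndicatorApprox m I c) :
    Tendsto (fun k => ∫ z, trigFun (c k) z ∂m) atTop (𝓝 (m.real I : ℂ)) := by
  rw [tendsto_iff_norm_sub_tendsto_zero]
  refine squeeze_zero (fun _ => norm_nonneg _) (fun k => ?_) hc.2
  have : (m.real I : ℂ) = ∫ z, I.indicator 1 z ∂m := by
    have h := integral_indicator_const (μ := m) (1 : ℂ) hI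
    rw [Complex.real_smul, mul_one] at h
    exact h.symm
  rw [this, ← integral_sub (f := fun z => trigFun (c k) z) (g := fun z => I.indicator 1 z)
    (integrable_continuousMap m _) ((integrable_const (1 : ℂ)).indicator hI)]
  exact norm_integral_le_integral_norm _

theorem norm_indicator_one_le (I : Set Circle) (z : Circle) :
    ‖I.indicator (1 : Circle → ℂ) z‖ ≤ 1 := by
  by_cases h : z ∈ I <;> simp [h]

/-- Identifies the moments of the limit of `p_k(U)ψ`: its spectral measure will be `m` restricted to
`I`. The constant 3 comes from the bounds 2 for `p_k` and 1 for the indicator. -/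
theorem IndicatorApprox.tendsto_integral_sq [IsFiniteMeasure m] (hI : MeasurableSet I)
    (hc : IndicatorApprox m I c) (n : ℤ) :
    Tendsto (fun k => ∫ z, (starRingEnd ℂ) (trigFun (c k) z) * (z : ℂ) ^ n * trigFun (c k) z ∂m)
      atTop (𝓝 (∫ z, (z : ℂ) ^ n ∂(m.restrict I))) := by
  rw [tendsto_iff_norm_sub_tendsto_zero]
  have h3 : Tendsto (fun k => 3 * ∫ z, ‖trigFun (c k) z - I.indicator 1 z‖ ∂m) atTop (𝓝 0) := by
    simpa using hc.2.const_mul 3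
  refine squeeze_zero (fun _ => norm_nonneg _) (fun k => ?_) h3
  have hz : Integrable (fun z : Circle => (z : ℂ) ^ n) m :=
    integrable_continuousMap m (circleMonomial n)
  rw [← integral_indicator hI, ← integral_sub
    (f := fun z => (starRingEnd ℂ) (trigFun (c k) z) * (z : ℂ) ^ n * trigFun (c k) z)
    (g := fun x => I.indicator (fun z : Circle => (z : ℂ) ^ n) x)
    (integrable_continuousMap m (star (trigFun (c k)) * circleMonomial n * trigFun (c k)))
    (hz.indicator hI)]
  refine (norm_integral_le_integral_norm _).trans ?_
  rw [← integral_const_mul]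
  refine integral_mono_of_nonneg (ae_of_all _ fun _ => norm_nonneg _)
    ((integrable_trigFun_sub_indicator hI _).norm.const_mul 3) (ae_of_all _ fun z => ?_)
  set t := trigFun (c k) z with ht
  have ht2 : ‖t‖ ≤ 2 := hc.norm_le_two k z
  set i := I.indicator (1 : Circle → ℂ) z with hi
  have hi1 : ‖i‖ ≤ 1 := norm_indicator_one_le I z
  have e1 : (I.indicator (fun z : Circle => (z : ℂ) ^ n) z) =
      (z : ℂ) ^ n * ((starRingEnd ℂ) i * i) := by
    by_cases h : z ∈ I <;> simp [hi, h]
  have e2 : (starRingEnd ℂ) t * (z : ℂ) ^ n * t - (z : ℂ) ^ n * ((starRingEnd ℂ) i * i) =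
      (z : ℂ) ^ n * ((starRingEnd ℂ) t * (t - i) + (starRingEnd ℂ) (t - i) * i) := by
    rw [map_sub]; ring
  have hzn : ‖(z : ℂ) ^ n‖ = 1 := by rw [norm_zpow, Circle.norm_coe, one_zpow]
  beta_reduce
  rw [e1, e2, norm_mul, hzn, one_mul]
  refine (norm_add_le _ _).trans ?_
  rw [norm_mul, norm_mul, RCLike.norm_conj, RCLike.norm_conj]
  nlinarith [norm_nonneg (t - i)]

/-- One of the two factors of the square is at most `2 + 1`, so `L¹` convergence becomes `L²`
convergence. -/
theorem integral_norm_sq_trigFun_le [IsFiniteMeasure m] (hI : MeasurableSet I) {a : ℤ →₀ ℂ}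
    (ha : ∀ z, ‖trigFun a z‖ ≤ 2) :
    ∫ z, ‖trigFun a z - I.indicator 1 z‖ ^ 2 ∂m ≤
      3 * ∫ z, ‖trigFun a z - I.indicator 1 z‖ ∂m := by
  rw [← integral_const_mul]
  refine integral_mono_of_nonneg (ae_of_all _ fun _ => by positivity)
    ((integrable_trigFun_sub_indicator hI _).norm.const_mul 3) (ae_of_all _ fun z => ?_)
  have h1 := norm_sub_le (trigFun a z) (I.indicator (1 : Circle → ℂ) z)
  have h2 := norm_indicator_one_le I z
  have h3 := ha z
  beta_reduce
  rw [sq]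
  gcongr
  linarith

theorem integrable_norm_sq_trigFun [IsFiniteMeasure m] (hI : MeasurableSet I) {a : ℤ →₀ ℂ}
    (ha : ∀ z, ‖trigFun a z‖ ≤ 2) :
    Integrable (fun z => ‖trigFun a z - I.indicator 1 z‖ ^ 2) m := by
  have hi := integrable_trigFun_sub_indicator (m := m) hI a
  refine (hi.norm.const_mul 3).mono' (hi.1.norm.pow 2) (ae_of_all _ fun z => ?_)
  have h1 := norm_sub_le (trigFun a z) (I.indicator (1 : Circle → ℂ) z)
  have h2 := norm_indicator_one_le I z
  have h3 := ha z
  rw [Real.norm_of_nonneg (by positivity), sq]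
  gcongr
  linarith

variable {H : Type*} [NormedAddCommGroup H] [InnerProductSpace ℂ H] {U : H ≃ₗᵢ[ℂ] H} {ψ φ : H}

theorem IsSpectralMeasure.norm_sub_sq_le (hm : IsSpectralMeasure U ψ m) (hI : MeasurableSet I)
    {a b : ℤ →₀ ℂ} (ha : ∀ z, ‖trigFun a z‖ ≤ 2) (hb : ∀ z, ‖trigFun b z‖ ≤ 2) :
    ‖trigVec U ψ a - trigVec U ψ b‖ ^ 2 ≤ 6 * (∫ z, ‖trigFun a z - I.indicator 1 z‖ ∂m) +
      6 * ∫ z, ‖trigFun b z - I.indicator 1 z‖ ∂m := by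
  have := hm.1
  rw [← map_sub, hm.norm_sq_trigVec]
  have hA := integral_norm_sq_trigFun_le (m := m) hI ha
  have hB := integral_norm_sq_trigFun_le (m := m) hI hb
  have iA := integrable_norm_sq_trigFun (m := m) hI ha
  have iB := integrable_norm_sq_trigFun (m := m) hI hb
  have : ∫ z, ‖trigFun (a - b) z‖ ^ 2 ∂m ≤ ∫ z, (2 * ‖trigFun a z - I.indicator 1 z‖ ^ 2 +
      2 * ‖trigFun b z - I.indicator 1 z‖ ^ 2) ∂m := by
    refine integral_mono_of_nonneg (ae_of_all _ fun _ => by positivity)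
      ((iA.const_mul 2).add (iB.const_mul 2)) (ae_of_all _ fun z => ?_)
    have h1 := norm_sub_le (trigFun a z - I.indicator (1 : Circle → ℂ) z)
      (trigFun b z - I.indicator (1 : Circle → ℂ) z)
    have h2 : trigFun (a - b) z = (trigFun a z - I.indicator (1 : Circle → ℂ) z) -
      (trigFun b z - I.indicator (1 : Circle → ℂ) z) := by
      rw [map_sub, ContinuousMap.sub_apply]; ring
    beta_reduce
    rw [h2]
    nlinarith [norm_nonneg (trigFun a z - I.indicator (1 : Circle → ℂ) z - (trigFun b z - I.indicator (1 : Circle → ℂ) z)), sq_nonneg (‖trigFun a z - I.indicator (1 : Circle → ℂ) z‖ - ‖trigFun b z - I.indicator (1 : Circle → ℂ) z‖)]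
  rw [integral_add (iA.const_mul 2) (iB.const_mul 2), integral_const_mul, integral_const_mul] at this
  linarith

theorem tendsto_zero_of_norm_sq {E : Type*} [NormedAddCommGroup E] {v : ℕ → E}
    (h : Tendsto (fun k => ‖v k‖ ^ 2) atTop (𝓝 0)) :
    Tendsto v atTop (𝓝 0) := by
  rw [tendsto_zero_iff_norm_tendsto_zero]
  have := (Real.continuous_sqrt.tendsto 0).comp h
  rw [Real.sqrt_zero] at this
  exact this.congr fun k => Real.sqrt_sq (norm_nonneg _)

theorem IndicatorApprox.tendsto_sub (hm : IsSpectralMeasure U ψ m) (hI : MeasurableSet I)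
    (hc : IndicatorApprox m I c) (hc' : IndicatorApprox m I c') :
    Tendsto (fun k => trigVec U ψ (c k) - trigVec U ψ (c' k)) atTop (𝓝 0) := by
  have h : Tendsto (fun k => ‖trigVec U ψ (c k) - trigVec U ψ (c' k)‖ ^ 2) atTop (𝓝 0) := by
    have := (hc.2.const_mul 6).add (hc'.2.const_mul 6)
    simp only [mul_zero, add_zero] at this
    exact squeeze_zero (fun _ => by positivity)
      (fun k => hm.norm_sub_sq_le hI (hc.norm_le_two k) (hc'.norm_le_two k)) this
  exact tendsto_zero_of_norm_sq h

theorem IndicatorApprox.cauchySeq (hm : IsSpectralMeasure U ψ m) (hI : MeasurableSet I)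
    (hc : IndicatorApprox m I c) : CauchySeq fun k => trigVec U ψ (c k) := by
  rw [Metric.cauchySeq_iff']
  intro ε hε
  have h := (hc.2.const_mul 6)
  rw [mul_zero] at h
  obtain ⟨N, hN⟩ := eventually_atTop.1 (h.eventually_lt_const (show 0 < ε ^ 2 / 2 by positivity))
  refine ⟨N, fun n hn => ?_⟩
  rw [dist_eq_norm]
  have h1 := hm.norm_sub_sq_le hI (hc.norm_le_two n) (hc.norm_le_two N)
  have h2 := hN n hn
  have h3 := hN N le_rfl
  exact lt_of_pow_lt_pow_left₀ 2 hε.le (by linarith)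

theorem inner_trigVec_left (U : H ≃ₗᵢ[ℂ] H) (a : ℤ →₀ ℂ) :
    ∃ b : ℤ →₀ ℂ, (∀ z, trigFun b z = (starRingEnd ℂ) (trigFun a z)) ∧
      ∀ φ ψ : H, inner ℂ φ (trigVec U ψ a) = inner ℂ (trigVec U φ b) ψ := by
  induction a using Finsupp.induction_linear with
  | zero => exact ⟨0, by simp, by simp⟩
  | add a a' ha ha' =>
    obtain ⟨b, hb, hb2⟩ := ha
    obtain ⟨b', hb', hb2'⟩ := ha'
    exact ⟨b + b', fun z => by simp [hb, hb'],
      fun φ ψ => by rw [map_add, map_add, inner_add_left, inner_add_right, hb2, hb2']⟩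
  | single n α =>
    refine ⟨Finsupp.single (-n) ((starRingEnd ℂ) α), fun z => ?_, fun φ ψ => ?_⟩
    · rw [trigFun_single, trigFun_single, map_mul, conj_circle_zpow]
    · rw [trigVec_single, trigVec_single, inner_smul_left, inner_smul_right, inner_zpow_left]
      simp

variable [CompleteSpace H]

/-- The limit lies in the spectral subspace because its spectral measure is `m.restrict I`; the
remainder is orthogonal to every vector whose spectral measure lives on `I`, since `1 - p_k` tends
to zero there. -/
theorem IndicatorApprox.tendsto_spectralProjection (hm : IsSpectralMeasure U ψ m)
    (hI : MeasurableSet I) (hc : IndicatorApprox m I c) :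
    Tendsto (fun k => trigVec U ψ (c k)) atTop (𝓝 (spectralProjection U I ψ)) := by
  have hfin := hm.1
  obtain ⟨η, hη⟩ := cauchySeq_tendsto_of_complete (hc.cauchySeq hm hI)
  suffices h : spectralProjection U I ψ = η by rwa [h]
  have : CompleteSpace (spectralSubspace U I) :=
    inferInstanceAs (CompleteSpace (Submodule.topologicalClosure _))
  refine Submodule.eq_starProjection_of_mem_of_inner_eq_zero (K := spectralSubspace U I) ?_ ?_
  · refine Submodule.le_topologicalClosure _ (Submodule.subset_span ⟨m.restrict I, ⟨inferInstance, ?_⟩, ?_⟩)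
    · intro n
      have h1 : Tendsto (fun k => inner ℂ (trigVec U ψ (c k)) ((U ^ n) (trigVec U ψ (c k)))) atTop
          (𝓝 (inner ℂ η ((U ^ n) η))) :=
        hη.inner (((U ^ n).continuous.tendsto η).comp hη)
      simp_rw [hm.inner_trigVec] at h1
      exact tendsto_nhds_unique h1 (hc.tendsto_integral_sq hI n)
    · rw [Measure.restrict_apply hI.compl, Set.compl_inter_self, measure_empty]
  · intro w hw
    have key : ∀ φ ∈ {φ : H | ∃ m : Measure Circle, IsSpectralMeasure U φ m ∧ m Iᶜ = 0},
        inner ℂ (ψ - η) φ = 0 := by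
      rintro φ ⟨m', hm', hm0⟩
      have hfin' := hm'.1
      -- One sequence must serve both vectors, hence the sum of their spectral measures.
      obtain ⟨e, he⟩ := exists_indicatorApprox (m + m') hI
      have he1 : IndicatorApprox m I e := he.mono hI (Measure.le_add_right le_rfl)
      have he2 : IndicatorApprox m' I e := he.mono hI (Measure.le_add_left le_rfl)
      have hη' : Tendsto (fun k => trigVec U ψ (e k)) atTop (𝓝 η) := by
        have := hη.sub (hc.tendsto_sub hm hI he1)
        simpa using this
      have hlim : Tendsto (fun k => inner ℂ φ (ψ - trigVec U ψ (e k))) atTop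
          (𝓝 (inner ℂ φ (ψ - η))) :=
        tendsto_const_nhds.inner (tendsto_const_nhds.sub hη')
      choose b hb hb2 using fun k => inner_trigVec_left U (Finsupp.single 0 1 - e k)
      have hrw : ∀ k, inner ℂ φ (ψ - trigVec U ψ (e k)) = inner ℂ (trigVec U φ (b k)) ψ := by
        intro k
        rw [← hb2, map_sub, trigVec_single]
        simp
      have hnorm : Tendsto (fun k => ‖trigVec U φ (b k)‖ ^ 2) atTop (𝓝 0) := by
        have h3 : Tendsto (fun k => 3 * ∫ z, ‖trigFun (e k) z - I.indicator 1 z‖ ∂m') atTop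
          (𝓝 0) := by simpa using he2.2.const_mul 3
        refine squeeze_zero (fun _ => by positivity) (fun k => ?_) h3
        refine le_trans (le_of_eq ?_)
          (integral_norm_sq_trigFun_le (m := m') hI (he2.norm_le_two k))
        rw [hm'.norm_sq_trigVec]
        refine integral_congr_ae ?_
        have : ∀ᵐ z ∂m', z ∈ I := by
          rw [ae_iff]; exact hm0
        filter_upwards [this] with z hz
        rw [hb, RCLike.norm_conj, map_sub, ContinuousMap.sub_apply, trigFun_single]
        simp [hz, norm_sub_rev]
      have hv : Tendsto (fun k => trigVec U φ (b k)) atTop (𝓝 0) := tendsto_zero_of_norm_sq hnorm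
      simp_rw [hrw] at hlim
      have hz : Tendsto (fun k => inner ℂ (trigVec U φ (b k)) ψ) atTop (𝓝 0) := by
        simpa using hv.inner (tendsto_const_nhds (x := ψ))
      rw [← inner_conj_symm, tendsto_nhds_unique hlim hz, map_zero]
    have hle : spectralSubspace U I ≤ (Submodule.span ℂ {ψ - η})ᗮ := by
      refine Submodule.topologicalClosure_minimal _ (Submodule.span_le.2 fun φ hφ => ?_)
        (Submodule.isClosed_orthogonal _)
      exact Submodule.mem_orthogonal_singleton_iff_inner_right.2 (key φ hφ)
    exact Submodule.mem_orthogonal_singleton_iff_inner_right.1 (hle hw)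

theorem IsSpectralMeasure.inner_spectralProjection (hm : IsSpectralMeasure U ψ m)
    (hI : MeasurableSet I) : inner ℂ ψ (spectralProjection U I ψ) = (m.real I : ℂ) := by
  have hfin := hm.1
  obtain ⟨c, hc⟩ := exists_indicatorApprox m hI
  have h1 : Tendsto (fun k => inner ℂ ψ (trigVec U ψ (c k))) atTop
      (𝓝 (inner ℂ ψ (spectralProjection U I ψ))) :=
    tendsto_const_nhds.inner (hc.tendsto_spectralProjection hm hI)
  refine tendsto_nhds_unique h1 ?_
  convert hc.tendsto_integral hI using 2 with k
  have := hm.inner_trigVec (Finsupp.single 0 1) (c k) 0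
  simpa [trigVec_single, trigFun_single] using this

end SpectralProjection

end ScatteringWalk

namespace ScatteringWalk
open Filter Topology AddCircle

/-! ### Resolvents and Poisson kernels of unitary operators -/

section Poisson

variable {H : Type*} [NormedAddCommGroup H] [InnerProductSpace ℂ H]

/-- A unitary as a bounded operator. -/
noncomputable abbrev unitaryOp (U : H ≃ₗᵢ[ℂ] H) : H →L[ℂ] H :=
  (U.toContinuousLinearEquiv : H →L[ℂ] H)

/-- `(1 - A)⁻¹`. -/
noncomputable def geomOp (A : H →L[ℂ] H) : H →L[ℂ] H := Ring.inverse (1 - A)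

theorem norm_smul_unitaryOp_le (U : H ≃ₗᵢ[ℂ] H) (ζ : ℂ) : ‖ζ • unitaryOp U‖ ≤ ‖ζ‖ := by
  refine ContinuousLinearMap.opNorm_le_bound _ (norm_nonneg _) fun v => ?_
  simp [norm_smul]

theorem smul_unitaryOp_pow_apply (U : H ≃ₗᵢ[ℂ] H) (ζ : ℂ) (k : ℕ) (f : H) :
    ((ζ • unitaryOp U) ^ k) f = ζ ^ k • (U ^ (k : ℤ)) f := by
  induction k with
  | zero => simp
  | succ k ih =>
    rw [pow_succ', mul_apply_eq_comp, ih, Nat.cast_succ, add_comm (k : ℤ) 1,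
      zpow_add_apply, zpow_one]
    simp [pow_succ, mul_smul]

theorem norm_smul_unitaryOp_lt {U : H ≃ₗᵢ[ℂ] H} {ζ : ℂ} (hζ : ‖ζ‖ < 1) : ‖ζ • unitaryOp U‖ < 1 :=
  (norm_smul_unitaryOp_le U ζ).trans_lt hζ

theorem norm_inner_zpow_le (U : H ≃ₗᵢ[ℂ] H) (e f : H) (n : ℤ) :
    ‖inner ℂ e ((U ^ n) f)‖ ≤ ‖e‖ * ‖f‖ := by
  refine (norm_inner_le_norm _ _).trans_eq ?_
  rw [LinearIsometryEquiv.norm_map]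

variable [CompleteSpace H] {A : H →L[ℂ] H} {U : H ≃ₗᵢ[ℂ] H} {ζ : ℂ}

theorem geomOp_mul (hA : ‖A‖ < 1) : geomOp A * (1 - A) = 1 :=
  Ring.inverse_mul_cancel _ (isUnit_one_sub_of_norm_lt_one hA)

theorem mul_geomOp (hA : ‖A‖ < 1) : (1 - A) * geomOp A = 1 :=
  Ring.mul_inverse_cancel _ (isUnit_one_sub_of_norm_lt_one hA)

theorem geomOp_apply_sub (hA : ‖A‖ < 1) (v : H) : geomOp A (v - A v) = v := by
  simpa using congrArg (fun B : H →L[ℂ] H => B v) (geomOp_mul hA)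

theorem sub_geomOp_apply (hA : ‖A‖ < 1) (v : H) : geomOp A v - A (geomOp A v) = v := by
  simpa using congrArg (fun B : H →L[ℂ] H => B v) (mul_geomOp hA)

theorem geomOp_apply_map (hA : ‖A‖ < 1) (v : H) : geomOp A (A v) = geomOp A v - v := by
  have := geomOp_apply_sub hA v
  rw [map_sub] at this
  rw [eq_sub_iff_add_eq', ← eq_sub_iff_add_eq]
  exact this.symm

theorem adjoint_geomOp_sub (hA : ‖A‖ < 1) (v : H) :
    (geomOp A).adjoint v - A.adjoint ((geomOp A).adjoint v) = v := by
  refine ext_inner_right ℂ fun w => ?_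
  rw [inner_sub_left, ContinuousLinearMap.adjoint_inner_left, ContinuousLinearMap.adjoint_inner_left,
    ContinuousLinearMap.adjoint_inner_left, geomOp_apply_map hA, inner_sub_right]
  ring

theorem hasSum_inner_geomOp (U : H ≃ₗᵢ[ℂ] H) (hζ : ‖ζ‖ < 1) (e f : H) :
    HasSum (fun k : ℕ => ζ ^ k * inner ℂ e ((U ^ (k : ℤ)) f))
      (inner ℂ e (geomOp (ζ • unitaryOp U) f)) := by
  have h := hasSum_geom_series_inverse (ζ • unitaryOp U) (norm_smul_unitaryOp_lt hζ)
  have h2 : HasSum (fun k => inner ℂ e (((ζ • unitaryOp U) ^ k) f))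
      (inner ℂ e (geomOp (ζ • unitaryOp U) f)) :=
    h.mapL ((innerSL ℂ e).comp (ContinuousLinearMap.apply ℂ H f))
  simpa only [smul_unitaryOp_pow_apply, inner_smul_right] using h2

/-- The matrix elements of the Poisson kernel of `U`. -/
noncomputable def poissonElem (U : H ≃ₗᵢ[ℂ] H) (ζ : ℂ) (e f : H) : ℂ :=
  inner ℂ e (geomOp (ζ • unitaryOp U) f) +
    (starRingEnd ℂ) (inner ℂ f (geomOp (ζ • unitaryOp U) e)) - inner ℂ e f

/-- With `a`, `b` the images of `e`, `f` under the adjoint resolvent, `e = a - A* a` and `f = b - A*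
b`. Expanding leaves `⟨a, b⟩ - ⟨A* a, A* b⟩`, and `U*` is isometric. -/
theorem poissonElem_eq (hζ : ‖ζ‖ < 1) (e f : H) :
    poissonElem U ζ e f = (1 - ‖ζ‖ ^ 2 : ℝ) * inner ℂ ((geomOp (ζ • unitaryOp U)).adjoint e)
      ((geomOp (ζ • unitaryOp U)).adjoint f) := by
  set A := ζ • unitaryOp U with hA
  have hA1 : ‖A‖ < 1 := norm_smul_unitaryOp_lt hζ
  have ha := adjoint_geomOp_sub hA1 e
  have hb := adjoint_geomOp_sub hA1 f
  set a := (geomOp A).adjoint e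
  set b := (geomOp A).adjoint f
  have e1 : inner ℂ e (geomOp A f) = inner ℂ a f := (ContinuousLinearMap.adjoint_inner_left _ _ _).symm
  have e2 : (starRingEnd ℂ) (inner ℂ f (geomOp A e)) = inner ℂ e b := by
    rw [inner_conj_symm]; exact (ContinuousLinearMap.adjoint_inner_right _ _ _).symm
  have e3 : inner ℂ (A.adjoint a) (A.adjoint b) = (‖ζ‖ ^ 2 : ℝ) * inner ℂ a b := by
    have hAd : A.adjoint = (starRingEnd ℂ) ζ • unitaryOp U.symm := by
      rw [hA, map_smulₛₗ]
      congr 1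
      exact U.adjoint_eq_symm
    rw [hAd]
    simp only [smul_apply, inner_smul_left, inner_smul_right]
    change _ * (_ * inner ℂ (U.symm a) (U.symm b)) = _
    rw [LinearIsometryEquiv.inner_map_map, ← mul_assoc, Complex.conj_conj, Complex.conj_mul']
    simp
  rw [poissonElem, e1, e2]
  rw [← ha, ← hb]
  simp only [inner_sub_left, inner_sub_right, e3]
  push_cast
  ring

theorem hasSum_poissonElem (U : H ≃ₗᵢ[ℂ] H) {r : ℝ} (hr0 : 0 ≤ r) (hr : r < 1) (e f : H)
    (w : Circle) :
    HasSum (fun n : ℤ => (r : ℂ) ^ n.natAbs * inner ℂ e ((U ^ n) f) * (w : ℂ) ^ (-n))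
      (poissonElem U (r * (starRingEnd ℂ) w) e f) := by
  have hζ : ‖(r : ℂ) * (starRingEnd ℂ) (w : ℂ)‖ < 1 := by
    rw [norm_mul, RCLike.norm_conj, Circle.norm_coe, mul_one, Complex.norm_real,
      Real.norm_of_nonneg hr0]
    exact hr
  have h1 := hasSum_inner_geomOp U hζ e f
  have h2 : HasSum (fun k : ℕ => (starRingEnd ℂ) (((r : ℂ) * (starRingEnd ℂ) (w : ℂ)) ^ k *
      inner ℂ f ((U ^ (k : ℤ)) e))) _ :=
    (hasSum_inner_geomOp U hζ f e).mapL ((Complex.conjCLE : ℂ ≃L[ℝ] ℂ) : ℂ →L[ℝ] ℂ)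
  have hw : (starRingEnd ℂ) (w : ℂ) = (w : ℂ)⁻¹ := by
    rw [← Circle.coe_inv_eq_conj, Circle.coe_inv]
  -- Both one-sided series contain the index 0; this is the term `⟨e, f⟩` subtracted in
  -- `poissonElem`.
  have key := HasSum.of_nat_of_neg (f := fun n : ℤ => (r : ℂ) ^ n.natAbs *
    inner ℂ e ((U ^ n) f) * (w : ℂ) ^ (-n)) (h1.congr_fun ?_) (h2.congr_fun ?_)
  · have h0 : poissonElem U (r * (starRingEnd ℂ) w) e f =
        inner ℂ e (geomOp ((r * (starRingEnd ℂ) (w : ℂ)) • unitaryOp U) f) +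
        (starRingEnd ℂ) (inner ℂ f (geomOp ((r * (starRingEnd ℂ) (w : ℂ)) • unitaryOp U) e)) -
        (r : ℂ) ^ (0 : ℤ).natAbs * inner ℂ e ((U ^ (0 : ℤ)) f) * (w : ℂ) ^ (-(0 : ℤ)) := by
      simp [poissonElem]
    rw [h0]
    exact key
  · intro k
    have hk : (w : ℂ) ^ (-(k : ℤ)) = (w : ℂ)⁻¹ ^ k := by rw [zpow_neg, zpow_natCast, inv_pow]
    rw [Int.natAbs_natCast, mul_pow, hw, hk]
    ring
  · intro k
    rw [map_mul, inner_conj_symm, inner_zpow_left, map_pow, map_mul, Complex.conj_conj,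
      Complex.conj_ofReal, Int.natAbs_neg, Int.natAbs_natCast, mul_pow, neg_neg, zpow_natCast]
    ring

theorem integral_toCircle_zpow (n : ℤ) :
    ∫ θ : Torus, ((toCircle θ : Circle) : ℂ) ^ n ∂haarAddCircle = if n = 0 then 1 else 0 := by
  have h := congrFun (fourierCoeff_fourier (T := 2 * Real.pi) n) 0
  have h2 : ∫ θ : Torus, ((toCircle θ : Circle) : ℂ) ^ n ∂haarAddCircle =
      (Pi.single n 1 : ℤ → ℂ) 0 := by
    rw [← h, fourierCoeff]
    refine integral_congr_ae (ae_of_all _ fun θ => ?_)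
    beta_reduce
    rw [neg_zero, fourier_zero, one_smul, fourier_apply, toCircle_zsmul, Circle.coe_zpow]
  rw [h2]
  by_cases hn : n = 0
  · simp [hn]
  · simp [hn, Ne.symm hn]

/-- The Fourier coefficients of the Poisson kernel are the damped matrix elements of the powers of
`U`; summability of `r ^ |n|` permits termwise integration. -/
theorem integral_zpow_mul_poissonElem (U : H ≃ₗᵢ[ℂ] H) {r : ℝ} (hr0 : 0 ≤ r) (hr : r < 1)
    (e f : H) (m : ℤ) :
    ∫ θ : Torus, ((toCircle θ : Circle) : ℂ) ^ m *
      poissonElem U (r * (starRingEnd ℂ) (toCircle θ : ℂ)) e f ∂haarAddCircle =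
      (r : ℂ) ^ m.natAbs * inner ℂ e ((U ^ m) f) := by
  let F : ℤ → Torus → ℂ := fun n θ => ((toCircle θ : Circle) : ℂ) ^ m *
    ((r : ℂ) ^ n.natAbs * inner ℂ e ((U ^ n) f) * (toCircle θ : ℂ) ^ (-n))
  have hF : ∀ n θ, F n θ = ((r : ℂ) ^ n.natAbs * inner ℂ e ((U ^ n) f)) *
      (toCircle θ : ℂ) ^ (m - n) := by
    intro n θ
    simp only [F]
    rw [sub_eq_add_neg, zpow_add₀ (Circle.coe_ne_zero _)]
    ring
  have hcont : ∀ n : ℤ, Continuous fun θ : Torus => ((toCircle θ : Circle) : ℂ) ^ n := fun n =>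
    (circleMonomial n).continuous.comp continuous_toCircle
  have hFi : ∀ n, Integrable (F n) (haarAddCircle : Measure Torus) := by
    intro n
    have : F n = fun θ => ((r : ℂ) ^ n.natAbs * inner ℂ e ((U ^ n) f)) *
      (toCircle θ : ℂ) ^ (m - n) := funext (hF n)
    rw [this]
    exact (BoundedContinuousFunction.mkOfCompact
      ⟨_, continuous_const.mul (hcont (m - n))⟩).integrable _
  have hgeo : Summable fun n : ℤ => r ^ n.natAbs :=
    Summable.of_nat_of_neg (by simpa using summable_geometric_of_lt_one hr0 hr)
      (by simpa using summable_geometric_of_lt_one hr0 hr)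
  have hsum : Summable fun n : ℤ => ∫ θ, ‖F n θ‖ ∂(haarAddCircle : Measure Torus) := by
    refine Summable.of_nonneg_of_le (fun n => integral_nonneg fun _ => norm_nonneg _) (fun n => ?_)
      (hgeo.mul_right (‖e‖ * ‖f‖))
    have : ∀ θ, ‖F n θ‖ ≤ r ^ n.natAbs * (‖e‖ * ‖f‖) := by
      intro θ
      rw [hF, norm_mul, norm_mul, norm_zpow, Circle.norm_coe, one_zpow, mul_one, norm_pow,
        Complex.norm_real, Real.norm_of_nonneg hr0]
      exact mul_le_mul_of_nonneg_left (norm_inner_zpow_le U e f n) (by positivity)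
    refine (integral_mono (hFi n).norm (integrable_const _) this).trans ?_
    simp
  have h := hasSum_integral_of_summable_integral_norm hFi hsum
  have hs : ∀ θ : Torus, ∑' n, F n θ = ((toCircle θ : Circle) : ℂ) ^ m *
      poissonElem U (r * (starRingEnd ℂ) (toCircle θ : ℂ)) e f := fun θ =>
    ((hasSum_poissonElem U hr0 hr e f (toCircle θ)).mul_left _).tsum_eq
  simp_rw [hs] at h
  have hI : ∀ n, ∫ θ, F n θ ∂(haarAddCircle : Measure Torus) =
      if n = m then (r : ℂ) ^ m.natAbs * inner ℂ e ((U ^ m) f) else 0 := by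
    intro n
    simp_rw [hF]
    rw [integral_const_mul, integral_toCircle_zpow]
    by_cases hn : n = m
    · simp [hn]
    · simp [hn, sub_eq_zero, Ne.symm hn]
  simp_rw [hI] at h
  exact h.unique (hasSum_ite_eq m _)

end Poisson

end ScatteringWalk

namespace ScatteringWalk
open Filter Topology AddCircle

/-! ### Poisson kernels near the unit circle -/

section TotalVariation

variable {H : Type*} [NormedAddCommGroup H] [InnerProductSpace ℂ H] [CompleteSpace H]
  {U : H ≃ₗᵢ[ℂ] H}

/-- The radii at which the Poisson kernel is evaluated; they increase to `1`. -/
noncomputable def radius (k : ℕ) : ℝ := 1 - 1 / ((k : ℝ) + 1)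

theorem radius_nonneg (k : ℕ) : 0 ≤ radius k := by
  rw [radius, sub_nonneg, div_le_one (by positivity)]
  have : (0 : ℝ) ≤ k := Nat.cast_nonneg k
  linarith

theorem radius_lt_one (k : ℕ) : radius k < 1 := by
  rw [radius, sub_lt_self_iff]
  positivity

theorem tendsto_radius : Tendsto radius atTop (𝓝 1) := by
  have := tendsto_one_div_add_atTop_nhds_zero_nat (𝕜 := ℝ)
  have h := this.const_sub 1
  rw [sub_zero] at h
  exact h

/-- The spectral parameter of modulus `r` and phase `-θ`. -/
noncomputable def spectralParam (r : ℝ) (θ : Torus) : ℂ := r * (starRingEnd ℂ) (toCircle θ : ℂ)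

theorem norm_spectralParam {r : ℝ} (hr : 0 ≤ r) (θ : Torus) : ‖spectralParam r θ‖ = r := by
  rw [spectralParam, norm_mul, RCLike.norm_conj, Circle.norm_coe, mul_one, Complex.norm_real,
    Real.norm_of_nonneg hr]

theorem continuous_toCircle_coe : Continuous fun θ : Torus => ((toCircle θ : Circle) : ℂ) :=
  continuous_subtype_val.comp continuous_toCircle

theorem continuous_spectralParam (r : ℝ) : Continuous (spectralParam r) :=
  continuous_const.mul (Complex.continuous_conj.comp continuous_toCircle_coe)

/-- The mass of the Poisson kernel on the circle of radius `r`. -/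
noncomputable def poissonMass (U : H ≃ₗᵢ[ℂ] H) (r : ℝ) (e f : H) : ℝ≥0∞ :=
  ∫⁻ θ : Torus, ‖poissonElem U (spectralParam r θ) e f‖ₑ ∂haarAddCircle

theorem continuous_poissonElem (U : H ≃ₗᵢ[ℂ] H) {r : ℝ} (hr0 : 0 ≤ r) (hr : r < 1) (e f : H) :
    Continuous fun θ : Torus => poissonElem U (spectralParam r θ) e f := by
  have h : ∀ e f : H, Continuous fun θ : Torus =>
      inner ℂ e (geomOp (spectralParam r θ • unitaryOp U) f) := by
    intro e f
    have hg : Continuous fun θ : Torus => geomOp (spectralParam r θ • unitaryOp U) := by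
      refine continuous_iff_continuousAt.2 fun θ => ?_
      have hu : IsUnit (1 - spectralParam r θ • unitaryOp U) :=
        isUnit_one_sub_of_norm_lt_one
          (norm_smul_unitaryOp_lt (by rw [norm_spectralParam hr0]; exact hr))
      obtain ⟨u, hu⟩ := hu
      have h1 : ContinuousAt Ring.inverse (1 - spectralParam r θ • unitaryOp U) := by
        rw [← hu]; exact NormedRing.inverse_continuousAt u
      exact ContinuousAt.comp (f := fun θ : Torus => 1 - spectralParam r θ • unitaryOp U) h1
        (continuous_const.sub ((continuous_spectralParam r).smul continuous_const)).continuousAt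
    exact continuous_const.inner (hg.clm_apply continuous_const)
  exact ((h e f).add (Complex.continuous_conj.comp (h f e))).sub continuous_const

theorem integral_trigFun_mul_poissonElem (U : H ≃ₗᵢ[ℂ] H) {r : ℝ} (hr0 : 0 ≤ r) (hr : r < 1)
    (e f : H) (a : ℤ →₀ ℂ) :
    ∫ θ : Torus, trigFun a (toCircle θ) * poissonElem U (spectralParam r θ) e f ∂haarAddCircle =
      a.sum fun n α => α * ((r : ℂ) ^ n.natAbs * inner ℂ e ((U ^ n) f)) := by
  have hint : ∀ a : ℤ →₀ ℂ, Integrable (fun θ : Torus =>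
      trigFun a (toCircle θ) * poissonElem U (spectralParam r θ) e f) haarAddCircle := fun a =>
    (BoundedContinuousFunction.mkOfCompact ⟨_, ((trigFun a).continuous.comp continuous_toCircle).mul
      (continuous_poissonElem U hr0 hr e f)⟩).integrable _
  induction a using Finsupp.induction_linear with
  | zero => simp
  | add a b ha hb =>
    rw [Finsupp.sum_add_index' (by simp) (by intros; ring), ← ha, ← hb,
      ← integral_add (hint a) (hint b)]
    congr 1; ext θ
    rw [map_add, ContinuousMap.add_apply]; ring
  | single n α =>
    rw [Finsupp.sum_single_index (by simp), ← integral_zpow_mul_poissonElem U hr0 hr e f n,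
      ← integral_const_mul]
    congr 1; ext θ
    rw [trigFun_single]; simp only [spectralParam]; ring

/-- Pairing a polynomial with the Poisson kernel damps its coefficients by `r ^ |n|`. The pairing is
at most the sup norm times the mass, and the damping disappears as `r → 1`. -/
theorem enorm_inner_trigVec_le (U : H ≃ₗᵢ[ℂ] H) (e f : H) {a : ℤ →₀ ℂ} {M : ℝ}
    (ha : ∀ z, ‖trigFun a z‖ ≤ M) :
    ‖inner ℂ e (trigVec U f a)‖ₑ ≤
      ENNReal.ofReal M * liminf (fun k => poissonMass U (radius k) e f) atTop := by
  have h1 : ∀ k, ‖a.sum fun n α => α * ((radius k : ℂ) ^ n.natAbs * inner ℂ e ((U ^ n) f))‖ₑ ≤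
      ENNReal.ofReal M * poissonMass U (radius k) e f := by
    intro k
    rw [← integral_trigFun_mul_poissonElem U (radius_nonneg k) (radius_lt_one k)]
    refine (enorm_integral_le_lintegral_enorm _).trans ?_
    rw [poissonMass, ← lintegral_const_mul' _ _ ENNReal.ofReal_ne_top]
    refine lintegral_mono fun θ => ?_
    rw [enorm_mul]
    gcongr
    rw [← ofReal_norm]
    exact ENNReal.ofReal_le_ofReal (ha _)
  have h2 : Tendsto (fun k => ‖a.sum fun n α => α * ((radius k : ℂ) ^ n.natAbs *
      inner ℂ e ((U ^ n) f))‖ₑ) atTop (𝓝 ‖inner ℂ e (trigVec U f a)‖ₑ) := by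
    refine (continuous_enorm.tendsto _).comp ?_
    have h3 : inner ℂ e (trigVec U f a) = a.sum fun n α => α * inner ℂ e ((U ^ n) f) := by
      rw [trigVec, Finsupp.linearCombination_apply, Finsupp.inner_sum]
      simp [inner_smul_right]
    rw [h3]
    refine tendsto_finsetSum _ fun n _ => ?_
    have h4 : Tendsto (fun k => (radius k : ℂ) ^ n.natAbs) atTop (𝓝 1) := by
      have := ((Complex.continuous_ofReal.tendsto 1).comp tendsto_radius).pow n.natAbs
      simpa using this
    simpa using (h4.mul_const (inner ℂ e ((U ^ n) f))).const_mul (a n)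
  rw [← h2.liminf_eq, ← ENNReal.liminf_const_mul_of_ne_top ENNReal.ofReal_ne_top]
  exact liminf_le_liminf (Eventually.of_forall h1)

/-! ### Existence of spectral measures -/

/-- For `e = f = ψ` the Poisson kernel is nonnegative of total mass one. Weak compactness of the
probability measures on the circle gives a limit, and the damped moments converge to the required
ones. -/
theorem exists_isSpectralMeasure_of_norm_eq_one (U : H ≃ₗᵢ[ℂ] H) {ψ : H} (hψ : ‖ψ‖ = 1) :
    ∃ m : Measure Circle, IsSpectralMeasure U ψ m := by
  let p : ℕ → Torus → ℝ := fun k θ => (poissonElem U (spectralParam (radius k) θ) ψ ψ).re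
  have hp : ∀ k θ, poissonElem U (spectralParam (radius k) θ) ψ ψ = (p k θ : ℂ) ∧ 0 ≤ p k θ := by
    intro k θ
    have hζ : ‖spectralParam (radius k) θ‖ < 1 := by
      rw [norm_spectralParam (radius_nonneg k)]; exact radius_lt_one k
    have h := poissonElem_eq (U := U) hζ ψ ψ
    rw [inner_self_eq_norm_sq_to_K] at h
    have h' : poissonElem U (spectralParam (radius k) θ) ψ ψ =
      (((1 - ‖spectralParam (radius k) θ‖ ^ 2) *
        ‖(geomOp (spectralParam (radius k) θ • unitaryOp U)).adjoint ψ‖ ^ 2 : ℝ) : ℂ) := by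
      rw [h]; simp
    have h1 : 0 ≤ 1 - ‖spectralParam (radius k) θ‖ ^ 2 := by nlinarith [norm_nonneg (spectralParam (radius k) θ)]
    refine ⟨?_, ?_⟩
    · simp only [p]; rw [h', Complex.ofReal_re]
    · simp only [p]; rw [h', Complex.ofReal_re]; positivity
  have hcont : ∀ k, Continuous (p k) := fun k =>
    Complex.continuous_re.comp (continuous_poissonElem U (radius_nonneg k) (radius_lt_one k) ψ ψ)
  let ν : ℕ → Measure Torus := fun k => haarAddCircle.withDensity fun θ => ENNReal.ofReal (p k θ)
  have hint : ∀ k (n : ℤ), ∫ z, circleMonomial n z ∂((ν k).map toCircle) =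
      (radius k : ℂ) ^ n.natAbs * inner ℂ ψ ((U ^ n) ψ) := by
    intro k n
    rw [integral_map continuous_toCircle.aemeasurable
      (circleMonomial n).continuous.aestronglyMeasurable,
      integral_withDensity_eq_integral_toReal_smul (by fun_prop) (by simp),
      ← integral_zpow_mul_poissonElem U (radius_nonneg k) (radius_lt_one k)]
    refine integral_congr_ae (ae_of_all _ fun θ => ?_)
    beta_reduce
    rw [ENNReal.toReal_ofReal (hp k θ).2, Complex.real_smul, ← (hp k θ).1, mul_comm]
    rfl
  have hfin : ∀ k, IsFiniteMeasure (ν k) := fun k => by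
    have hi : Integrable (p k) (haarAddCircle : Measure Torus) :=
      (BoundedContinuousFunction.mkOfCompact ⟨p k, hcont k⟩).integrable _
    exact isFiniteMeasure_withDensity_ofReal hi.2
  have hprob : ∀ k, IsProbabilityMeasure ((ν k).map toCircle) := fun k => by
    have hf : IsFiniteMeasure ((ν k).map toCircle) := by
      have := hfin k
      infer_instance
    have h := hint k 0
    simp only [circleMonomial_apply, zpow_zero, integral_const, Int.natAbs_zero, pow_zero, one_mul,
      LinearIsometryEquiv.coe_one, id_eq, Complex.real_smul, mul_one,
      inner_self_eq_norm_sq_to_K, hψ] at h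
    have h' : ((ν k).map toCircle).real Set.univ = 1 := by
      have := congrArg Complex.re h
      simpa using this
    refine ⟨?_⟩
    rw [Measure.real, ENNReal.toReal_eq_one_iff] at h'
    exact h'
  let m : ℕ → ProbabilityMeasure Circle := fun k => ⟨(ν k).map toCircle, hprob k⟩
  let 𝒰 : Ultrafilter (ProbabilityMeasure Circle) := (Filter.hyperfilter ℕ).map m
  obtain ⟨μ, -, hμ⟩ := (isCompact_univ (X := ProbabilityMeasure Circle)).ultrafilter_le_nhds 𝒰
    (by simp)
  have hμ' : Tendsto m (Filter.hyperfilter ℕ) (𝓝 μ) := hμ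
  rw [ProbabilityMeasure.tendsto_iff_forall_integral_rclike_tendsto ℂ] at hμ'
  refine ⟨μ, inferInstance, fun n => ?_⟩
  have h1 := hμ' (BoundedContinuousFunction.mkOfCompact (circleMonomial n))
  have h2 : Tendsto (fun k => (radius k : ℂ) ^ n.natAbs * inner ℂ ψ ((U ^ n) ψ))
      (Filter.hyperfilter ℕ : Filter ℕ) (𝓝 (inner ℂ ψ ((U ^ n) ψ))) := by
    have h3 : Tendsto (fun k => (radius k : ℂ) ^ n.natAbs) atTop (𝓝 1) := by
      have := ((Complex.continuous_ofReal.tendsto 1).comp tendsto_radius).pow n.natAbs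
      simpa using this
    have h4 := h3.mul_const (inner ℂ ψ ((U ^ n) ψ))
    rw [one_mul] at h4
    exact h4.mono_left Nat.hyperfilter_le_atTop
  refine tendsto_nhds_unique (h2.congr fun k => ?_) h1
  exact (hint k n).symm

theorem exists_isSpectralMeasure (U : H ≃ₗᵢ[ℂ] H) (ψ : H) :
    ∃ m : Measure Circle, IsSpectralMeasure U ψ m := by
  by_cases hψ : ψ = 0
  · exact ⟨0, inferInstance, fun n => by simp [hψ]⟩
  have hn : ‖ψ‖ ≠ 0 := norm_ne_zero_iff.2 hψ
  obtain ⟨m, hm⟩ := exists_isSpectralMeasure_of_norm_eq_one U (ψ := ((‖ψ‖⁻¹ : ℝ) : ℂ) • ψ)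
    (by rw [norm_smul, Complex.norm_real, norm_inv, norm_norm, inv_mul_cancel₀ hn])
  have hfin := hm.1
  refine ⟨ENNReal.ofReal (‖ψ‖ ^ 2) • m, Measure.smul_finite _ ENNReal.ofReal_ne_top, fun n => ?_⟩
  rw [integral_smul_measure, ENNReal.toReal_ofReal (by positivity), ← hm.2 n, map_smul,
    inner_smul_left, inner_smul_right, Complex.conj_ofReal, Complex.real_smul]
  have : (‖ψ‖ : ℂ) ≠ 0 := by exact_mod_cast hn
  push_cast
  field_simp

/-! ### The total variation bound and measurability -/

/-- Multiplying the approximating polynomials by `z ^ n` does not change their modulus on the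
circle, hence the uniformity in `n`. Their sup bounds tend to one, so no constant is lost. -/
theorem inner_zpow_spectralProjection_le (U : H ≃ₗᵢ[ℂ] H) (e f : H) {I : Set Circle}
    (hI : MeasurableSet I) (n : ℤ) :
    ‖inner ℂ e ((U ^ n) (spectralProjection U I f))‖ₑ ≤
      liminf (fun k => poissonMass U (radius k) e f) atTop := by
  obtain ⟨m, hm⟩ := exists_isSpectralMeasure U f
  have hfin := hm.1
  obtain ⟨c, hc⟩ := exists_indicatorApprox m hI
  set L := liminf (fun k => poissonMass U (radius k) e f) atTop with hL
  have h1 : Tendsto (fun k => ‖inner ℂ e ((U ^ n) (trigVec U f (c k)))‖ₑ) atTop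
      (𝓝 ‖inner ℂ e ((U ^ n) (spectralProjection U I f))‖ₑ) := by
    refine (continuous_enorm.tendsto _).comp (tendsto_const_nhds.inner ?_)
    exact ((U ^ n).continuous.tendsto _).comp (hc.tendsto_spectralProjection hm hI)
  have hshift : ∀ a : ℤ →₀ ℂ, ∃ b : ℤ →₀ ℂ, (∀ z, trigFun b z = (z : ℂ) ^ n * trigFun a z) ∧
      (U ^ n) (trigVec U f a) = trigVec U f b := by
    intro a
    induction a using Finsupp.induction_linear with
    | zero => exact ⟨0, by simp, by simp⟩
    | add a a' ha ha' =>
      obtain ⟨b, hb, hb2⟩ := ha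
      obtain ⟨b', hb', hb2'⟩ := ha'
      exact ⟨b + b', fun z => by simp [hb, hb', mul_add], by simp [hb2, hb2']⟩
    | single l α =>
      refine ⟨Finsupp.single (n + l) α, fun z => ?_, ?_⟩
      · rw [trigFun_single, trigFun_single, zpow_add₀ (Circle.coe_ne_zero z)]; ring
      · rw [trigVec_single, trigVec_single, map_smul, zpow_add_apply]
  choose b hb hb2 using fun k => hshift (c k)
  have h2 : ∀ k, ‖inner ℂ e ((U ^ n) (trigVec U f (c k)))‖ₑ ≤
      ENNReal.ofReal (1 + 1 / ((k : ℝ) + 1)) * L := by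
    intro k
    rw [hb2]
    refine enorm_inner_trigVec_le U e f fun z => ?_
    rw [hb, norm_mul, norm_zpow, Circle.norm_coe, one_zpow, one_mul]
    exact hc.1 k z
  have h3 : Tendsto (fun k : ℕ => ENNReal.ofReal (1 + 1 / ((k : ℝ) + 1)) * L) atTop (𝓝 L) := by
    have h4 : Tendsto (fun k : ℕ => ENNReal.ofReal (1 + 1 / ((k : ℝ) + 1))) atTop (𝓝 1) := by
      have h5 := (tendsto_one_div_add_atTop_nhds_zero_nat (𝕜 := ℝ)).const_add 1
      rw [add_zero] at h5
      simpa using ENNReal.tendsto_ofReal h5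
    simpa using ENNReal.Tendsto.mul_const h4 (Or.inl one_ne_zero)
  exact le_of_tendsto_of_tendsto' h1 h3 h2

variable {Ω : Type*} [MeasurableSpace Ω]

omit [CompleteSpace H] in
-- The measures are merely chosen pointwise, so measurability has to come from the moments: it
-- passes to polynomials, to continuous functions by uniform approximation, to closed sets by
-- thickened indicators, and to Borel sets by a π-λ argument.
theorem measurable_spectralMeasure {W : Ω → H ≃ₗᵢ[ℂ] H} {ψ : Ω → H} {m : Ω → Measure Circle}
    (hm : ∀ w, IsSpectralMeasure (W w) (ψ w) (m w))
    (hW : ∀ n : ℤ, Measurable fun w => inner ℂ (ψ w) ((W w ^ n) (ψ w)))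
    {I : Set Circle} (hI : MeasurableSet I) : Measurable fun w => m w I := by
  have hfin : ∀ w, IsFiniteMeasure (m w) := fun w => (hm w).1
  have htrig : ∀ a : ℤ →₀ ℂ, Measurable fun w => ∫ z, trigFun a z ∂(m w) := by
    intro a
    induction a using Finsupp.induction_linear with
    | zero => simp
    | add a b ha hb =>
      have : (fun w => ∫ z, trigFun (a + b) z ∂(m w)) =
          fun w => ∫ z, trigFun a z ∂(m w) + ∫ z, trigFun b z ∂(m w) := by
        funext w
        rw [← integral_add (integrable_continuousMap _ _) (integrable_continuousMap _ _)]
        simp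
      rw [this]
      exact ha.add hb
    | single n α =>
      have : (fun w => ∫ z, trigFun (Finsupp.single n α) z ∂(m w)) =
          fun w => α * inner ℂ (ψ w) ((W w ^ n) (ψ w)) := by
        funext w
        simp_rw [trigFun_single]
        rw [integral_const_mul, (hm w).2]
      rw [this]
      exact (hW n).const_mul α
  have hcont : ∀ h : C(Circle, ℂ), Measurable fun w => ∫ z, h z ∂(m w) := by
    intro h
    choose a ha using fun k : ℕ => exists_trigFun_near h (Nat.one_div_pos_of_nat (α := ℝ) (n := k))
    refine measurable_of_tendsto_metrizable (fun k => htrig (a k)) (tendsto_pi_nhds.2 fun w => ?_)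
    rw [tendsto_iff_norm_sub_tendsto_zero]
    have hz : Tendsto (fun k : ℕ => 1 / ((k : ℝ) + 1) * (m w).real Set.univ) atTop (𝓝 0) := by
      simpa using (tendsto_one_div_add_atTop_nhds_zero_nat (𝕜 := ℝ)).mul_const _
    refine squeeze_zero (fun _ => norm_nonneg _) (fun k => ?_) hz
    rw [← integral_sub (integrable_continuousMap _ _) (integrable_continuousMap _ _)]
    exact norm_integral_le_of_norm_le_const (ae_of_all _ fun z => (ha k z).le)
  have huniv : Measurable fun w => m w Set.univ := by
    have h1 : (fun w => m w Set.univ) = fun w => ENNReal.ofReal (∫ z, (1 : C(Circle, ℂ)) z ∂(m w)).re := by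
      funext w
      simp [Measure.real]
    rw [h1]
    exact (Complex.measurable_re.comp (hcont 1)).ennreal_ofReal
  induction I, hI using MeasurableSpace.induction_on_inter
    (borel_eq_generateFrom_isClosed (α := Circle)) isPiSystem_isClosed with
  | empty => simp
  | basic F hF =>
    have hF : IsClosed F := hF
    let δ : ℕ → ℝ := fun k => 1 / ((k : ℝ) + 1)
    have hδ : ∀ k, 0 < δ k := fun k => Nat.one_div_pos_of_nat
    have hlim : ∀ w, Tendsto (fun k => ∫⁻ z, thickenedIndicator (hδ k) F z ∂(m w)) atTop
        (𝓝 (m w F)) := fun w =>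
      tendsto_lintegral_thickenedIndicator_of_isClosed (m w) hF hδ
        tendsto_one_div_add_atTop_nhds_zero_nat
    refine measurable_of_tendsto_metrizable (fun k => ?_) (tendsto_pi_nhds.2 hlim)
    let h : C(Circle, ℂ) := ⟨fun z => ((thickenedIndicator (hδ k) F z : ℝ) : ℂ),
      Complex.continuous_ofReal.comp (NNReal.continuous_coe.comp (thickenedIndicator (hδ k) F).continuous)⟩
    have h1 : (fun w => ∫⁻ z, thickenedIndicator (hδ k) F z ∂(m w)) =
        fun w => ENNReal.ofReal (∫ z, h z ∂(m w)).re := by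
      funext w
      simp only [h, ContinuousMap.coe_mk]
      rw [integral_complex_ofReal, Complex.ofReal_re, lintegral_coe_eq_integral]
      exact integrable_thickenedIndicator F (hδ k)
    rw [h1]
    exact (Complex.measurable_re.comp (hcont h)).ennreal_ofReal
  | compl J hJ ih =>
    have : (fun w => m w Jᶜ) = fun w => m w Set.univ - m w J :=
      funext fun w => measure_compl hJ (measure_ne_top _ _)
    rw [this]
    exact huniv.sub ih
  | iUnion f hd hf ih =>
    have : (fun w => m w (⋃ i, f i)) = fun w => ∑' i, m w (f i) :=
      funext fun w => measure_iUnion hd hf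
    rw [this]
    exact Measurable.tsum ih

/-- Polarization reduces to diagonal elements, which are masses `m(I)` of spectral measures. The
vectors may depend on the parameter so that `U ^ n` can later be absorbed into the left one. -/
theorem measurable_inner_spectralProjection {W : Ω → H ≃ₗᵢ[ℂ] H} {e f : Ω → H} {I : Set Circle}
    (hI : MeasurableSet I)
    (hee : ∀ n : ℤ, Measurable fun w => inner ℂ (e w) ((W w ^ n) (e w)))
    (hef : ∀ n : ℤ, Measurable fun w => inner ℂ (e w) ((W w ^ n) (f w)))
    (hff : ∀ n : ℤ, Measurable fun w => inner ℂ (f w) ((W w ^ n) (f w))) :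
    Measurable fun w => inner ℂ (e w) (spectralProjection (W w) I (f w)) := by
  have hfe : ∀ n : ℤ, Measurable fun w => inner ℂ (f w) ((W w ^ n) (e w)) := by
    intro n
    have : (fun w => inner ℂ (f w) ((W w ^ n) (e w))) =
        fun w => (starRingEnd ℂ) (inner ℂ (e w) ((W w ^ (-n)) (f w))) := by
      funext w
      rw [inner_conj_symm, inner_zpow_left, neg_neg]
    rw [this]
    exact Complex.continuous_conj.measurable.comp (hef (-n))
  have hdiag : ∀ a : ℂ, Measurable fun w => inner ℂ (f w + a • e w)
      (spectralProjection (W w) I (f w + a • e w)) := by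
    intro a
    choose m hm using fun w => exists_isSpectralMeasure (W w) (f w + a • e w)
    have hI' := measurable_spectralMeasure hm (fun n => ?_) hI
    · have : (fun w => inner ℂ (f w + a • e w)
          (spectralProjection (W w) I (f w + a • e w))) = fun w => ((m w I).toReal : ℂ) :=
        funext fun w => (hm w).inner_spectralProjection hI
      rw [this]
      exact Complex.measurable_ofReal.comp hI'.ennreal_toReal
    · simp only [map_add, map_smul, inner_add_left, inner_add_right, inner_smul_left,
        inner_smul_right]
      exact ((hff n).add ((hef n).const_mul _)).add
        (((hfe n).add ((hee n).const_mul _)).const_mul _)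
  have hpol : ∀ w, inner ℂ (e w) (spectralProjection (W w) I (f w)) =
      (inner ℂ (f w + (1 : ℂ) • e w) (spectralProjection (W w) I (f w + (1 : ℂ) • e w)) -
      inner ℂ (f w + (-1 : ℂ) • e w) (spectralProjection (W w) I (f w + (-1 : ℂ) • e w)) +
      Complex.I * inner ℂ (f w + Complex.I • e w) (spectralProjection (W w) I (f w + Complex.I • e w)) -
      Complex.I * inner ℂ (f w + (-Complex.I) • e w) (spectralProjection (W w) I (f w + (-Complex.I) • e w))) / 4 := by
    intro w
    simp only [map_add, map_smul, inner_add_left, inner_add_right, inner_smul_left,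
        inner_smul_right]
    simp only [map_one, map_neg, Complex.conj_I]
    ring_nf
    simp only [Complex.I_sq]
    ring
  simp_rw [hpol]
  exact ((((hdiag 1).sub (hdiag (-1))).add ((hdiag Complex.I).const_mul _)).sub
    ((hdiag (-Complex.I)).const_mul _)).div_const _

end TotalVariation

end ScatteringWalk

namespace ScatteringWalk
open Filter Topology AddCircle

/-! ### Averages of analytic functions with positive real part -/

section Analytic

theorem integral_toCircle_eq {h : ℂ → ℂ} (hd : ∀ w : ℂ, ‖w‖ ≤ 1 → DifferentiableAt ℂ h w) :
    ∫ θ : Torus, h (toCircle θ : ℂ) ∂haarAddCircle = h 0 := by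
  have hdc : DiffContOnCl ℂ h (Metric.ball 0 |1|) := by
    refine DifferentiableOn.diffContOnCl fun w hw => ?_
    refine (hd w ?_).differentiableWithinAt
    have := Metric.closure_ball_subset_closedBall hw
    simpa using this
  rw [← hdc.circleAverage, integral_haarAddCircle, Real.circleAverage_def,
    ← AddCircle.intervalIntegral_preimage (2 * Real.pi) 0]
  congr 1
  rw [zero_add]
  refine intervalIntegral.integral_congr fun t _ => ?_
  rw [toCircle_apply_mk, Circle.coe_exp, circleMap]
  have : (2 * Real.pi) / (2 * Real.pi) = 1 := div_self (by positivity)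
  rw [this]
  simp

theorem continuous_comp_toCircle {h : ℂ → ℂ} (hd : ∀ w : ℂ, ‖w‖ ≤ 1 → DifferentiableAt ℂ h w) :
    Continuous fun θ : Torus => h (toCircle θ : ℂ) :=
  continuous_iff_continuousAt.2 fun _ =>
    ContinuousAt.comp (f := fun θ : Torus => (toCircle θ : ℂ))
      (hd _ (Circle.norm_coe _).le).continuousAt continuous_toCircle_coe.continuousAt

theorem lintegral_re_toCircle_eq {h : ℂ → ℂ} (hd : ∀ w : ℂ, ‖w‖ ≤ 1 → DifferentiableAt ℂ h w)
    (hpos : ∀ w : ℂ, ‖w‖ ≤ 1 → 0 < (h w).re) :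
    ∫⁻ θ : Torus, ENNReal.ofReal (h (toCircle θ : ℂ)).re ∂haarAddCircle =
      ENNReal.ofReal (h 0).re := by
  have hi : Integrable (fun θ : Torus => h (toCircle θ : ℂ)) haarAddCircle :=
    (BoundedContinuousFunction.mkOfCompact ⟨_, continuous_comp_toCircle hd⟩).integrable _
  refine (ofReal_integral_eq_lintegral_ofReal hi.re
    (ae_of_all _ fun _ => (hpos _ (Circle.norm_coe _).le).le)).symm.trans ?_
  rw [← integral_toCircle_eq hd]
  congr 1
  exact integral_re hi

/-- For the principal root `u`, the positivity of `Re(u²)` forces `|Im u| < Re u`. -/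
theorem norm_rpow_half_le_re {z : ℂ} (hz : 0 < z.re) :
    ‖z‖ ^ (1 / 2 : ℝ) ≤ 2 * (z ^ (1 / 2 : ℂ)).re := by
  have hz0 : z ≠ 0 := by rintro rfl; simp at hz
  set u := z ^ (1 / 2 : ℂ) with hu
  have hu2 : u ^ 2 = z := by
    rw [hu, ← Complex.cpow_nat_mul]; simp
  have hnorm : ‖u‖ = ‖z‖ ^ (1 / 2 : ℝ) := by
    rw [hu, Complex.norm_cpow_of_ne_zero hz0]
    simp
  have hre : 0 ≤ u.re := by
    rw [hu, Complex.cpow_def_of_ne_zero hz0, Complex.exp_re]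
    refine mul_nonneg (Real.exp_pos _).le (Real.cos_nonneg_of_mem_Icc ?_)
    have him : (Complex.log z * (1 / 2 : ℂ)).im = z.arg / 2 := by
      have : (Complex.log z * (1 / 2 : ℂ)) = Complex.log z * ((1 / 2 : ℝ) : ℂ) := by norm_num
      rw [this, Complex.im_mul_ofReal, Complex.log_im]; ring
    rw [him]
    have h1 := Complex.neg_pi_lt_arg z
    have h2 := Complex.arg_le_pi z
    constructor <;> linarith
  rw [← hnorm]
  have h3 : z.re = u.re ^ 2 - u.im ^ 2 := by rw [← hu2, sq, Complex.mul_re]; ring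
  have h4 : ‖u‖ ^ 2 = u.re ^ 2 + u.im ^ 2 := by
    rw [← Complex.normSq_eq_norm_sq, Complex.normSq_apply]; ring
  nlinarith [norm_nonneg u]

/-- Kolmogorov's bound for the square root of an analytic function with positive real part. -/
theorem lintegral_rpow_half_toCircle_le {h : ℂ → ℂ}
    (hd : ∀ w : ℂ, ‖w‖ ≤ 1 → DifferentiableAt ℂ h w)
    (hpos : ∀ w : ℂ, ‖w‖ ≤ 1 → 0 < (h w).re) :
    ∫⁻ θ : Torus, ‖h (toCircle θ : ℂ)‖ₑ ^ (1 / 2 : ℝ) ∂haarAddCircle ≤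
      2 * ‖h 0‖ₑ ^ (1 / 2 : ℝ) := by
  -- The root is again analytic with positive real part, so the mean of its real part over the
  -- circle is the value at the centre.
  let u : ℂ → ℂ := fun w => h w ^ (1 / 2 : ℂ)
  have hud : ∀ w : ℂ, ‖w‖ ≤ 1 → DifferentiableAt ℂ u w := fun w hw =>
    (hd w hw).cpow_const (Or.inl (hpos w hw))
  have hre : ∀ w : ℂ, ‖w‖ ≤ 1 → ‖h w‖ ^ (1 / 2 : ℝ) ≤ 2 * (u w).re := fun w hw =>
    norm_rpow_half_le_re (hpos w hw)
  have hne : ∀ w : ℂ, ‖w‖ ≤ 1 → 0 < ‖h w‖ := fun w hw =>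
    norm_pos_iff.2 fun h0 => by have := hpos w hw; simp [h0] at this
  have hupos : ∀ w : ℂ, ‖w‖ ≤ 1 → 0 < (u w).re := fun w hw => by
    have := Real.rpow_pos_of_pos (hne w hw) (1 / 2 : ℝ)
    linarith [hre w hw]
  have he : ∀ z : ℂ, ‖z‖ₑ ^ (1 / 2 : ℝ) = ENNReal.ofReal (‖z‖ ^ (1 / 2 : ℝ)) := fun z => by
    rw [← ofReal_norm, ENNReal.ofReal_rpow_of_nonneg (norm_nonneg _) (by norm_num)]
  calc ∫⁻ θ : Torus, ‖h (toCircle θ : ℂ)‖ₑ ^ (1 / 2 : ℝ) ∂haarAddCircle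
      ≤ ∫⁻ θ : Torus, 2 * ENNReal.ofReal (u (toCircle θ : ℂ)).re ∂haarAddCircle := by
        refine lintegral_mono fun θ => ?_
        rw [he]
        refine (ENNReal.ofReal_le_ofReal (hre _ (Circle.norm_coe _).le)).trans_eq ?_
        rw [ENNReal.ofReal_mul (by norm_num), ENNReal.ofReal_ofNat]
    _ = 2 * ENNReal.ofReal (u 0).re := by
        rw [lintegral_const_mul' _ _ (by norm_num), lintegral_re_toCircle_eq hud hupos]
    _ ≤ 2 * ‖h 0‖ₑ ^ (1 / 2 : ℝ) := by
        rw [he]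
        gcongr
        refine (Complex.re_le_norm _).trans_eq ?_
        have h0 : h 0 ≠ 0 := norm_pos_iff.1 (hne 0 (by simp))
        simp only [u]
        rw [Complex.norm_cpow_of_ne_zero h0]
        simp

end Analytic

/-! ### Averages over a finite rank phase -/

section RankPhase

variable {H : Type*} [NormedAddCommGroup H] [InnerProductSpace ℂ H] [CompleteSpace H]

/-- The diagonal matrix elements of `(1 + A) (1 - A)⁻¹`. -/
noncomputable def herglotzElem (A : H →L[ℂ] H) (ψ : H) : ℂ :=
  2 * inner ℂ ψ (geomOp A ψ) - inner ℂ ψ ψ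

/-- With `ψ = φ - Aφ` the element equals `⟨φ - Aφ, φ + Aφ⟩`. -/
theorem re_herglotzElem {A : H →L[ℂ] H} (hA : ‖A‖ < 1) (ψ : H) :
    (herglotzElem A ψ).re = ‖geomOp A ψ‖ ^ 2 - ‖A (geomOp A ψ)‖ ^ 2 := by
  have h := sub_geomOp_apply hA ψ
  set φ := geomOp A ψ with hφ
  rw [herglotzElem, ← hφ]
  rw [← h]
  have e1 : ∀ v : H, inner ℂ v v = ((‖v‖ ^ 2 : ℝ) : ℂ) := fun v => by
    rw [inner_self_eq_norm_sq_to_K]; simp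
  have e2 : (inner ℂ (A φ) φ).re = (inner ℂ φ (A φ)).re := by
    rw [← inner_conj_symm, Complex.conj_re]
  simp only [inner_sub_left, inner_sub_right]
  simp only [e1, Complex.sub_re, Complex.mul_re, Complex.ofReal_re, Complex.re_ofNat, Complex.im_ofNat, zero_mul, sub_zero]
  linarith

theorem re_herglotzElem_pos {A : H →L[ℂ] H} (hA : ‖A‖ < 1) {ψ : H} (hψ : ψ ≠ 0) :
    0 < (herglotzElem A ψ).re := by
  rw [re_herglotzElem hA, sub_pos]
  have h := sub_geomOp_apply hA ψ
  have hφ : 0 < ‖geomOp A ψ‖ := by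
    rw [norm_pos_iff]
    intro h0
    rw [h0] at h
    simp at h
    exact hψ h.symm
  have h2 : ‖A (geomOp A ψ)‖ < ‖geomOp A ψ‖ :=
    (A.le_opNorm _).trans_lt (by nlinarith)
  gcongr

/-- The adjoint form of the energy identity for unitary `U`. -/
theorem re_herglotzElem_unitary {U : H ≃ₗᵢ[ℂ] H} {ζ : ℂ} (hζ : ‖ζ‖ < 1) (ψ : H) :
    (herglotzElem (ζ • unitaryOp U) ψ).re =
      (1 - ‖ζ‖ ^ 2) * ‖(geomOp (ζ • unitaryOp U)).adjoint ψ‖ ^ 2 := by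
  have h := poissonElem_eq (U := U) hζ ψ ψ
  rw [inner_self_eq_norm_sq_to_K] at h
  have h2 := congrArg Complex.re h
  rw [poissonElem] at h2
  simp only [Complex.sub_re, Complex.add_re, Complex.conj_re] at h2
  rw [herglotzElem, Complex.sub_re, Complex.mul_re, Complex.re_ofNat, Complex.im_ofNat, zero_mul,
    sub_zero, two_mul, h2]
  rw [← Complex.ofReal_re ((1 - ‖ζ‖ ^ 2) * _)]
  congr 1
  simp

variable {U : H ≃ₗᵢ[ℂ] H} {ζ : ℂ} {P : H →L[ℂ] H}

/-- `ζ U` with the range of `P` multiplied by `w`. -/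
noncomputable def phaseOp (U : H ≃ₗᵢ[ℂ] H) (ζ : ℂ) (P : H →L[ℂ] H) (w : ℂ) : H →L[ℂ] H :=
  (ζ • unitaryOp U) * (1 + (w - 1) • P)

omit [CompleteSpace H] in
-- The factor `1 + (w - 1)P` scales the range of the orthogonal projection by `w` and fixes its
-- complement, so it is a contraction by Pythagoras. The resolvent is therefore analytic at every
-- point of the closed disc.
theorem norm_phaseOp_lt (hζ : ‖ζ‖ < 1) (hP : ∀ v, P (P v) = P v)
    (hPs : ∀ u v, inner ℂ (P u) v = inner ℂ u (P v)) {w : ℂ} (hw : ‖w‖ ≤ 1) :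
    ‖phaseOp U ζ P w‖ < 1 := by
  refine lt_of_le_of_lt (ContinuousLinearMap.opNorm_le_bound _ (norm_nonneg ζ) fun v => ?_) hζ
  have h1 : phaseOp U ζ P w v = ζ • U (v - P v + w • P v) := by
    simp only [phaseOp, mul_apply_eq_comp]
    change ζ • U (v + (w - 1) • P v) = _
    congr 2
    module
  have h2 : ∀ a : ℂ, ‖v - P v + a • P v‖ ^ 2 = ‖v - P v‖ ^ 2 + ‖a‖ ^ 2 * ‖P v‖ ^ 2 := by
    intro a
    have horth : inner ℂ (v - P v) (a • P v) = 0 := by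
      rw [inner_smul_right, inner_sub_left, hPs v (P v), hP, sub_self, mul_zero]
    have := norm_add_sq_eq_norm_sq_add_norm_sq_of_inner_eq_zero _ _ horth
    rw [norm_smul] at this
    nlinarith
  rw [h1, norm_smul, LinearIsometryEquiv.norm_map]
  gcongr
  have h3 := h2 w
  have h4 := h2 1
  rw [one_smul, sub_add_cancel, norm_one] at h4
  refine le_of_sq_le_sq ?_ (norm_nonneg _)
  rw [h3, h4]
  gcongr

theorem differentiableAt_herglotzElem (hζ : ‖ζ‖ < 1) (hP : ∀ v, P (P v) = P v)
    (hPs : ∀ u v, inner ℂ (P u) v = inner ℂ u (P v)) (ψ : H) {w : ℂ} (hw : ‖w‖ ≤ 1) :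
    DifferentiableAt ℂ (fun w => herglotzElem (phaseOp U ζ P w) ψ) w := by
  have h1 : DifferentiableAt ℂ (fun w => 1 - phaseOp U ζ P w) w := by
    unfold phaseOp
    fun_prop
  have h2 : DifferentiableAt ℂ (fun w => geomOp (phaseOp U ζ P w)) w :=
    DifferentiableAt.comp w (differentiableAt_inverse
      (isUnit_one_sub_of_norm_lt_one (norm_phaseOp_lt hζ hP hPs hw))) h1
  have h3 : DifferentiableAt ℂ (fun w => innerSL ℂ ψ (geomOp (phaseOp U ζ P w) ψ)) w :=
    (innerSL ℂ ψ).differentiableAt.comp w (h2.clm_apply (differentiableAt_const ψ))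
  exact (h3.const_mul 2).sub_const _

/-- At `w = 0` the operator kills `ψ`, so the resolvent fixes it. The central value depends neither
on `U` nor on `ζ`, which makes all averages uniform. -/
theorem herglotzElem_phaseOp_zero (hζ : ‖ζ‖ < 1) (hP : ∀ v, P (P v) = P v)
    (hPs : ∀ u v, inner ℂ (P u) v = inner ℂ u (P v)) {ψ : H} (hψ : P ψ = ψ) :
    herglotzElem (phaseOp U ζ P 0) ψ = ((‖ψ‖ ^ 2 : ℝ) : ℂ) := by
  have h0 : phaseOp U ζ P 0 ψ = 0 := by
    simp [phaseOp, mul_apply_eq_comp, hψ]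
  have h1 := geomOp_apply_sub (norm_phaseOp_lt (U := U) hζ hP hPs (w := 0) (by simp)) ψ
  rw [h0, sub_zero] at h1
  rw [herglotzElem, h1, inner_self_eq_norm_sq_to_K]
  push_cast
  ring_nf
  simp

theorem lintegral_herglotzElem_rpow_le (hζ : ‖ζ‖ < 1) (hP : ∀ v, P (P v) = P v)
    (hPs : ∀ u v, inner ℂ (P u) v = inner ℂ u (P v)) {ψ : H} (hψ : P ψ = ψ) :
    ∫⁻ θ : Torus, ‖herglotzElem (phaseOp U ζ P (toCircle θ)) ψ‖ₑ ^ (1 / 2 : ℝ) ∂haarAddCircle ≤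
      2 * ‖ψ‖ₑ := by
  by_cases h0 : ψ = 0
  · simp [h0, herglotzElem]
  refine (lintegral_rpow_half_toCircle_le
    (fun w hw => differentiableAt_herglotzElem (U := U) hζ hP hPs ψ hw)
    (fun w hw => re_herglotzElem_pos (norm_phaseOp_lt hζ hP hPs hw) h0)).trans_eq ?_
  rw [herglotzElem_phaseOp_zero hζ hP hPs hψ]
  congr 1
  rw [← ofReal_norm, Complex.norm_real, Real.norm_of_nonneg (by positivity),
    ENNReal.ofReal_rpow_of_nonneg (by positivity) (by norm_num), ← Real.sqrt_eq_rpow,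
    Real.sqrt_sq (norm_nonneg _), ofReal_norm]

theorem lintegral_re_herglotzElem (hζ : ‖ζ‖ < 1) (hP : ∀ v, P (P v) = P v)
    (hPs : ∀ u v, inner ℂ (P u) v = inner ℂ u (P v)) {ψ : H} (hψ : P ψ = ψ) (h0 : ψ ≠ 0) :
    ∫⁻ θ : Torus, ENNReal.ofReal (herglotzElem (phaseOp U ζ P (toCircle θ)) ψ).re ∂haarAddCircle =
      ENNReal.ofReal (‖ψ‖ ^ 2) := by
  rw [lintegral_re_toCircle_eq
    (fun w hw => differentiableAt_herglotzElem (U := U) hζ hP hPs ψ hw)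
    (fun w hw => re_herglotzElem_pos (norm_phaseOp_lt hζ hP hPs hw) h0),
    herglotzElem_phaseOp_zero hζ hP hPs hψ, Complex.ofReal_re]

omit [CompleteSpace H] in
-- Kolmogorov's bound needs a positive real part, which diagonal Herglotz elements have;
-- polarization writes an off-diagonal resolvent element through four of them and `⟨e, f⟩ / 2`.
theorem enorm_inner_geomOp_rpow_le (A : H →L[ℂ] H) {e f : H} (he : ‖e‖ = 1) (hf : ‖f‖ = 1) :
    ‖inner ℂ e (geomOp A f)‖ₑ ^ (1 / 2 : ℝ) ≤
      ‖herglotzElem A (f + (1 : ℂ) • e)‖ₑ ^ (1 / 2 : ℝ) +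
      ‖herglotzElem A (f + (-1 : ℂ) • e)‖ₑ ^ (1 / 2 : ℝ) +
      ‖herglotzElem A (f + Complex.I • e)‖ₑ ^ (1 / 2 : ℝ) +
      ‖herglotzElem A (f + (-Complex.I) • e)‖ₑ ^ (1 / 2 : ℝ) + 1 := by
  set a := herglotzElem A (f + (1 : ℂ) • e) with ha
  set b := herglotzElem A (f + (-1 : ℂ) • e) with hb
  set c := herglotzElem A (f + Complex.I • e) with hc
  set d := herglotzElem A (f + (-Complex.I) • e) with hd
  have hpol : inner ℂ e (geomOp A f) =
      (1 / 8 : ℂ) * (a - b + Complex.I * c - Complex.I * d) + (1 / 2 : ℂ) * inner ℂ e f := by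
    simp only [ha, hb, hc, hd, herglotzElem]
    simp only [map_add, map_smul, inner_add_left, inner_add_right, inner_smul_left,
        inner_smul_right]
    simp only [map_one, map_neg, Complex.conj_I]
    ring_nf
    simp only [Complex.I_sq]
    ring
  have hn : ‖inner ℂ e (geomOp A f)‖ ≤ ‖a‖ + ‖b‖ + ‖c‖ + ‖d‖ + 1 := by
    rw [hpol]
    have h1 : ‖inner ℂ e f‖ ≤ 1 := by
      simpa [he, hf] using norm_inner_le_norm (𝕜 := ℂ) e f
    have h2 : ‖a - b + Complex.I * c - Complex.I * d‖ ≤ ‖a‖ + ‖b‖ + ‖c‖ + ‖d‖ := by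
      refine (norm_sub_le _ _).trans ?_
      refine add_le_add ((norm_add_le _ _).trans (add_le_add (norm_sub_le _ _) ?_)) ?_ <;> simp
    refine (norm_add_le _ _).trans ?_
    rw [norm_mul, norm_mul]
    have h8 : ‖(1 / 8 : ℂ)‖ = 1 / 8 := by norm_num
    have h9 : ‖(1 / 2 : ℂ)‖ = 1 / 2 := by norm_num
    rw [h8, h9]
    nlinarith [norm_nonneg a, norm_nonneg b, norm_nonneg c, norm_nonneg d]
  have hn' : ‖inner ℂ e (geomOp A f)‖ₑ ≤ ‖a‖ₑ + ‖b‖ₑ + ‖c‖ₑ + ‖d‖ₑ + 1 := by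
    simp only [← ofReal_norm]
    rw [← ENNReal.ofReal_one, ← ENNReal.ofReal_add, ← ENNReal.ofReal_add, ← ENNReal.ofReal_add,
      ← ENNReal.ofReal_add]
    · exact ENNReal.ofReal_le_ofReal hn
    all_goals positivity
  have hsub : ∀ x y : ℝ≥0∞, (x + y) ^ (1 / 2 : ℝ) ≤ x ^ (1 / 2 : ℝ) + y ^ (1 / 2 : ℝ) := fun x y =>
    ENNReal.rpow_add_le_add_rpow x y (by norm_num) (by norm_num)
  calc _ ≤ (‖a‖ₑ + ‖b‖ₑ + ‖c‖ₑ + ‖d‖ₑ + 1) ^ (1 / 2 : ℝ) := by gcongr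
    _ ≤ (‖a‖ₑ + ‖b‖ₑ + ‖c‖ₑ + ‖d‖ₑ) ^ (1 / 2 : ℝ) + 1 ^ (1 / 2 : ℝ) := hsub _ _
    _ ≤ _ := by
      rw [ENNReal.one_rpow]
      gcongr
      exact (hsub _ _).trans (by gcongr; exact (hsub _ _).trans (by gcongr; exact hsub _ _))

/-- The a priori bound on square roots of resolvent matrix elements. -/
theorem lintegral_inner_geomOp_rpow_le (hζ : ‖ζ‖ < 1) (hP : ∀ v, P (P v) = P v)
    (hPs : ∀ u v, inner ℂ (P u) v = inner ℂ u (P v)) {e f : H} (he : ‖e‖ = 1) (hf : ‖f‖ = 1)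
    (hPe : P e = e) (hPf : P f = f) :
    ∫⁻ θ : Torus, ‖inner ℂ e (geomOp (phaseOp U ζ P (toCircle θ)) f)‖ₑ ^ (1 / 2 : ℝ)
      ∂haarAddCircle ≤ 17 := by
  let q : ℂ → Torus → ℝ≥0∞ := fun a θ =>
    ‖herglotzElem (phaseOp U ζ P (toCircle θ)) (f + a • e)‖ₑ ^ (1 / 2 : ℝ)
  have hqm : ∀ a, Measurable (q a) := fun a => by
    have := continuous_comp_toCircle
      (fun w hw => differentiableAt_herglotzElem (U := U) hζ hP hPs (f + a • e) hw)
    exact (this.measurable.enorm).pow_const _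
  have hq : ∀ a : ℂ, ‖a‖ = 1 → ∫⁻ θ, q a θ ∂haarAddCircle ≤ 4 := by
    intro a ha
    refine (lintegral_herglotzElem_rpow_le hζ hP hPs (by rw [map_add, map_smul, hPe, hPf])).trans ?_
    have : ‖f + a • e‖ₑ ≤ 2 := by
      rw [← ofReal_norm]
      refine ENNReal.ofReal_le_of_le_toReal ?_
      refine (norm_add_le _ _).trans ?_
      rw [norm_smul, ha, he, hf]; norm_num
    calc 2 * ‖f + a • e‖ₑ ≤ 2 * 2 := by gcongr
      _ = 4 := by norm_num
  calc _ ≤ ∫⁻ θ, (q 1 θ + q (-1) θ + q Complex.I θ + q (-Complex.I) θ + 1) ∂haarAddCircle :=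
        lintegral_mono fun θ => enorm_inner_geomOp_rpow_le _ he hf
    _ = ∫⁻ θ, q 1 θ ∂haarAddCircle + ∫⁻ θ, q (-1) θ ∂haarAddCircle +
        ∫⁻ θ, q Complex.I θ ∂haarAddCircle + ∫⁻ θ, q (-Complex.I) θ ∂haarAddCircle + 1 := by
        rw [lintegral_add_right _ measurable_const, lintegral_add_right _ (hqm _),
          lintegral_add_right _ (hqm _), lintegral_add_right _ (hqm _)]
        simp
    -- Each of the four means is at most `2 ‖f + a e‖ ≤ 4`; the last summand bounds the contribution
    -- of `⟨e, f⟩`.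
    _ ≤ 4 + 4 + 4 + 4 + 1 := by
        gcongr <;> exact hq _ (by simp)
    _ = 17 := by norm_num

end RankPhase

end ScatteringWalk

namespace ScatteringWalk
open Filter Topology AddCircle

variable {V : Type*}

/-! ### The canonical basis and the edges at two vertices -/

section Edges

variable {G : SimpleGraph V} [DecidableEq V]

theorem inner_ket (e : DirEdge G) (v : EdgeSpace G) : inner ℂ (ket e) v = v e := by
  rw [ket, lp.inner_single_left]
  simp

theorem ket_apply (e e' : DirEdge G) : (ket e : EdgeSpace G) e' = if e' = e then 1 else 0 := by
  rw [ket, lp.single_apply]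
  by_cases h : e' = e
  · subst h; simp
  · simp [h]

theorem norm_ket (e : DirEdge G) : ‖(ket e : EdgeSpace G)‖ = 1 := by
  rw [ket, lp.norm_single (by norm_num)]
  simp

variable [G.LocallyFinite]

/-- The directed edges arriving at `x` or `y`. -/
def edgesAt (G : SimpleGraph V) [G.LocallyFinite] (x y : V) : Finset (DirEdge G) :=
  (Finset.univ.image fun z : G.neighborSet x => inEdge G ⟨x, z⟩) ∪
    Finset.univ.image fun z : G.neighborSet y => inEdge G ⟨y, z⟩

theorem mem_edgesAt {x y : V} {e : DirEdge G} : e ∈ edgesAt G x y ↔ e.1.1 = x ∨ e.1.1 = y := by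
  have h : ∀ x : V, e ∈ (Finset.univ.image fun z : G.neighborSet x => inEdge G ⟨x, z⟩) ↔
      e.1.1 = x := by
    intro x
    rw [Finset.mem_image]
    constructor
    · rintro ⟨z, -, rfl⟩; rfl
    · rintro rfl
      exact ⟨⟨e.1.2, e.2⟩, Finset.mem_univ _, rfl⟩
  rw [edgesAt, Finset.mem_union, h, h]

theorem card_edgesAt_le {d : ℕ} (hd : ∀ x : V, G.degree x ≤ d) (x y : V) :
    (edgesAt G x y).card ≤ 2 * d := by
  have h : ∀ x : V, (Finset.univ.image fun z : G.neighborSet x => inEdge G ⟨x, z⟩).card ≤ d := by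
    intro x
    refine Finset.card_image_le.trans ?_
    rw [Finset.card_univ, G.card_neighborSet_eq_degree]
    exact hd x
  refine (Finset.card_union_le _ _).trans ?_
  have := h x
  have := h y
  omega

theorem sum_edgesAt {M : Type*} [AddCommMonoid M] {x y : V} (hxy : x ≠ y) (F : DirEdge G → M) :
    ∑ e ∈ edgesAt G x y, F e = ∑ z : G.neighborSet x, F (inEdge G ⟨x, z⟩) +
      ∑ z : G.neighborSet y, F (inEdge G ⟨y, z⟩) := by
  have hinj : ∀ x : V, Function.Injective fun z : G.neighborSet x => inEdge G ⟨x, z⟩ := by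
    intro x z z' h
    have := congrArg (fun e : DirEdge G => e.1.2) h
    exact Subtype.ext this
  rw [edgesAt, Finset.sum_union, Finset.sum_image fun _ _ _ _ h => hinj x h,
    Finset.sum_image fun _ _ _ _ h => hinj y h]
  rw [Finset.disjoint_left]
  intro e h1 h2
  obtain ⟨z, -, rfl⟩ := Finset.mem_image.1 h1
  obtain ⟨z', -, h⟩ := Finset.mem_image.1 h2
  exact hxy (congrArg (fun e : DirEdge G => e.1.1) h).symm

/-- The coordinate projection onto the edges in `F`. -/
noncomputable def edgeProj (F : Finset (DirEdge G)) : EdgeSpace G →L[ℂ] EdgeSpace G :=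
  ∑ e ∈ F, (innerSL ℂ (ket e)).smulRight (ket e)

omit [G.LocallyFinite] in
theorem sum_smul_ket_apply (F : Finset (DirEdge G)) (c : DirEdge G → ℂ) (e : DirEdge G) :
    (∑ e' ∈ F, c e' • (ket e' : EdgeSpace G)) e = if e ∈ F then c e else 0 := by
  rw [lp.coeFn_sum, Finset.sum_apply]
  simp only [lp.coeFn_smul, Pi.smul_apply, ket_apply, smul_eq_mul, mul_ite, mul_one, mul_zero]
  rw [Finset.sum_ite_eq]

omit [G.LocallyFinite] in
theorem edgeProj_eq (F : Finset (DirEdge G)) (v : EdgeSpace G) :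
    edgeProj F v = ∑ e ∈ F, v e • (ket e : EdgeSpace G) := by
  rw [edgeProj, sum_apply]
  refine Finset.sum_congr rfl fun e _ => ?_
  rw [ContinuousLinearMap.smulRight_apply, innerSL_apply_apply, inner_ket]

omit [G.LocallyFinite] in
theorem edgeProj_apply (F : Finset (DirEdge G)) (v : EdgeSpace G) (e : DirEdge G) :
    edgeProj F v e = if e ∈ F then v e else 0 := by
  rw [edgeProj_eq, sum_smul_ket_apply]

omit [G.LocallyFinite] in
theorem edgeProj_idem (F : Finset (DirEdge G)) (v : EdgeSpace G) :
    edgeProj F (edgeProj F v) = edgeProj F v := by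
  ext e
  rw [edgeProj_apply, edgeProj_apply]
  split_ifs <;> rfl

omit [G.LocallyFinite] in
theorem edgeProj_symm (F : Finset (DirEdge G)) (u v : EdgeSpace G) :
    inner ℂ (edgeProj F u) v = inner ℂ u (edgeProj F v) := by
  rw [edgeProj_eq, edgeProj_eq, sum_inner, inner_sum]
  refine Finset.sum_congr rfl fun e _ => ?_
  rw [inner_smul_left, inner_smul_right, inner_ket, ← inner_conj_symm, inner_ket, mul_comm]

omit [G.LocallyFinite] in
theorem edgeProj_ket {F : Finset (DirEdge G)} {e : DirEdge G} (he : e ∈ F) :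
    edgeProj F (ket e) = ket e := by
  ext e'
  rw [edgeProj_apply, ket_apply]
  by_cases h : e' = e
  · simp [h, he]
  · simp [h]

end Edges

/-! ### Resolvents of the random walk -/

section RandomWalk

variable {G : SimpleGraph V} [DecidableEq V] [G.LocallyFinite] (S : ScatteringFamily G)

theorem randomWalk_apply (θ : V → Torus) (v : EdgeSpace G) (e : DirEdge G) :
    randomWalk S θ v e = ((toCircle (θ e.1.2) : Circle) : ℂ) *
      ∑ y : G.neighborSet e.1.2, (S e.1.2).1 ⟨e.1.1, e.2.symm⟩ y * v (inEdge G ⟨e.1.2, y⟩) := by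
  change ∑ y : G.neighborSet e.1.2, (((toCircle (θ e.1.2) : Circle) : ℂ) •
    (S e.1.2).1 ⟨e.1.1, e.2.symm⟩ y) * v (inEdge G ⟨e.1.2, y⟩) = _
  rw [Finset.mul_sum]
  refine Finset.sum_congr rfl fun y _ => ?_
  rw [smul_eq_mul, mul_assoc]

/-- The relative change of a phase. -/
noncomputable def phaseJump (θ θ' : V → Torus) (v : V) : ℂ :=
  (toCircle (θ' v - θ v) : ℂ) - 1

omit [DecidableEq V] in
theorem norm_phaseJump_le (θ θ' : V → Torus) (v : V) : ‖phaseJump θ θ' v‖ ≤ 2 := by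
  refine (norm_sub_le _ _).trans ?_
  rw [Circle.norm_coe, norm_one]; norm_num

omit [DecidableEq V] in
theorem toCircle_mul_phaseJump (θ θ' : V → Torus) (v : V) :
    (toCircle (θ v) : ℂ) * (1 + phaseJump θ θ' v) = (toCircle (θ' v) : ℂ) := by
  rw [phaseJump, add_sub_cancel, ← Circle.coe_mul, ← toCircle_add, add_sub_cancel]

/-- The phase at `x` multiplies whatever arrives at `x`, so changing it amounts to rescaling the
components on the edges at `x` before the walk acts. -/
theorem randomWalk_change {θ θ' : V → Torus} {x y : V} (h : ∀ v, v ≠ x → v ≠ y → θ' v = θ v)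
    (v : EdgeSpace G) :
    randomWalk S θ' v = randomWalk S θ (v + ∑ e ∈ edgesAt G x y,
      (phaseJump θ θ' e.1.1 * v e) • (ket e : EdgeSpace G)) := by
  ext e
  rw [randomWalk_apply, randomWalk_apply]
  have hin : ∀ z : G.neighborSet e.1.2, (v + ∑ e ∈ edgesAt G x y,
      (phaseJump θ θ' e.1.1 * v e) • (ket e : EdgeSpace G) : EdgeSpace G) (inEdge G ⟨e.1.2, z⟩) =
      (if e.1.2 = x ∨ e.1.2 = y then 1 + phaseJump θ θ' e.1.2 else 1) *
        v (inEdge G ⟨e.1.2, z⟩) := by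
    intro z
    rw [lp.coeFn_add, Pi.add_apply,
      sum_smul_ket_apply (c := fun e => phaseJump θ θ' e.1.1 * v e)]
    simp only [mem_edgesAt]
    change v (inEdge G ⟨e.1.2, z⟩) + (if e.1.2 = x ∨ e.1.2 = y then
      phaseJump θ θ' e.1.2 * v (inEdge G ⟨e.1.2, z⟩) else 0) = _
    split_ifs <;> ring
  simp_rw [hin]
  by_cases hx : e.1.2 = x ∨ e.1.2 = y
  · simp only [hx, if_true]
    rw [← toCircle_mul_phaseJump θ θ', Finset.mul_sum, Finset.mul_sum]
    exact Finset.sum_congr rfl fun z _ => by ring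
  · simp only [hx, if_false, one_mul]
    rw [not_or] at hx
    rw [h _ hx.1 hx.2]

/-- The phases at `x` and `y` shifted by `α`. -/
noncomputable def shiftPhase (x y : V) (α : Torus) (θ : V → Torus) : V → Torus :=
  fun v => if v = x ∨ v = y then θ v + α else θ v

theorem phaseOp_randomWalk (x y : V) (α : Torus) (θ : V → Torus) (ζ : ℂ) :
    ζ • unitaryOp (randomWalk S (shiftPhase x y α θ)) =
      phaseOp (randomWalk S θ) ζ (edgeProj (edgesAt G x y)) (toCircle α) := by
  ext1 v
  rw [phaseOp, mul_apply_eq_comp]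
  change ζ • randomWalk S (shiftPhase x y α θ) v = ζ • randomWalk S θ
    (v + ((toCircle α : ℂ) - 1) • edgeProj (edgesAt G x y) v)
  rw [randomWalk_change S (θ := θ) (x := x) (y := y)
    (fun v h1 h2 => by simp [shiftPhase, h1, h2]), edgeProj_eq, Finset.smul_sum]
  congr 3
  refine Finset.sum_congr rfl fun e he => ?_
  rw [mem_edgesAt] at he
  rw [smul_smul, phaseJump, shiftPhase, if_pos he, add_sub_cancel_left]

/-- The matrix elements of the resolvent `(1 - ζ U_θ)⁻¹`. -/
noncomputable def resolventElem (θ : V → Torus) (ζ : ℂ) (e f : DirEdge G) : ℂ :=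
  inner ℂ (ket e) (geomOp (ζ • unitaryOp (randomWalk S θ)) (ket f))

variable {S} {ζ : ℂ}

/-- The resolvent identity for a perturbation supported on the edges at `x` and `y`. The Kronecker
term comes from `X A = X - 1` for `X = (1 - A)⁻¹`. -/
theorem resolventElem_change (hζ : ‖ζ‖ < 1) {θ θ' : V → Torus} {x y : V}
    (h : ∀ v, v ≠ x → v ≠ y → θ' v = θ v) (e f : DirEdge G) :
    resolventElem S θ' ζ e f = resolventElem S θ ζ e f + ∑ e' ∈ edgesAt G x y,
      phaseJump θ θ' e'.1.1 * resolventElem S θ' ζ e' f *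
        (resolventElem S θ ζ e e' - if e = e' then 1 else 0) := by
  have hA : ‖ζ • unitaryOp (randomWalk S θ)‖ < 1 := norm_smul_unitaryOp_lt hζ
  have hA' : ‖ζ • unitaryOp (randomWalk S θ')‖ < 1 := norm_smul_unitaryOp_lt hζ
  have h1 := sub_geomOp_apply hA' (ket f)
  set φ := geomOp (ζ • unitaryOp (randomWalk S θ')) (ket f) with hφ
  set N : EdgeSpace G := ∑ e ∈ edgesAt G x y,
    (phaseJump θ θ' e.1.1 * φ e) • (ket e : EdgeSpace G) with hN
  have h2 : (ζ • unitaryOp (randomWalk S θ')) φ = (ζ • unitaryOp (randomWalk S θ)) (φ + N) :=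
    congrArg (ζ • ·) (randomWalk_change S h φ)
  rw [h2] at h1
  set X := geomOp (ζ • unitaryOp (randomWalk S θ)) with hX
  have h3 : X (ket f) = φ - X N + N := by
    rw [← h1, map_add, map_sub, map_add, ← sub_sub, geomOp_apply_map hA, geomOp_apply_map hA, ← hX]
    abel
  have h4 : φ = X (ket f) + (X N - N) := by rw [h3]; abel
  have h5 : inner ℂ (ket e) (X N - N) = ∑ e' ∈ edgesAt G x y,
      phaseJump θ θ' e'.1.1 * resolventElem S θ' ζ e' f *
        (resolventElem S θ ζ e e' - if e = e' then 1 else 0) := by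
    rw [hN, map_sum, ← Finset.sum_sub_distrib, inner_sum]
    refine Finset.sum_congr rfl fun e' _ => ?_
    rw [map_smul, ← smul_sub, inner_smul_right, inner_sub_right, inner_ket e (ket e'), ket_apply,
      resolventElem, resolventElem, inner_ket e' _]
  calc resolventElem S θ' ζ e f = inner ℂ (ket e) φ := rfl
    _ = inner ℂ (ket e) (X (ket f)) + inner ℂ (ket e) (X N - N) := by
      rw [← inner_add_right, ← h4]
    _ = _ := by rw [h5]; rfl

/-- Since `S(x)` is unitary, the walk sends `v = ∑_w conj(S_{yw}(x)) |xw⟩` to `e^{iθ_x}|yx⟩`.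
Applying the resolvent to `ζUv` gives the relation without inhomogeneous term, as `e` does not
arrive at `x` and so `⟨e, v⟩ = 0`; splitting `S = 1 + (S - 1)` isolates the reflected edge. -/
theorem resolventElem_flip (hζ : ‖ζ‖ < 1) (θ : V → Torus) {e : DirEdge G} {x y : V}
    (he : e.1.1 ≠ x) (hxy : G.Adj x y) :
    resolventElem S θ ζ e ⟨(x, y), hxy⟩ =
      ζ * (toCircle (θ x) : ℂ) * resolventElem S θ ζ e ⟨(y, x), hxy.symm⟩ -
      ∑ w : G.neighborSet x, (starRingEnd ℂ) ((S x).1 ⟨y, hxy⟩ w - (1 : Matrix (G.neighborSet x) (G.neighborSet x) ℂ) ⟨y, hxy⟩ w) *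
        resolventElem S θ ζ e (inEdge G ⟨x, w⟩) := by
  have hA : ‖ζ • unitaryOp (randomWalk S θ)‖ < 1 := norm_smul_unitaryOp_lt hζ
  set v : EdgeSpace G := ∑ w : G.neighborSet x,
    (starRingEnd ℂ) ((S x).1 ⟨y, hxy⟩ w) • (ket (inEdge G ⟨x, w⟩) : EdgeSpace G) with hv
  have hU : randomWalk S θ v = (toCircle (θ x) : ℂ) • (ket ⟨(y, x), hxy.symm⟩ : EdgeSpace G) := by
    have h1 : ∀ w : G.neighborSet x, randomWalk S θ (ket (inEdge G ⟨x, w⟩)) =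
        ∑ z : G.neighborSet x, ((toCircle (θ x) : ℂ) * (S x).1 z w) • ket (outEdge G ⟨x, z⟩) :=
      fun w => walk_ket (phaseFamily θ S) w.2
    rw [hv, map_sum]
    simp_rw [map_smul, h1, Finset.smul_sum]
    rw [Finset.sum_comm]
    have h2 : ∀ z : G.neighborSet x, ∑ w : G.neighborSet x, (starRingEnd ℂ) ((S x).1 ⟨y, hxy⟩ w) •
        ((toCircle (θ x) : ℂ) * (S x).1 z w) • (ket (outEdge G ⟨x, z⟩) : EdgeSpace G) =
        ((toCircle (θ x) : ℂ) * (1 : Matrix (G.neighborSet x) (G.neighborSet x) ℂ) z ⟨y, hxy⟩) • ket (outEdge G ⟨x, z⟩) := by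
      intro z
      have h3 : (S x).1 * star (S x).1 = 1 := (Matrix.mem_unitaryGroup_iff).1 (S x).2
      rw [← h3, Matrix.mul_apply, Finset.mul_sum, Finset.sum_smul]
      refine Finset.sum_congr rfl fun w _ => ?_
      rw [smul_smul, Matrix.star_apply, RCLike.star_def]
      congr 1; ring
    simp_rw [h2]
    rw [Finset.sum_eq_single (⟨y, hxy⟩ : G.neighborSet x)]
    · simp [outEdge]
    · intro z _ hz
      simp [Matrix.one_apply_ne hz]
    · simp
  have h1 := geomOp_apply_map hA v
  have h2 : (ζ • unitaryOp (randomWalk S θ)) v =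
      (ζ * (toCircle (θ x) : ℂ)) • (ket ⟨(y, x), hxy.symm⟩ : EdgeSpace G) := by
    rw [mul_smul, ← hU]; rfl
  rw [h2, map_smul] at h1
  have h3 := congrArg (fun u => inner ℂ (ket e) u) h1
  simp only [inner_smul_right, inner_sub_right] at h3
  have h4 : inner ℂ (ket e) v = 0 := by
    rw [hv, inner_sum]
    refine Finset.sum_eq_zero fun w _ => ?_
    rw [inner_smul_right, inner_ket, ket_apply, if_neg, mul_zero]
    rintro rfl
    exact he rfl
  have h5 : inner ℂ (ket e) (geomOp (ζ • unitaryOp (randomWalk S θ)) v) =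
      resolventElem S θ ζ e ⟨(x, y), hxy⟩ + ∑ w : G.neighborSet x,
        (starRingEnd ℂ) ((S x).1 ⟨y, hxy⟩ w - (1 : Matrix (G.neighborSet x) (G.neighborSet x) ℂ) ⟨y, hxy⟩ w) *
        resolventElem S θ ζ e (inEdge G ⟨x, w⟩) := by
    rw [hv, map_sum, inner_sum]
    simp only [map_sub, sub_mul, map_smul, inner_smul_right]
    rw [Finset.sum_sub_distrib]
    have h6 : ∑ w : G.neighborSet x, (starRingEnd ℂ) ((1 : Matrix (G.neighborSet x) (G.neighborSet x) ℂ) ⟨y, hxy⟩ w) *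
        resolventElem S θ ζ e (inEdge G ⟨x, w⟩) = resolventElem S θ ζ e ⟨(x, y), hxy⟩ := by
      rw [Finset.sum_eq_single (⟨y, hxy⟩ : G.neighborSet x)]
      · simp [inEdge]
      · intro z _ hz
        simp [Matrix.one_apply_ne hz.symm]
      · simp
    rw [h6, add_sub_cancel]
    rfl
  rw [h4, sub_zero, h5] at h3
  rw [eq_sub_iff_add_eq, ← h3]
  rfl

/-- Flipping at `x` and then at `y` returns to the same edge with the factor `ζ² e^{i(θ_x + θ_y)}`;
both remainders carry entries of `S - 1`. -/
theorem norm_resolventElem_mul_le (hζ : ‖ζ‖ < 1) {φ : ℝ}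
    (hS : ∀ x z y, ‖(S x).1 z y - (1 : Matrix _ _ ℂ) z y‖ ≤ φ) (θ : V → Torus)
    {e : DirEdge G} {x y : V} (hex : e.1.1 ≠ x) (hey : e.1.1 ≠ y) (hxy : G.Adj x y) :
    ‖1 - ζ ^ 2 * (toCircle (θ x) : ℂ) * (toCircle (θ y) : ℂ)‖ *
      ‖resolventElem S θ ζ e ⟨(x, y), hxy⟩‖ ≤
      φ * ∑ f ∈ edgesAt G x y, ‖resolventElem S θ ζ e f‖ := by
  have h1 := resolventElem_flip (S := S) hζ θ hex hxy
  have h2 := resolventElem_flip (S := S) hζ θ hey hxy.symm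
  have hb : ∀ {x y : V} (hxy : G.Adj x y), ‖∑ w : G.neighborSet x,
      (starRingEnd ℂ) ((S x).1 ⟨y, hxy⟩ w - (1 : Matrix (G.neighborSet x) (G.neighborSet x) ℂ) ⟨y, hxy⟩ w) *
        resolventElem S θ ζ e (inEdge G ⟨x, w⟩)‖ ≤
      φ * ∑ w : G.neighborSet x, ‖resolventElem S θ ζ e (inEdge G ⟨x, w⟩)‖ := by
    intro x y hxy
    rw [Finset.mul_sum]
    refine norm_sum_le_of_le _ fun w _ => ?_
    rw [norm_mul, RCLike.norm_conj]
    exact mul_le_mul_of_nonneg_right (hS _ _ _) (norm_nonneg _)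
  have hbx := hb hxy
  have hby := hb hxy.symm
  rw [← norm_mul, sum_edgesAt hxy.ne, mul_add]
  set A := ∑ w : G.neighborSet x, (starRingEnd ℂ) ((S x).1 ⟨y, hxy⟩ w - (1 : Matrix (G.neighborSet x) (G.neighborSet x) ℂ) ⟨y, hxy⟩ w) *
        resolventElem S θ ζ e (inEdge G ⟨x, w⟩)
  set B := ∑ w : G.neighborSet y, (starRingEnd ℂ) ((S y).1 ⟨x, hxy.symm⟩ w - (1 : Matrix (G.neighborSet y) (G.neighborSet y) ℂ) ⟨x, hxy.symm⟩ w) *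
        resolventElem S θ ζ e (inEdge G ⟨y, w⟩)
  set X1 := resolventElem S θ ζ e ⟨(x, y), hxy⟩
  set X2 := resolventElem S θ ζ e ⟨(y, x), hxy.symm⟩
  have h3 : (1 - ζ ^ 2 * (toCircle (θ x) : ℂ) * (toCircle (θ y) : ℂ)) * X1 =
      -(A + ζ * (toCircle (θ x) : ℂ) * B) := by
    rw [h2] at h1
    linear_combination h1
  rw [h3, norm_neg]
  refine (norm_add_le _ _).trans (add_le_add hbx ?_)
  rw [norm_mul, norm_mul, Circle.norm_coe, mul_one]
  calc ‖ζ‖ * ‖B‖ ≤ 1 * ‖B‖ := by gcongr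
    _ ≤ _ := by rw [one_mul]; exact hby

end RandomWalk

end ScatteringWalk

namespace ScatteringWalk
open Filter Topology AddCircle

variable {V : Type*}

/-! ### Inequalities for fractional powers -/

section Fractional

theorem rpow_sum_le_sum_rpow {ι : Type*} (F : Finset ι) (a : ι → ℝ≥0∞) {p : ℝ} (hp : 0 < p)
    (hp1 : p ≤ 1) : (∑ i ∈ F, a i) ^ p ≤ ∑ i ∈ F, a i ^ p := by
  classical
  induction F using Finset.induction_on with
  | empty => simp [hp]
  | insert i F hi ih =>
    rw [Finset.sum_insert hi, Finset.sum_insert hi]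
    exact (ENNReal.rpow_add_le_add_rpow _ _ hp.le hp1).trans (by gcongr)

theorem rpow_quarter_le (a : ℝ≥0∞) : a ^ (1 / 4 : ℝ) ≤ 1 + a ^ (1 / 2 : ℝ) := by
  rcases le_total a 1 with h | h
  · exact (ENNReal.rpow_le_one h (by norm_num)).trans le_self_add
  · exact (ENNReal.rpow_le_rpow_of_exponent_le h (by norm_num)).trans le_add_self

/-- The reason for the exponent `1/4`: a product of two quarter powers is controlled by square
roots, whose means Kolmogorov's bound makes finite. -/
theorem rpow_quarter_mul_le (a b : ℝ≥0∞) :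
    a ^ (1 / 4 : ℝ) * b ^ (1 / 4 : ℝ) ≤ a ^ (1 / 2 : ℝ) + b ^ (1 / 2 : ℝ) := by
  have h : ∀ c : ℝ≥0∞, c ^ (1 / 4 : ℝ) * c ^ (1 / 4 : ℝ) = c ^ (1 / 2 : ℝ) := fun c => by
    rw [← ENNReal.rpow_add_of_nonneg _ _ (by norm_num) (by norm_num)]; norm_num
  rcases le_total a b with hab | hab
  · calc _ ≤ b ^ (1 / 4 : ℝ) * b ^ (1 / 4 : ℝ) := by gcongr
      _ ≤ _ := by rw [h]; exact le_add_self
  · calc _ ≤ a ^ (1 / 4 : ℝ) * a ^ (1 / 4 : ℝ) := by gcongr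
      _ ≤ _ := by rw [h]; exact le_self_add

theorem two_rpow_quarter_le : (2 : ℝ≥0∞) ^ (1 / 4 : ℝ) ≤ 2 := by
  simpa using ENNReal.rpow_le_rpow_of_exponent_le (x := 2) (by norm_num) (show (1 / 4 : ℝ) ≤ 1 by norm_num)

theorem sqrt_mul_le_of_le {ι : Type*} (F : Finset ι) (b c : ι → ℝ) (hb : ∀ i ∈ F, 0 ≤ b i)
    {s t a : ℝ} (hs1 : Real.sqrt s ≤ 1)
    (hc : ∀ i ∈ F, Real.sqrt s * c i ≤ t)
    (ha : a ≤ ∑ i ∈ F, b i + ∑ i ∈ F, 2 * b i * (c i + 1)) :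
    Real.sqrt s * a ≤ (∑ i ∈ F, b i) * (3 + 2 * t) := by
  have h0 := Real.sqrt_nonneg s
  calc Real.sqrt s * a ≤ Real.sqrt s * (∑ i ∈ F, b i + ∑ i ∈ F, 2 * b i * (c i + 1)) := by gcongr
    _ = ∑ i ∈ F, b i * (3 * Real.sqrt s + 2 * (Real.sqrt s * c i)) := by
        rw [← Finset.sum_add_distrib, Finset.mul_sum]
        exact Finset.sum_congr rfl fun _ _ => by ring
    _ ≤ ∑ i ∈ F, b i * (3 + 2 * t) := Finset.sum_le_sum fun i hi =>
        mul_le_mul_of_nonneg_left (by linarith [hc i hi]) (hb i hi)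
    _ = _ := (Finset.sum_mul _ _ _).symm

/-- Interpolation: for `q ≤ 1` the first bound is used with `q² ≤ q^{1/4}`, for `q ≥ 1` the bound
`T` suffices. The constants come from `(3 + 2√T)² ≤ 2·9 + 2·4T`. -/
theorem mul_sq_le_rpow_quarter {η T q a : ℝ} (hη0 : 0 ≤ η) (hT0 : 0 ≤ T) (hq0 : 0 ≤ q) (ha : 0 ≤ a)
    (key : Real.sqrt η * a ≤ q * (3 + 2 * Real.sqrt T)) (hb : η * a ^ 2 ≤ T) :
    η * a ^ 2 ≤ q ^ (1 / 4 : ℝ) * (18 + 8 * T) := by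
  have hsq : η * a ^ 2 = (Real.sqrt η * a) ^ 2 := by rw [mul_pow, Real.sq_sqrt hη0]
  rcases le_total q 1 with h1 | h1
  · have h2 : q ^ 2 ≤ q ^ (1 / 4 : ℝ) := by
      rw [← Real.rpow_natCast q 2]
      exact Real.rpow_le_rpow_of_exponent_ge' hq0 h1 (by norm_num) (by norm_num)
    calc η * a ^ 2 ≤ (q * (3 + 2 * Real.sqrt T)) ^ 2 := by
          rw [hsq]
          gcongr
      _ = q ^ 2 * (3 + 2 * Real.sqrt T) ^ 2 := by ring
      _ ≤ q ^ (1 / 4 : ℝ) * (18 + 8 * T) := by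
          gcongr
          nlinarith [Real.sq_sqrt hT0, sq_nonneg (3 - 2 * Real.sqrt T)]
  · have h2 : 1 ≤ q ^ (1 / 4 : ℝ) := Real.one_le_rpow h1 (by norm_num)
    calc η * a ^ 2 ≤ T := hb
      _ ≤ 1 * (18 + 8 * T) := by linarith
      _ ≤ _ := by gcongr

end Fractional

/-! ### Measurability in the phases -/

section Measurability

variable {G : SimpleGraph V} [DecidableEq V] [G.LocallyFinite] (S : ScatteringFamily G)

theorem measurable_inner_randomWalk_pow (k : ℕ) (e f : DirEdge G) :
    Measurable fun θ : V → Torus => inner ℂ (ket e) ((randomWalk S θ ^ (k : ℤ)) (ket f)) := by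
  induction k generalizing e with
  | zero => simp
  | succ k ih =>
    have h : ∀ θ : V → Torus, inner ℂ (ket e) ((randomWalk S θ ^ ((k + 1 : ℕ) : ℤ)) (ket f)) =
        ((toCircle (θ e.1.2) : Circle) : ℂ) * ∑ y : G.neighborSet e.1.2,
          (S e.1.2).1 ⟨e.1.1, e.2.symm⟩ y *
            inner ℂ (ket (inEdge G ⟨e.1.2, y⟩)) ((randomWalk S θ ^ (k : ℤ)) (ket f)) := by
      intro θ
      simp only [inner_ket]
      rw [Nat.cast_succ, add_comm (k : ℤ) 1, zpow_add_apply, zpow_one, randomWalk_apply]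
    simp_rw [h]
    refine Measurable.mul (continuous_toCircle_coe.measurable.comp (measurable_pi_apply _)) ?_
    exact Finset.measurable_sum _ fun y _ => (ih _).const_mul _

theorem measurable_inner_randomWalk_zpow (n : ℤ) (e f : DirEdge G) :
    Measurable fun θ : V → Torus => inner ℂ (ket e) ((randomWalk S θ ^ n) (ket f)) := by
  obtain ⟨k, rfl | rfl⟩ := n.eq_nat_or_neg
  · exact measurable_inner_randomWalk_pow S k e f
  · have h : ∀ θ : V → Torus, inner ℂ (ket e) ((randomWalk S θ ^ (-(k : ℤ))) (ket f)) =
        (starRingEnd ℂ) (inner ℂ (ket f) ((randomWalk S θ ^ (k : ℤ)) (ket e))) := by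
      intro θ
      rw [inner_conj_symm, inner_zpow_left]
    simp_rw [h]
    exact Complex.continuous_conj.measurable.comp (measurable_inner_randomWalk_pow S k f e)

/-- A limit of partial Neumann sums, whose coefficients are polynomials in finitely many phase
factors. -/
theorem measurable_resolventElem {Ω : Type*} [MeasurableSpace Ω] {Θ : Ω → V → Torus} {z : Ω → ℂ}
    (hΘ : Measurable Θ) (hz : Measurable z) (hz1 : ∀ w, ‖z w‖ < 1) (e f : DirEdge G) :
    Measurable fun w => resolventElem S (Θ w) (z w) e f := by
  refine measurable_of_tendsto_metrizable (f := fun (N : ℕ) w => ∑ k ∈ Finset.range N,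
    z w ^ k * inner ℂ (ket e) ((randomWalk S (Θ w) ^ (k : ℤ)) (ket f))) (fun N => ?_)
    (tendsto_pi_nhds.2 fun w =>
      (hasSum_inner_geomOp (randomWalk S (Θ w)) (hz1 w) (ket e) (ket f)).tendsto_sum_nat)
  exact Finset.measurable_sum _ fun k _ =>
    (hz.pow_const k).mul ((measurable_inner_randomWalk_pow S k e f).comp hΘ)

theorem measurable_shiftPhase (x y : V) (θ : V → Torus) :
    Measurable fun α : Torus => shiftPhase x y α θ := by
  refine measurable_pi_lambda _ fun v => ?_
  unfold shiftPhase
  split_ifs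
  · exact measurable_const.add measurable_id
  · exact measurable_const

end Measurability

/-! ### Averages over a common phase of two vertices -/

section ShiftAverages

variable {G : SimpleGraph V} [DecidableEq V] [G.LocallyFinite] (S : ScatteringFamily G) {ζ : ℂ}

theorem lintegral_resolventElem_shift_le (hζ : ‖ζ‖ < 1) {x y : V} {e f : DirEdge G}
    (he : e ∈ edgesAt G x y) (hf : f ∈ edgesAt G x y) (θ : V → Torus) :
    ∫⁻ α : Torus, ‖resolventElem S (shiftPhase x y α θ) ζ e f‖ₑ ^ (1 / 2 : ℝ) ∂haarAddCircle ≤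
      17 := by
  simp_rw [resolventElem, phaseOp_randomWalk]
  exact lintegral_inner_geomOp_rpow_le hζ (edgeProj_idem _) (edgeProj_symm _) (norm_ket e)
    (norm_ket f) (edgeProj_ket he) (edgeProj_ket hf)

theorem lintegral_herglotzElem_shift (hζ : ‖ζ‖ < 1) {x y : V} {e : DirEdge G}
    (he : e ∈ edgesAt G x y) (θ : V → Torus) :
    ∫⁻ α : Torus, ENNReal.ofReal (herglotzElem
      (ζ • unitaryOp (randomWalk S (shiftPhase x y α θ))) (ket e)).re ∂haarAddCircle = 1 := by
  simp_rw [phaseOp_randomWalk]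
  rw [lintegral_re_herglotzElem hζ (edgeProj_idem _) (edgeProj_symm _) (edgeProj_ket he)
    (norm_ne_zero_iff.1 (by rw [norm_ket]; norm_num)), norm_ket]
  simp

/-- The small denominator of a reflecting edge. -/
noncomputable def edgeDenom (ζ : ℂ) (x y : V) (θ : V → Torus) : ℂ :=
  1 - ζ ^ 2 * (toCircle (θ x) : ℂ) * (toCircle (θ y) : ℂ)

theorem re_edgeDenom_aux {a : ℂ} (ha : ‖a‖ < 1) : 0 < ((1 - a)⁻¹).re := by
  have h1 : 0 < (1 - a).re := by
    rw [Complex.sub_re, Complex.one_re]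
    linarith [Complex.re_le_norm a]
  rw [Complex.inv_re]
  refine div_pos h1 (Complex.normSq_pos.2 ?_)
  intro h
  rw [h] at h1
  simp at h1

omit [DecidableEq V] in
theorem edgeDenom_ne_zero (hζ : ‖ζ‖ < 1) (x y : V) (θ : V → Torus) : edgeDenom ζ x y θ ≠ 0 := by
  intro h
  have h1 : ‖ζ ^ 2 * (toCircle (θ x) : ℂ) * (toCircle (θ y) : ℂ)‖ < 1 := by
    rw [norm_mul, norm_mul, Circle.norm_coe, Circle.norm_coe, norm_pow, mul_one, mul_one]
    exact pow_lt_one₀ (norm_nonneg _) hζ two_ne_zero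
  have := re_edgeDenom_aux h1
  rw [edgeDenom] at h
  rw [h] at this
  simp at this

/-- Both phases rotate together, so the denominator is `1 - a w²` with `|a| < 1`; its inverse has
positive real part in the disc and the value one at the centre. -/
theorem lintegral_edgeDenom_shift_le (hζ : ‖ζ‖ < 1) {x y : V} (θ : V → Torus) :
    ∫⁻ α : Torus, ‖(edgeDenom ζ x y (shiftPhase x y α θ))⁻¹‖ₑ ^ (1 / 2 : ℝ) ∂haarAddCircle ≤ 2 := by
  set a : ℂ := ζ ^ 2 * (toCircle (θ x) : ℂ) * (toCircle (θ y) : ℂ) with ha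
  have hna : ‖a‖ < 1 := by
    rw [ha, norm_mul, norm_mul, Circle.norm_coe, Circle.norm_coe, norm_pow, mul_one, mul_one]
    exact pow_lt_one₀ (norm_nonneg _) hζ two_ne_zero
  have hnaw : ∀ w : ℂ, ‖w‖ ≤ 1 → ‖a * w ^ 2‖ < 1 := by
    intro w hw
    rw [norm_mul, norm_pow]
    calc ‖a‖ * ‖w‖ ^ 2 ≤ ‖a‖ * 1 := by gcongr; exact pow_le_one₀ (norm_nonneg _) hw
      _ < 1 := by rwa [mul_one]
  have hpos : ∀ w : ℂ, ‖w‖ ≤ 1 → 0 < ((1 - a * w ^ 2)⁻¹).re := fun w hw =>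
    re_edgeDenom_aux (hnaw w hw)
  have hd : ∀ w : ℂ, ‖w‖ ≤ 1 → DifferentiableAt ℂ (fun w : ℂ => (1 - a * w ^ 2)⁻¹) w := by
    intro w hw
    refine DifferentiableAt.inv (by fun_prop) fun h => ?_
    have := hpos w hw
    rw [h] at this
    simp at this
  have h := lintegral_rpow_half_toCircle_le hd hpos
  have heq : ∀ α : Torus, edgeDenom ζ x y (shiftPhase x y α θ) =
      1 - a * (toCircle α : ℂ) ^ 2 := by
    intro α
    simp only [edgeDenom, shiftPhase, true_or, or_true, if_true, toCircle_add, Circle.coe_mul, ha]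
    ring
  simp_rw [heq]
  refine h.trans ?_
  simp

end ShiftAverages

/-! ### Decoupling inequalities -/

section Pointwise

variable {G : SimpleGraph V} [DecidableEq V] [G.LocallyFinite] (S : ScatteringFamily G) {ζ : ℂ}

/-- The random factor of the decoupling inequality. -/
noncomputable def decayFactor (ζ : ℂ) (x y : V) (e : DirEdge G) (θ : V → Torus) : ℝ≥0∞ :=
  1 + ‖(edgeDenom ζ x y θ)⁻¹‖ₑ ^ (1 / 2 : ℝ) + 2 * ∑ f ∈ edgesAt G x y,
    (‖(edgeDenom ζ x y θ)⁻¹‖ₑ ^ (1 / 2 : ℝ) + ‖resolventElem S θ ζ e f‖ₑ ^ (1 / 2 : ℝ))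

omit [DecidableEq V] [G.LocallyFinite] in
theorem enorm_phaseJump_le (θ θ' : V → Torus) (v : V) : ‖phaseJump θ θ' v‖ₑ ≤ 2 := by
  rw [← ofReal_norm]
  exact ENNReal.ofReal_le_of_le_toReal (norm_phaseJump_le θ θ' v)

variable {S}

/-- The decoupling: elements starting at the remote edge `e` appear at `θ` only, while the
configuration `θ'` enters through the denominator and elements between edges at `x` and `y`, all of
which have finite means over the two phases. -/
theorem enorm_resolventElem_rpow_le (hζ : ‖ζ‖ < 1) {φ : ℝ} (hφ : 0 ≤ φ)
    (hS : ∀ x z y, ‖(S x).1 z y - (1 : Matrix _ _ ℂ) z y‖ ≤ φ) {θ θ' : V → Torus}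
    {e : DirEdge G} {x y : V} (hex : e.1.1 ≠ x) (hey : e.1.1 ≠ y) (hxy : G.Adj x y)
    (h : ∀ v, v ≠ x → v ≠ y → θ' v = θ v) :
    ‖resolventElem S θ' ζ e ⟨(x, y), hxy⟩‖ₑ ^ (1 / 4 : ℝ) ≤
      ∑ e' ∈ edgesAt G x y, ENNReal.ofReal φ ^ (1 / 4 : ℝ) *
        ‖resolventElem S θ ζ e e'‖ₑ ^ (1 / 4 : ℝ) * decayFactor S ζ x y e' θ' := by
  set F := edgesAt G x y with hF
  set g := ‖(edgeDenom ζ x y θ')⁻¹‖ₑ with hg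
  have h1 : ‖resolventElem S θ' ζ e ⟨(x, y), hxy⟩‖ₑ ≤
      g * (ENNReal.ofReal φ * ∑ f ∈ F, ‖resolventElem S θ' ζ e f‖ₑ) := by
    have h0 := norm_resolventElem_mul_le hζ hS θ' hex hey hxy
    have hne := edgeDenom_ne_zero hζ x y θ'
    have h2 : ‖resolventElem S θ' ζ e ⟨(x, y), hxy⟩‖ ≤
        ‖(edgeDenom ζ x y θ')⁻¹‖ * (φ * ∑ f ∈ F, ‖resolventElem S θ' ζ e f‖) := by
      rw [norm_inv, ← div_eq_inv_mul, le_div_iff₀ (norm_pos_iff.2 hne), mul_comm]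
      exact h0
    simp only [hg, ← ofReal_norm]
    rw [← ENNReal.ofReal_sum_of_nonneg fun _ _ => norm_nonneg _, ← ENNReal.ofReal_mul hφ,
      ← ENNReal.ofReal_mul (norm_nonneg _)]
    exact ENNReal.ofReal_le_ofReal h2
  have h2 : ∀ f ∈ F, ‖resolventElem S θ' ζ e f‖ₑ ≤ ‖resolventElem S θ ζ e f‖ₑ +
      ∑ e' ∈ F, 2 * ‖resolventElem S θ' ζ e' f‖ₑ * ‖resolventElem S θ ζ e e'‖ₑ := by
    intro f _
    rw [resolventElem_change hζ h]
    refine (enorm_add_le _ _).trans ?_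
    gcongr
    refine (enorm_sum_le _ _).trans (Finset.sum_le_sum fun e' he' => ?_)
    have hne : e ≠ e' := by
      rintro rfl
      rcases mem_edgesAt.1 he' with h' | h'
      · exact hex h'
      · exact hey h'
    rw [if_neg hne, sub_zero, enorm_mul, enorm_mul]
    gcongr
    exact enorm_phaseJump_le _ _ _
  have h3 : ∑ f ∈ F, ‖resolventElem S θ' ζ e f‖ₑ ≤ ∑ e' ∈ F, ‖resolventElem S θ ζ e e'‖ₑ *
      (1 + 2 * ∑ f ∈ F, ‖resolventElem S θ' ζ e' f‖ₑ) := by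
    refine (Finset.sum_le_sum h2).trans (le_of_eq ?_)
    rw [Finset.sum_add_distrib, Finset.sum_comm, ← Finset.sum_add_distrib]
    refine Finset.sum_congr rfl fun e' _ => ?_
    rw [mul_add, mul_one, Finset.mul_sum, Finset.mul_sum]
    congr 1
    exact Finset.sum_congr rfl fun f _ => by ring
  have h4 : ∀ e', g ^ (1 / 4 : ℝ) * (1 + 2 * ∑ f ∈ F, ‖resolventElem S θ' ζ e' f‖ₑ) ^ (1 / 4 : ℝ) ≤
      decayFactor S ζ x y e' θ' := by
    intro e'
    calc _ ≤ g ^ (1 / 4 : ℝ) * (1 + 2 * ∑ f ∈ F, ‖resolventElem S θ' ζ e' f‖ₑ ^ (1 / 4 : ℝ)) := by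
          gcongr
          refine (ENNReal.rpow_add_le_add_rpow _ _ (by norm_num) (by norm_num)).trans ?_
          rw [ENNReal.one_rpow, ENNReal.mul_rpow_of_nonneg _ _ (by norm_num)]
          gcongr
          · exact two_rpow_quarter_le
          · exact rpow_sum_le_sum_rpow F _ (by norm_num) (by norm_num)
      _ = g ^ (1 / 4 : ℝ) + 2 * ∑ f ∈ F,
          g ^ (1 / 4 : ℝ) * ‖resolventElem S θ' ζ e' f‖ₑ ^ (1 / 4 : ℝ) := by
          rw [mul_add, mul_one, ← Finset.mul_sum]; ring
      _ ≤ _ := by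
          rw [decayFactor]
          gcongr
          · exact rpow_quarter_le _
          · exact rpow_quarter_mul_le _ _
  calc _ ≤ (g * (ENNReal.ofReal φ * ∑ e' ∈ F, ‖resolventElem S θ ζ e e'‖ₑ *
      (1 + 2 * ∑ f ∈ F, ‖resolventElem S θ' ζ e' f‖ₑ))) ^ (1 / 4 : ℝ) := by
        gcongr
        exact h1.trans (by gcongr)
    _ ≤ g ^ (1 / 4 : ℝ) * (ENNReal.ofReal φ ^ (1 / 4 : ℝ) * ∑ e' ∈ F,
        ‖resolventElem S θ ζ e e'‖ₑ ^ (1 / 4 : ℝ) *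
        (1 + 2 * ∑ f ∈ F, ‖resolventElem S θ' ζ e' f‖ₑ) ^ (1 / 4 : ℝ)) := by
        rw [ENNReal.mul_rpow_of_nonneg _ _ (by norm_num),
          ENNReal.mul_rpow_of_nonneg _ _ (by norm_num)]
        gcongr
        refine (rpow_sum_le_sum_rpow F _ (by norm_num) (by norm_num)).trans (le_of_eq ?_)
        exact Finset.sum_congr rfl fun e' _ => ENNReal.mul_rpow_of_nonneg _ _ (by norm_num)
    _ = ∑ e' ∈ F, ENNReal.ofReal φ ^ (1 / 4 : ℝ) * ‖resolventElem S θ ζ e e'‖ₑ ^ (1 / 4 : ℝ) *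
        (g ^ (1 / 4 : ℝ) * (1 + 2 * ∑ f ∈ F, ‖resolventElem S θ' ζ e' f‖ₑ) ^ (1 / 4 : ℝ)) := by
        rw [Finset.mul_sum, Finset.mul_sum]
        exact Finset.sum_congr rfl fun e' _ => by ring
    _ ≤ _ := Finset.sum_le_sum fun e' _ => by gcongr; exact h4 e'

/-! ### From fractional to second moments -/

/-- A single coordinate of the adjoint resolvent vector is at most its norm, which the energy
identity for unitaries evaluates. -/
theorem norm_sq_resolventElem_le_herglotz (hζ : ‖ζ‖ < 1) (θ : V → Torus) (e f : DirEdge G) :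
    (1 - ‖ζ‖ ^ 2) * ‖resolventElem S θ ζ e f‖ ^ 2 ≤
      (herglotzElem (ζ • unitaryOp (randomWalk S θ)) (ket e)).re := by
  rw [re_herglotzElem_unitary hζ]
  have h1 : 0 ≤ 1 - ‖ζ‖ ^ 2 := by nlinarith [norm_nonneg ζ]
  gcongr
  rw [resolventElem, ← ContinuousLinearMap.adjoint_inner_left]
  refine (norm_inner_le_norm _ _).trans_eq ?_
  rw [norm_ket, mul_one]

/-- The resolvent identity with the roles of `θ` and `θ'` exchanged: the elements ending at the
remote `f` are now the ones at `θ`, and only elements between edges at `v` remain at `θ'`. -/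
theorem norm_resolventElem_le_sum (hζ : ‖ζ‖ < 1) {θ θ' : V → Torus} {e : DirEdge G} {v : V}
    (he : e ∈ edgesAt G v v) (h : ∀ u, u ≠ v → θ' u = θ u) (f : DirEdge G) :
    ‖resolventElem S θ' ζ e f‖ ≤ ∑ e' ∈ edgesAt G v v, ‖resolventElem S θ ζ e' f‖ +
      ∑ e' ∈ edgesAt G v v, 2 * ‖resolventElem S θ ζ e' f‖ *
        (‖resolventElem S θ' ζ e e'‖ + 1) := by
  have h0 := resolventElem_change (S := S) hζ (θ := θ') (θ' := θ) (x := v) (y := v)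
    (fun u h1 _ => (h u h1).symm) e f
  have h1 : resolventElem S θ' ζ e f = resolventElem S θ ζ e f - ∑ e' ∈ edgesAt G v v,
      phaseJump θ' θ e'.1.1 * resolventElem S θ ζ e' f *
      (resolventElem S θ' ζ e e' - if e = e' then 1 else 0) := by rw [h0]; ring
  rw [h1]
  refine (norm_sub_le _ _).trans (add_le_add ?_ ?_)
  · exact Finset.single_le_sum (f := fun e' => ‖resolventElem S θ ζ e' f‖)
      (fun _ _ => norm_nonneg _) he
  · refine norm_sum_le_of_le _ fun e' _ => ?_
    rw [norm_mul, norm_mul]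
    gcongr
    · exact norm_phaseJump_le _ _ _
    · refine (norm_sub_le _ _).trans ?_
      gcongr
      split_ifs <;> simp

theorem norm_sq_resolventElem_le (hζ : ‖ζ‖ < 1) {θ θ' : V → Torus} {e : DirEdge G} {v : V}
    (he : e ∈ edgesAt G v v) (h : ∀ u, u ≠ v → θ' u = θ u) (f : DirEdge G) :
    (1 - ‖ζ‖ ^ 2) * ‖resolventElem S θ' ζ e f‖ ^ 2 ≤
      (∑ e' ∈ edgesAt G v v, ‖resolventElem S θ ζ e' f‖) ^ (1 / 4 : ℝ) *
        (18 + 8 * (herglotzElem (ζ • unitaryOp (randomWalk S θ')) (ket e)).re) := by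
  have hη0 : 0 ≤ 1 - ‖ζ‖ ^ 2 := by nlinarith [norm_nonneg ζ]
  have hb : ∀ e', (1 - ‖ζ‖ ^ 2) * ‖resolventElem S θ' ζ e e'‖ ^ 2 ≤
      (herglotzElem (ζ • unitaryOp (randomWalk S θ')) (ket e)).re := fun e' =>
    norm_sq_resolventElem_le_herglotz hζ θ' e e'
  have hT0 : 0 ≤ (herglotzElem (ζ • unitaryOp (randomWalk S θ')) (ket e)).re :=
    le_trans (by positivity) (hb e)
  refine mul_sq_le_rpow_quarter hη0 hT0 (Finset.sum_nonneg fun _ _ => norm_nonneg _)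
    (norm_nonneg _) ?_ (hb f)
  refine sqrt_mul_le_of_le (edgesAt G v v) (fun e' => ‖resolventElem S θ ζ e' f‖)
    (fun e' => ‖resolventElem S θ' ζ e e'‖) (fun _ _ => norm_nonneg _)
    (Real.sqrt_le_one.2 (by nlinarith [norm_nonneg ζ])) (fun e' _ => ?_)
    (norm_resolventElem_le_sum hζ he h f)
  refine Real.le_sqrt_of_sq_le ?_
  rw [mul_pow, Real.sq_sqrt hη0]
  exact hb e'

/-- Square moments of the resolvent are controlled by fractional powers at different phases. -/
theorem enorm_sq_resolventElem_le (hζ : ‖ζ‖ < 1) {θ θ' : V → Torus} {e : DirEdge G} {v : V}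
    (he : e ∈ edgesAt G v v) (h : ∀ u, u ≠ v → θ' u = θ u) (f : DirEdge G) :
    ENNReal.ofReal (1 - ‖ζ‖ ^ 2) * ‖resolventElem S θ' ζ e f‖ₑ ^ 2 ≤
      ∑ e' ∈ edgesAt G v v, ‖resolventElem S θ ζ e' f‖ₑ ^ (1 / 4 : ℝ) *
        (18 + 8 * ENNReal.ofReal
          (herglotzElem (ζ • unitaryOp (randomWalk S θ')) (ket e)).re) := by
  have hη0 : 0 ≤ 1 - ‖ζ‖ ^ 2 := by nlinarith [norm_nonneg ζ]
  have hT0 : 0 ≤ (herglotzElem (ζ • unitaryOp (randomWalk S θ')) (ket e)).re :=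
    le_trans (by positivity) (norm_sq_resolventElem_le_herglotz hζ θ' e e)
  have hmain := norm_sq_resolventElem_le (S := S) hζ he h f
  generalize (herglotzElem (ζ • unitaryOp (randomWalk S θ')) (ket e)).re = T at hT0 hmain ⊢
  rw [← Finset.sum_mul, ← ofReal_norm, ← ENNReal.ofReal_pow (norm_nonneg _),
    ← ENNReal.ofReal_mul hη0]
  have hq0 : 0 ≤ ∑ e' ∈ edgesAt G v v, ‖resolventElem S θ ζ e' f‖ :=
    Finset.sum_nonneg fun _ _ => norm_nonneg _
  refine (ENNReal.ofReal_le_ofReal hmain).trans ?_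
  rw [ENNReal.ofReal_mul (Real.rpow_nonneg hq0 _), ← ENNReal.ofReal_rpow_of_nonneg hq0 (by norm_num),
    ENNReal.ofReal_add (by norm_num) (by linarith), ENNReal.ofReal_mul (by norm_num),
    ENNReal.ofReal_sum_of_nonneg fun _ _ => norm_nonneg _]
  simp_rw [ofReal_norm]
  refine mul_le_mul' (rpow_sum_le_sum_rpow _ _ (by norm_num) (by norm_num)) (le_of_eq ?_)
  norm_num

end Pointwise

end ScatteringWalk

namespace ScatteringWalk
open Filter Topology AddCircle

variable {V : Type*} [DecidableEq V]

/-! ### Resampling the phases at two vertices -/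

section Resampling

theorem measurable_update_prod (x : V) :
    Measurable fun p : (V → Torus) × Torus => Function.update p.1 x p.2 := by
  refine measurable_pi_lambda _ fun v => ?_
  by_cases h : v = x
  · subst h
    simpa using measurable_snd
  · simp only [Function.update_of_ne h]
    exact (measurable_pi_apply v).comp measurable_fst

variable (μ : Measure Torus) [IsProbabilityMeasure μ]

theorem map_update_infinitePi (x : V) :
    ((Measure.infinitePi fun _ : V => μ).prod μ).map (fun p => Function.update p.1 x p.2) =
      Measure.infinitePi fun _ : V => μ := by
  refine Measure.eq_infinitePi _ fun s t ht => ?_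
  rw [Measure.map_apply (measurable_update_prod x) (.pi s.countable_toSet fun i _ => ht i)]
  by_cases hx : x ∈ s
  · have h : (fun p : (V → Torus) × Torus => Function.update p.1 x p.2) ⁻¹' (Set.pi s t) =
        (Set.pi (s.erase x : Finset V) t) ×ˢ t x := by
      ext ⟨θ, u⟩
      simp only [Set.mem_preimage, Set.mem_pi, Set.mem_prod, Finset.mem_coe, Finset.mem_erase]
      constructor
      · intro h
        refine ⟨fun i hi => ?_, by simpa using h x hx⟩
        simpa [Function.update_of_ne hi.1] using h i hi.2
      · rintro ⟨h1, h2⟩ i hi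
        by_cases hix : i = x
        · subst hix; simpa using h2
        · simpa [Function.update_of_ne hix] using h1 i ⟨hix, hi⟩
    rw [h, Measure.prod_prod, Measure.infinitePi_pi _ fun i _ => ht i, Finset.prod_erase_mul _ _ hx]
  · have h : (fun p : (V → Torus) × Torus => Function.update p.1 x p.2) ⁻¹' (Set.pi s t) =
        (Set.pi s t) ×ˢ Set.univ := by
      ext ⟨θ, u⟩
      simp only [Set.mem_preimage, Set.mem_pi, Set.mem_prod, Finset.mem_coe, Set.mem_univ, and_true]
      refine forall₂_congr fun i hi => ?_
      rw [Function.update_of_ne (ne_of_mem_of_not_mem hi hx)]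
    rw [h, Measure.prod_prod, Measure.infinitePi_pi _ fun i _ => ht i, measure_univ, mul_one]

theorem lintegral_infinitePi_update {g : (V → Torus) → ℝ≥0∞} (hg : Measurable g) (x : V) :
    ∫⁻ θ, ∫⁻ t, g (Function.update θ x t) ∂μ ∂(Measure.infinitePi fun _ : V => μ) =
      ∫⁻ θ, g θ ∂(Measure.infinitePi fun _ : V => μ) := by
  conv_rhs => rw [← map_update_infinitePi μ x]
  rw [lintegral_map hg (measurable_update_prod x),
    lintegral_prod (fun p : (V → Torus) × Torus => g (Function.update p.1 x p.2))
      (hg.comp (measurable_update_prod x)).aemeasurable]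

theorem lintegral_infinitePi_update_update {g : (V → Torus) → ℝ≥0∞} (hg : Measurable g) (x y : V) :
    ∫⁻ θ, ∫⁻ t, ∫⁻ t', g (Function.update (Function.update θ x t) y t') ∂μ ∂μ
      ∂(Measure.infinitePi fun _ : V => μ) = ∫⁻ θ, g θ ∂(Measure.infinitePi fun _ : V => μ) := by
  rw [← lintegral_infinitePi_update μ hg y]
  exact lintegral_infinitePi_update μ
    (g := fun θ => ∫⁻ t', g (Function.update θ y t') ∂μ)
    (hg.comp (measurable_update_prod y)).lintegral_prod_right' x

/-- Writing the second fresh phase as `β + t` turns `t` into a common shift. This also covers `x =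
y`, where the later update wins. -/
theorem update_update_add (x y : V) (θ : V → Torus) (t β : Torus) :
    Function.update (Function.update θ x t) y (β + t) =
      shiftPhase x y t (Function.update (Function.update θ x 0) y β) := by
  funext v
  by_cases hy : v = y
  · subst hy
    simp [shiftPhase]
  · by_cases hx : v = x
    · subst hx
      simp [shiftPhase, Function.update_of_ne hy]
    · simp [shiftPhase, hx, hy]

variable {μ} {K : ℝ≥0∞}

omit [IsProbabilityMeasure μ] in
-- The density costs a factor `K` per phase. Translation invariance then replaces `t'` by `t' + t`,
-- and after exchanging the integrals the inner one runs over a common shift.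
theorem lintegral_update_update_le (hK : μ ≤ K • haarAddCircle) (x y : V)
    {Φ : (V → Torus) → ℝ≥0∞} (hΦ : Measurable Φ) {C : ℝ≥0∞}
    (hC : ∀ θ, ∫⁻ α : Torus, Φ (shiftPhase x y α θ) ∂haarAddCircle ≤ C) (θ : V → Torus) :
    ∫⁻ t, ∫⁻ t', Φ (Function.update (Function.update θ x t) y t') ∂μ ∂μ ≤ K ^ 2 * C := by
  have hm : Measurable fun p : Torus × Torus =>
      Φ (Function.update (Function.update θ x p.1) y (p.2 + p.1)) := by
    refine hΦ.comp ((measurable_update_prod y).comp (Measurable.prodMk ?_ ?_))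
    · exact (measurable_update_prod x).comp (measurable_const.prodMk measurable_fst)
    · exact measurable_snd.add measurable_fst
  have hle : ∀ f : Torus → ℝ≥0∞, ∫⁻ t, f t ∂μ ≤ K * ∫⁻ t, f t ∂haarAddCircle := fun f => by
    refine (lintegral_mono' hK le_rfl).trans (le_of_eq ?_)
    rw [lintegral_smul_measure, smul_eq_mul]
  calc _ ≤ ∫⁻ t, K * ∫⁻ t', Φ (Function.update (Function.update θ x t) y t') ∂haarAddCircle ∂μ :=
        lintegral_mono fun t => hle _
    _ ≤ K * ∫⁻ t : Torus, K * ∫⁻ t' : Torus,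
        Φ (Function.update (Function.update θ x t) y (t' + t)) ∂haarAddCircle ∂haarAddCircle := by
        refine (hle _).trans (le_of_eq ?_)
        congr 1
        refine lintegral_congr fun t => ?_
        rw [lintegral_add_right_eq_self fun t' => Φ (Function.update (Function.update θ x t) y t')]
    _ = K ^ 2 * ∫⁻ t' : Torus, ∫⁻ t : Torus,
        Φ (Function.update (Function.update θ x t) y (t' + t)) ∂haarAddCircle ∂haarAddCircle := by
        rw [lintegral_const_mul _ hm.lintegral_prod_right', ← mul_assoc, sq,
          lintegral_lintegral_swap hm.aemeasurable]
    _ ≤ K ^ 2 * ∫⁻ _ : Torus, C ∂haarAddCircle := by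
        gcongr with t'
        simp_rw [update_update_add]
        exact hC _
    _ = K ^ 2 * C := by simp

/-- `h` is averaged at a configuration with fresh phases at `x` and `y`, while `b` stays at the old
one and leaves the inner integral; what remains is bounded by `C` for every value of the other
phases. -/
theorem lintegral_le_of_resample (hK : μ ≤ K • haarAddCircle) (x y : V) {ι : Type*} (F : Finset ι)
    {h : (V → Torus) → ℝ≥0∞} {b Φ : ι → (V → Torus) → ℝ≥0∞} (hh : Measurable h)
    (hb : ∀ i ∈ F, Measurable (b i)) (hΦ : ∀ i ∈ F, Measurable (Φ i)) {C : ℝ≥0∞}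
    (hC : ∀ i ∈ F, ∀ θ, ∫⁻ α : Torus, Φ i (shiftPhase x y α θ) ∂haarAddCircle ≤ C)
    (hle : ∀ θ θ', (∀ v, v ≠ x → v ≠ y → θ' v = θ v) → h θ' ≤ ∑ i ∈ F, b i θ * Φ i θ') :
    ∫⁻ θ, h θ ∂(Measure.infinitePi fun _ : V => μ) ≤
      ∑ i ∈ F, K ^ 2 * C * ∫⁻ θ, b i θ ∂(Measure.infinitePi fun _ : V => μ) := by
  have hm : ∀ i ∈ F, ∀ θ : V → Torus, Measurable fun p : Torus × Torus =>
      Φ i (Function.update (Function.update θ x p.1) y p.2) := fun i hi θ =>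
    (hΦ i hi).comp ((measurable_update_prod y).comp (((measurable_update_prod x).comp
      (measurable_const.prodMk measurable_fst)).prodMk measurable_snd))
  rw [← lintegral_infinitePi_update_update μ hh x y]
  calc _ ≤ ∫⁻ θ, ∑ i ∈ F, K ^ 2 * C * b i θ ∂(Measure.infinitePi fun _ : V => μ) := by
        refine lintegral_mono fun θ => ?_
        calc _ ≤ ∫⁻ t, ∫⁻ t', ∑ i ∈ F, b i θ *
              Φ i (Function.update (Function.update θ x t) y t') ∂μ ∂μ := by
              refine lintegral_mono fun t => lintegral_mono fun t' => hle _ _ fun v hx hy => ?_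
              rw [Function.update_of_ne hy, Function.update_of_ne hx]
          _ = ∑ i ∈ F, b i θ * ∫⁻ t, ∫⁻ t',
              Φ i (Function.update (Function.update θ x t) y t') ∂μ ∂μ := by
              have h1 : ∀ t, ∫⁻ t', ∑ i ∈ F, b i θ *
                  Φ i (Function.update (Function.update θ x t) y t') ∂μ = ∑ i ∈ F, b i θ *
                  ∫⁻ t', Φ i (Function.update (Function.update θ x t) y t') ∂μ := fun t => by
                have h2 : ∀ i ∈ F, Measurable fun t' : Torus =>
                    Φ i (Function.update (Function.update θ x t) y t') := fun i hi =>
                  (hm i hi θ).comp measurable_prodMk_left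
                rw [lintegral_finsetSum _ fun i hi => (h2 i hi).const_mul _]
                exact Finset.sum_congr rfl fun i hi => lintegral_const_mul _ (h2 i hi)
              simp_rw [h1]
              rw [lintegral_finsetSum _ fun i hi => (hm i hi θ).lintegral_prod_right'.const_mul _]
              exact Finset.sum_congr rfl fun i hi =>
                lintegral_const_mul _ (hm i hi θ).lintegral_prod_right'
          _ ≤ _ := by
              refine Finset.sum_le_sum fun i hi => ?_
              rw [mul_comm (K ^ 2 * C)]
              gcongr
              exact lintegral_update_update_le hK x y (hΦ i hi) (hC i hi) θ
    _ = _ := by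
        rw [lintegral_finsetSum _ fun i hi => (hb i hi).const_mul _]
        exact Finset.sum_congr rfl fun i hi => lintegral_const_mul _ (hb i hi)

end Resampling

/-! ### Decay of moments of the resolvent -/

section Moments

variable {G : SimpleGraph V} [G.LocallyFinite] (S : ScatteringFamily G) {ζ : ℂ}

/-- The fractional moment of a matrix element of the resolvent. -/
noncomputable def fracMoment (μ : Measure Torus) (S : ScatteringFamily G) (ζ : ℂ)
    (e f : DirEdge G) : ℝ≥0∞ :=
  ∫⁻ θ, ‖resolventElem S θ ζ e f‖ₑ ^ (1 / 4 : ℝ) ∂(Measure.infinitePi fun _ : V => μ)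

theorem measurable_enorm_resolventElem_rpow (hζ : ‖ζ‖ < 1) (e f : DirEdge G) (p : ℝ) :
    Measurable fun θ : V → Torus => ‖resolventElem S θ ζ e f‖ₑ ^ p :=
  ((measurable_resolventElem S measurable_id measurable_const (fun _ => hζ) e f).enorm).pow_const p

omit [DecidableEq V] in
theorem measurable_edgeDenom_inv_rpow (ζ : ℂ) (x y : V) :
    Measurable fun θ : V → Torus => ‖(edgeDenom ζ x y θ)⁻¹‖ₑ ^ (1 / 2 : ℝ) := by
  have h : ∀ v : V, Measurable fun θ : V → Torus => ((toCircle (θ v) : Circle) : ℂ) := fun v =>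
    continuous_toCircle_coe.measurable.comp (measurable_pi_apply v)
  exact ((measurable_const.sub ((measurable_const.mul (h x)).mul (h y))).inv.enorm).pow_const _

theorem measurable_decayFactor (hζ : ‖ζ‖ < 1) (x y : V) (e : DirEdge G) :
    Measurable (decayFactor S ζ x y e) := by
  have h := measurable_edgeDenom_inv_rpow ζ x y
  refine (measurable_const.add h).add (measurable_const.mul ?_)
  exact Finset.measurable_sum _ fun f _ =>
    h.add (measurable_enorm_resolventElem_rpow S hζ e f _)

theorem lintegral_decayFactor_shift_le (hζ : ‖ζ‖ < 1) {d : ℕ} (hd : ∀ x : V, G.degree x ≤ d)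
    {x y : V} {e : DirEdge G} (he : e ∈ edgesAt G x y) (θ : V → Torus) :
    ∫⁻ α : Torus, decayFactor S ζ x y e (shiftPhase x y α θ) ∂haarAddCircle ≤
      ((3 + 76 * d : ℕ) : ℝ≥0∞) := by
  have hs := measurable_shiftPhase x y θ
  have h : Measurable fun α : Torus =>
      ‖(edgeDenom ζ x y (shiftPhase x y α θ))⁻¹‖ₑ ^ (1 / 2 : ℝ) :=
    (measurable_edgeDenom_inv_rpow ζ x y).comp hs
  have hr : ∀ f, Measurable fun α : Torus =>
      ‖resolventElem S (shiftPhase x y α θ) ζ e f‖ₑ ^ (1 / 2 : ℝ) := fun f =>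
    (measurable_enorm_resolventElem_rpow S hζ e f (1 / 2)).comp hs
  have hsum : ∀ f ∈ edgesAt G x y, Measurable fun α : Torus =>
      ‖(edgeDenom ζ x y (shiftPhase x y α θ))⁻¹‖ₑ ^ (1 / 2 : ℝ) +
        ‖resolventElem S (shiftPhase x y α θ) ζ e f‖ₑ ^ (1 / 2 : ℝ) := fun f _ => h.add (hr f)
  unfold decayFactor
  have h' : Measurable fun α : Torus =>
      1 + ‖(edgeDenom ζ x y (shiftPhase x y α θ))⁻¹‖ₑ ^ (1 / 2 : ℝ) := measurable_const.add h
  rw [lintegral_add_left h',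
    lintegral_add_left measurable_const,
    lintegral_const_mul _ (Finset.measurable_sum _ hsum), lintegral_finsetSum _ hsum]
  have h1 := lintegral_edgeDenom_shift_le hζ (x := x) (y := y) θ
  -- The means are 2 for the denominator and 17 for a resolvent element, with at most `2d` edges:
  -- `76 d = 2 · 2d · 19`.
  calc _ ≤ (1 + 2 : ℝ≥0∞) + 2 * ∑ f ∈ edgesAt G x y, (2 + 17 : ℝ≥0∞) := by
        gcongr with f hf
        · simp
        · rw [lintegral_add_left h]
          exact add_le_add h1 (lintegral_resolventElem_shift_le S hζ he hf θ)
    _ ≤ (1 + 2 : ℝ≥0∞) + 2 * ((2 * d : ℕ) * (2 + 17)) := by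
        rw [Finset.sum_const, nsmul_eq_mul]
        gcongr
        exact card_edgesAt_le hd x y
    _ = _ := by push_cast; ring

variable {S} {μ : Measure Torus} [IsProbabilityMeasure μ] {K : ℝ≥0∞}

/-- The a priori bound: refreshing the phases at the vertices where `e` and `f` arrive puts both
edges in the range of the rotated projection. Here `18 = 1 + 17`. -/
theorem fracMoment_le (hK : μ ≤ K • haarAddCircle) (hζ : ‖ζ‖ < 1) (e f : DirEdge G) :
    fracMoment μ S ζ e f ≤ K ^ 2 * 18 := by
  have he : e ∈ edgesAt G e.1.1 f.1.1 := mem_edgesAt.2 (Or.inl rfl)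
  have hf : f ∈ edgesAt G e.1.1 f.1.1 := mem_edgesAt.2 (Or.inr rfl)
  refine (lintegral_le_of_resample hK e.1.1 f.1.1 {()} (b := fun _ _ => 1)
    (Φ := fun _ θ => 1 + ‖resolventElem S θ ζ e f‖ₑ ^ (1 / 2 : ℝ)) (C := 18)
    (measurable_enorm_resolventElem_rpow S hζ e f _) (fun _ _ => measurable_const)
    (fun _ _ => measurable_const.add (measurable_enorm_resolventElem_rpow S hζ e f _))
    (fun _ _ θ => ?_) fun θ θ' _ => ?_).trans_eq ?_
  · rw [lintegral_add_left measurable_const]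
    refine (add_le_add (le_of_eq (by simp)) (lintegral_resolventElem_shift_le S hζ he hf θ)).trans
      (le_of_eq (?_ : (1 : ℝ≥0∞) + 17 = 18))
    norm_num
  · simpa using rpow_quarter_le _
  · simp

/-- The rate of decay of fractional moments. -/
noncomputable def decayRate (K : ℝ≥0∞) (d : ℕ) (φ : ℝ) : ℝ≥0∞ :=
  (2 * d : ℕ) * (K ^ 2 * (3 + 76 * d : ℕ) * ENNReal.ofReal φ ^ (1 / 4 : ℝ))

theorem fracMoment_le_sum (hK : μ ≤ K • haarAddCircle) (hζ : ‖ζ‖ < 1) {d : ℕ}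
    (hd : ∀ x : V, G.degree x ≤ d) {φ : ℝ} (hφ : 0 ≤ φ)
    (hS : ∀ x z y, ‖(S x).1 z y - (1 : Matrix _ _ ℂ) z y‖ ≤ φ) {e f : DirEdge G}
    (hx : e.1.1 ≠ f.1.1) (hy : e.1.1 ≠ f.1.2) :
    fracMoment μ S ζ e f ≤ ∑ e' ∈ edgesAt G f.1.1 f.1.2,
      K ^ 2 * (3 + 76 * d : ℕ) * (ENNReal.ofReal φ ^ (1 / 4 : ℝ) * fracMoment μ S ζ e e') := by
  refine (lintegral_le_of_resample hK f.1.1 f.1.2 (edgesAt G f.1.1 f.1.2)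
    (b := fun e' θ => ENNReal.ofReal φ ^ (1 / 4 : ℝ) *
      ‖resolventElem S θ ζ e e'‖ₑ ^ (1 / 4 : ℝ))
    (Φ := fun e' => decayFactor S ζ f.1.1 f.1.2 e') (C := (3 + 76 * d : ℕ))
    (measurable_enorm_resolventElem_rpow S hζ e f _)
    (fun e' _ => (measurable_enorm_resolventElem_rpow S hζ e e' _).const_mul _)
    (fun e' _ => measurable_decayFactor S hζ _ _ e')
    (fun e' he' θ => lintegral_decayFactor_shift_le S hζ hd he' θ)
    fun θ θ' h => enorm_resolventElem_rpow_le hζ hφ hS hx hy f.2 h).trans_eq ?_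
  refine Finset.sum_congr rfl fun e' _ => ?_
  rw [lintegral_const_mul _ (measurable_enorm_resolventElem_rpow S hζ e e' _)]
  rfl

/-- The edges at the two ends of `f` arrive at vertices at most one step closer to `e`, so each step
uses up one unit of distance. With the extended distance, other components are included for every
`n`. -/
theorem fracMoment_le_pow (hK : μ ≤ K • haarAddCircle) (hζ : ‖ζ‖ < 1) {d : ℕ}
    (hd : ∀ x : V, G.degree x ≤ d) {φ : ℝ} (hφ : 0 ≤ φ)
    (hS : ∀ x z y, ‖(S x).1 z y - (1 : Matrix _ _ ℂ) z y‖ ≤ φ) (e : DirEdge G) (n : ℕ) :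
    ∀ f : DirEdge G, (n : ℕ∞) < G.edist e.1.1 f.1.1 →
      fracMoment μ S ζ e f ≤ K ^ 2 * 18 * decayRate K d φ ^ n := by
  induction n with
  | zero => exact fun f _ => by simpa using fracMoment_le hK hζ e f
  | succ n ih =>
    intro f hf
    have h1 : (n : ℕ∞) < G.edist e.1.1 f.1.2 := by
      have h2 : G.edist e.1.1 f.1.1 ≤ G.edist e.1.1 f.1.2 + 1 := by
        refine (SimpleGraph.edist_triangle (v := f.1.2)).trans ?_
        gcongr
        exact (SimpleGraph.edist_eq_one_iff_adj.2 f.2.symm).le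
      have h3 := hf.trans_le h2
      push_cast at h3
      exact lt_of_add_lt_add_right h3
    have h2 : (n : ℕ∞) < G.edist e.1.1 f.1.1 := lt_of_le_of_lt (by push_cast; exact le_self_add) hf
    have hne : ∀ {x : V}, (n : ℕ∞) < G.edist e.1.1 x → e.1.1 ≠ x := by
      rintro x hx rfl
      simp at hx
    refine (fracMoment_le_sum hK hζ hd hφ hS (hne h2) (hne h1)).trans ?_
    calc _ ≤ ∑ e' ∈ edgesAt G f.1.1 f.1.2, K ^ 2 * (3 + 76 * d : ℕ) *
          (ENNReal.ofReal φ ^ (1 / 4 : ℝ) * (K ^ 2 * 18 * decayRate K d φ ^ n)) := by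
          gcongr with e' he'
          refine ih e' ?_
          rcases mem_edgesAt.1 he' with h | h <;> rwa [h]
      _ ≤ (2 * d : ℕ) * (K ^ 2 * (3 + 76 * d : ℕ) *
          (ENNReal.ofReal φ ^ (1 / 4 : ℝ) * (K ^ 2 * 18 * decayRate K d φ ^ n))) := by
          rw [Finset.sum_const, nsmul_eq_mul]
          gcongr
          exact card_edgesAt_le hd _ _
      _ = _ := by rw [pow_succ]; conv_rhs => rw [decayRate]
                  conv_lhs => rw [decayRate]
                  ring

theorem fracMoment_le_of_dist (hK : μ ≤ K • haarAddCircle) (hζ : ‖ζ‖ < 1) {d : ℕ}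
    (hd : ∀ x : V, G.degree x ≤ d) {φ : ℝ} (hφ : 0 ≤ φ)
    (hS : ∀ x z y, ‖(S x).1 z y - (1 : Matrix _ _ ℂ) z y‖ ≤ φ) {e f : DirEdge G}
    (h : G.Reachable e.1.1 f.1.1) :
    fracMoment μ S ζ e f ≤ K ^ 2 * 18 * decayRate K d φ ^ (G.dist e.1.1 f.1.1 - 1) := by
  -- At distance zero the truncated exponent is zero and the a priori bound applies.
  rcases Nat.eq_zero_or_pos (G.dist e.1.1 f.1.1) with h0 | h0
  · simpa [h0] using fracMoment_le hK hζ e f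
  · refine fracMoment_le_pow hK hζ hd hφ hS e _ f ?_
    rw [← h.coe_dist_eq_edist]
    exact_mod_cast Nat.sub_lt h0 one_pos

theorem measurable_herglotzElem_ket (hζ : ‖ζ‖ < 1) (e : DirEdge G) :
    Measurable fun θ : V → Torus => ENNReal.ofReal
      (herglotzElem (ζ • unitaryOp (randomWalk S θ)) (ket e)).re := by
  have h := measurable_resolventElem S measurable_id (measurable_const (a := ζ)) (fun _ => hζ) e e
  refine ENNReal.measurable_ofReal.comp (Complex.measurable_re.comp ?_)
  exact (h.const_mul 2).sub measurable_const

/-- Only the phase at the vertex of `e` is refreshed, as the degenerate pair `x = y`. The constant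
is `26 = 18 + 8 · 1`, the mean of the Herglotz real part being one. -/
theorem secondMoment_le (hK : μ ≤ K • haarAddCircle) (hζ : ‖ζ‖ < 1) (e f : DirEdge G) :
    ∫⁻ θ, ENNReal.ofReal (1 - ‖ζ‖ ^ 2) * ‖resolventElem S θ ζ e f‖ₑ ^ 2
      ∂(Measure.infinitePi fun _ : V => μ) ≤
      ∑ e' ∈ edgesAt G e.1.1 e.1.1, K ^ 2 * 26 * fracMoment μ S ζ e' f := by
  have he : e ∈ edgesAt G e.1.1 e.1.1 := mem_edgesAt.2 (Or.inl rfl)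
  refine lintegral_le_of_resample hK e.1.1 e.1.1 (edgesAt G e.1.1 e.1.1)
    (b := fun e' θ => ‖resolventElem S θ ζ e' f‖ₑ ^ (1 / 4 : ℝ))
    (Φ := fun _ θ => 18 + 8 * ENNReal.ofReal
      (herglotzElem (ζ • unitaryOp (randomWalk S θ)) (ket e)).re)
    (((measurable_resolventElem S measurable_id measurable_const (fun _ => hζ)
      e f).enorm.pow_const 2).const_mul _)
    (fun e' _ => measurable_enorm_resolventElem_rpow S hζ e' f _)
    (fun _ _ => measurable_const.add ((measurable_herglotzElem_ket hζ e).const_mul _))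
    (fun _ _ θ => ?_)
    fun θ θ' h => enorm_sq_resolventElem_le hζ he (fun u hu => h u hu hu) f
  have hm : Measurable fun α : Torus => ENNReal.ofReal
      (herglotzElem (ζ • unitaryOp (randomWalk S (shiftPhase e.1.1 e.1.1 α θ))) (ket e)).re :=
    (measurable_herglotzElem_ket (S := S) hζ e).comp (measurable_shiftPhase e.1.1 e.1.1 θ)
  rw [lintegral_add_left measurable_const, lintegral_const_mul _ hm,
    lintegral_herglotzElem_shift S hζ he θ]
  simp
  norm_num

theorem secondMoment_le_of_dist (hK : μ ≤ K • haarAddCircle) (hζ : ‖ζ‖ < 1) {d : ℕ}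
    (hd : ∀ x : V, G.degree x ≤ d) {φ : ℝ} (hφ : 0 ≤ φ)
    (hS : ∀ x z y, ‖(S x).1 z y - (1 : Matrix _ _ ℂ) z y‖ ≤ φ) {e f : DirEdge G}
    (h : G.Reachable e.1.1 f.1.1) :
    ∫⁻ θ, ENNReal.ofReal (1 - ‖ζ‖ ^ 2) * ‖resolventElem S θ ζ e f‖ₑ ^ 2
      ∂(Measure.infinitePi fun _ : V => μ) ≤
      (2 * d : ℕ) * (K ^ 2 * 26) * (K ^ 2 * 18) *
        decayRate K d φ ^ (G.dist e.1.1 f.1.1 - 1) := by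
  refine (secondMoment_le hK hζ e f).trans ?_
  calc _ ≤ ∑ e' ∈ edgesAt G e.1.1 e.1.1, K ^ 2 * 26 *
        (K ^ 2 * 18 * decayRate K d φ ^ (G.dist e.1.1 f.1.1 - 1)) := by
        refine Finset.sum_le_sum fun e' he' => ?_
        have h1 : e'.1.1 = e.1.1 := (or_self_iff.1 (mem_edgesAt.1 he'))
        gcongr
        have := fracMoment_le_of_dist hK hζ hd hφ hS (e := e') (f := f) (by rwa [h1])
        rwa [h1] at this
    _ ≤ (2 * d : ℕ) * (K ^ 2 * 26 *
        (K ^ 2 * 18 * decayRate K d φ ^ (G.dist e.1.1 f.1.1 - 1))) := by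
        rw [Finset.sum_const, nsmul_eq_mul]
        gcongr
        exact card_edgesAt_le hd _ _
    _ = _ := by ring

end Moments

end ScatteringWalk

namespace ScatteringWalk
open Filter Topology AddCircle

variable {V : Type*}

/-! ### Sums over the graph -/

section Graph

variable {G : SimpleGraph V}

open Classical in
/-- `ρ` to the power of the graph distance, vanishing between different connected components. -/
noncomputable def distWeight (G : SimpleGraph V) (ρ : ℝ≥0∞) (x y : V) : ℝ≥0∞ :=
  if G.Reachable x y then ρ ^ G.dist x y else 0

theorem distWeight_of_reachable (ρ : ℝ≥0∞) {x y : V} (h : G.Reachable x y) :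
    distWeight G ρ x y = ρ ^ G.dist x y := if_pos h

theorem distWeight_of_not_reachable (ρ : ℝ≥0∞) {x y : V} (h : ¬G.Reachable x y) :
    distWeight G ρ x y = 0 := if_neg h

/-- From `d(x,y) + d(x,z) ≤ 2 d(x,z) + 2 d(y,z)`: the doubled rate leaves one factor for the decay
between `x` and `y` and one that can be summed over `z`. -/
theorem distWeight_mul_le {ρ : ℝ≥0∞} (hρ : ρ ≤ 1) (x y z : V) :
    distWeight G (ρ ^ 2) x z * distWeight G (ρ ^ 2) y z ≤
      distWeight G ρ x y * distWeight G ρ x z := by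
  by_cases hx : G.Reachable x z
  · by_cases hy : G.Reachable y z
    · have hxy : G.Reachable x y := hx.trans hy.symm
      rw [distWeight_of_reachable _ hx, distWeight_of_reachable _ hy,
        distWeight_of_reachable _ hx, distWeight_of_reachable _ hxy, ← pow_mul, ← pow_mul,
        ← pow_add, ← pow_add]
      refine pow_le_pow_right_of_le_one' hρ ?_
      have h1 : G.dist x y ≤ G.dist x z + G.dist z y := by
        have h := SimpleGraph.edist_triangle (G := G) (u := x) (v := z) (w := y)
        rw [← hxy.coe_dist_eq_edist, ← hx.coe_dist_eq_edist, ← hy.symm.coe_dist_eq_edist] at h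
        exact_mod_cast h
      rw [G.dist_comm (u := z)] at h1
      omega
    · rw [distWeight_of_not_reachable _ hy, mul_zero]
      exact zero_le
  · rw [distWeight_of_not_reachable _ hx, zero_mul]
    exact zero_le

theorem distWeight_le_expDecay {g : ℝ} {ρ : ℝ≥0∞} (hρ : ρ ≤ ENNReal.ofReal (Real.exp (-g)))
    (x y : V) : distWeight G ρ x y ≤ ENNReal.ofReal (expDecay G g x y) := by
  by_cases h : G.Reachable x y
  · rw [distWeight_of_reachable _ h, expDecay, if_pos h, mul_comm, Real.exp_nat_mul,
      ENNReal.ofReal_pow (Real.exp_nonneg _)]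
    gcongr
  · rw [distWeight_of_not_reachable _ h]
    exact zero_le

variable [DecidableEq V] [G.LocallyFinite]

/-- The endpoints of the walks of length `n` from `x`. -/
def walkEnds (G : SimpleGraph V) [G.LocallyFinite] (x : V) : ℕ → Finset V
  | 0 => {x}
  | n + 1 => (walkEnds G x n).biUnion fun y => G.neighborFinset y

theorem card_walkEnds_le {d : ℕ} (hd : ∀ x : V, G.degree x ≤ d) (x : V) (n : ℕ) :
    (walkEnds G x n).card ≤ d ^ n := by
  induction n with
  | zero => simp [walkEnds]
  | succ n ih =>
    rw [walkEnds, pow_succ]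
    exact (Finset.card_biUnion_le_card_mul _ _ d fun y _ => hd y).trans
      (Nat.mul_le_mul_right d ih)

theorem mem_walkEnds {x y : V} (p : G.Walk x y) : y ∈ walkEnds G x p.length := by
  induction p using SimpleGraph.Walk.concatRec with
  | Hnil => simp [walkEnds]
  | Hconcat p h ih =>
    rw [SimpleGraph.Walk.length_concat, walkEnds, Finset.mem_biUnion]
    exact ⟨_, ih, (G.mem_neighborFinset _ _).2 h⟩

/-- At distance `n` there are at most `d ^ n · 2d` edges, so the sum is dominated by `2d` times a
geometric series of ratio `1/2`. -/
theorem tsum_distWeight_le {d : ℕ} (hd : ∀ x : V, G.degree x ≤ d) {ρ : ℝ≥0∞}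
    (hρ : (d : ℝ≥0∞) * ρ ≤ 2⁻¹) (x : V) :
    ∑' e : DirEdge G, distWeight G ρ x e.1.1 ≤ (4 * d : ℕ) := by
  classical
  set B : ℕ → Finset (DirEdge G) := fun n => (walkEnds G x n).biUnion fun y => edgesAt G y y with hB
  have hcard : ∀ n, (B n).card ≤ d ^ n * (2 * d) := fun n =>
    (Finset.card_biUnion_le_card_mul _ _ (2 * d) fun y _ => card_edgesAt_le hd y y).trans
      (Nat.mul_le_mul_right _ (card_walkEnds_le hd x n))
  have hle : ∀ e : DirEdge G, distWeight G ρ x e.1.1 ≤ ∑' n, if e ∈ B n then ρ ^ n else 0 := by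
    intro e
    by_cases h : G.Reachable x e.1.1
    · obtain ⟨p, hp⟩ := h.exists_walk_length_eq_dist
      have hm : e ∈ B (G.dist x e.1.1) := Finset.mem_biUnion.2
        ⟨e.1.1, hp ▸ mem_walkEnds p, mem_edgesAt.2 (Or.inl rfl)⟩
      rw [distWeight_of_reachable _ h]
      refine le_trans (le_of_eq ?_) (ENNReal.le_tsum (G.dist x e.1.1))
      rw [if_pos hm]
    · rw [distWeight_of_not_reachable _ h]
      exact zero_le
  calc _ ≤ ∑' e : DirEdge G, ∑' n, (if e ∈ B n then ρ ^ n else 0) := ENNReal.tsum_le_tsum hle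
    _ = ∑' n, ∑' e : DirEdge G, (if e ∈ B n then ρ ^ n else 0) := ENNReal.tsum_comm
    _ ≤ ∑' n : ℕ, (2 * d : ℕ) * (2⁻¹ : ℝ≥0∞) ^ n := by
        refine ENNReal.tsum_le_tsum fun n => ?_
        rw [tsum_eq_sum (s := B n) fun e he => if_neg he, Finset.sum_congr rfl fun e he => if_pos he,
          Finset.sum_const, nsmul_eq_mul]
        calc ((B n).card : ℝ≥0∞) * ρ ^ n ≤ (d ^ n * (2 * d) : ℕ) * ρ ^ n := by
              gcongr
              exact hcard n
          _ = (2 * d : ℕ) * ((d : ℝ≥0∞) * ρ) ^ n := by push_cast; ring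
          _ ≤ _ := by gcongr
    _ = (4 * d : ℕ) := by
        rw [ENNReal.tsum_mul_left, ENNReal.tsum_geometric, ENNReal.one_sub_inv_two, inv_inv]
        push_cast
        ring

/-- The graph may be uncountable, and exchanging sum and integral needs a countable index set. A
finite sum of strictly positive weights over the component provides it. -/
theorem countable_reachable {d : ℕ} (hd : ∀ x : V, G.degree x ≤ d) (x : V) :
    {e : DirEdge G | G.Reachable x e.1.1}.Countable := by
  set ρ : ℝ≥0∞ := (2 * (d + 1))⁻¹ with hρ
  have hρ0 : ρ ≠ 0 := ENNReal.inv_ne_zero.2 (by finiteness)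
  have h : (d : ℝ≥0∞) * ρ ≤ 2⁻¹ := by
    rw [hρ, ENNReal.mul_inv (by simp) (by simp), mul_left_comm]
    refine (mul_le_mul_right (?_ : (d : ℝ≥0∞) * ((d : ℝ≥0∞) + 1)⁻¹ ≤ 1) _).trans_eq (mul_one _)
    rw [← div_eq_mul_inv]
    exact ENNReal.div_le_of_le_mul (by simp)
  refine (Summable.countable_support_ennreal
    (ne_top_of_le_ne_top (ENNReal.natCast_ne_top _) (tsum_distWeight_le hd h x))).mono ?_
  intro e he
  rw [Function.mem_support, distWeight_of_reachable _ he]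
  exact pow_ne_zero _ hρ0

end Graph

/-! ### Entries of scattering matrices and expansion of the Poisson kernel -/

section Scattering

variable {G : SimpleGraph V} [DecidableEq V] [G.LocallyFinite] (S : ScatteringFamily G)

/-- A real supremum over an unbounded family would be zero, so boundedness comes first: entries of
unitaries have modulus at most one and there are at most `d` neighbours. -/
theorem norm_entry_sub_one_le_scatteringDist {d : ℕ} (hd : ∀ x : V, G.degree x ≤ d) (x : V)
    (z y : G.neighborSet x) :
    ‖(S x).1 z y - (1 : Matrix (G.neighborSet x) (G.neighborSet x) ℂ) z y‖ ≤
      scatteringDist S 1 := by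
  have hbdd : BddAbove (Set.range fun x : V => Real.sqrt (∑ z : G.neighborSet x,
      ∑ y : G.neighborSet x,
        ‖(S x).1 z y - ((1 : ScatteringFamily G) x).1 z y‖ ^ 2)) := by
    refine ⟨Real.sqrt (∑ _ ∈ Finset.range d, ∑ _ ∈ Finset.range d, 2 ^ 2), ?_⟩
    rintro _ ⟨x, rfl⟩
    refine Real.sqrt_le_sqrt ?_
    have hcard : Fintype.card (G.neighborSet x) ≤ d := (G.card_neighborSet_eq_degree x).trans_le (hd x)
    have hent : ∀ z y : G.neighborSet x,
        ‖(S x).1 z y - ((1 : ScatteringFamily G) x).1 z y‖ ^ 2 ≤ 2 ^ 2 := fun z y => by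
      gcongr
      refine (norm_sub_le _ _).trans ?_
      linarith [entry_norm_bound_of_unitary (S x).2 z y,
        entry_norm_bound_of_unitary ((1 : ScatteringFamily G) x).2 z y]
    calc _ ≤ ∑ _ : G.neighborSet x, ∑ _ : G.neighborSet x, (2 : ℝ) ^ 2 :=
          Finset.sum_le_sum fun z _ => Finset.sum_le_sum fun y _ => hent z y
      _ ≤ _ := by
          simp only [Finset.sum_const, Finset.card_univ, Finset.card_range, nsmul_eq_mul]
          have : (Fintype.card (G.neighborSet x) : ℝ) ≤ d := by exact_mod_cast hcard
          gcongr
  refine le_trans ?_ (le_ciSup hbdd x)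
  refine Real.le_sqrt_of_sq_le ?_
  exact (Finset.single_le_sum (f := fun y => ‖(S x).1 z y - ((1 : ScatteringFamily G) x).1 z y‖ ^ 2)
    (fun _ _ => by positivity) (Finset.mem_univ y)).trans
    (Finset.single_le_sum (f := fun z => ∑ y : G.neighborSet x,
      ‖(S x).1 z y - ((1 : ScatteringFamily G) x).1 z y‖ ^ 2)
      (fun _ _ => by positivity) (Finset.mem_univ z))

theorem inner_randomWalk_pow_eq_zero (θ : V → Torus) (k : ℕ) {e f : DirEdge G}
    (h : ¬G.Reachable e.1.1 f.1.1) :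
    inner ℂ (ket e) ((randomWalk S θ ^ (k : ℤ)) (ket f)) = 0 := by
  induction k generalizing e with
  | zero =>
    have hne : e ≠ f := by
      rintro rfl
      exact h (SimpleGraph.Reachable.refl _)
    rw [Nat.cast_zero, zpow_zero, LinearIsometryEquiv.coe_one, id, inner_ket, ket_apply, if_neg hne]
  | succ k ih =>
    rw [inner_ket, Nat.cast_succ, add_comm (k : ℤ) 1, zpow_add_apply, zpow_one, randomWalk_apply,
      Finset.sum_eq_zero, mul_zero]
    intro y _
    have h0 := ih (e := inEdge G ⟨e.1.2, y⟩) fun h' => h (e.2.reachable.trans h')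
    rw [inner_ket] at h0
    rw [h0, mul_zero]

variable {S}

theorem resolventElem_eq_zero {ζ : ℂ} (hζ : ‖ζ‖ < 1) (θ : V → Torus) {e f : DirEdge G}
    (h : ¬G.Reachable e.1.1 f.1.1) : resolventElem S θ ζ e f = 0 := by
  refine (hasSum_inner_geomOp (randomWalk S θ) hζ (ket e) (ket f)).unique ?_
  simp_rw [inner_randomWalk_pow_eq_zero S θ _ h, mul_zero]
  exact hasSum_zero

/-- The factorized Poisson kernel expanded in the canonical basis; coordinates outside the component
of `e` vanish. -/
theorem enorm_poissonElem_le {ζ : ℂ} (hζ : ‖ζ‖ < 1) (θ : V → Torus) (e f : DirEdge G) :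
    ‖poissonElem (randomWalk S θ) ζ (ket e) (ket f)‖ₑ ≤
      ∑' e' : {e' : DirEdge G | G.Reachable e.1.1 e'.1.1}, ENNReal.ofReal (1 - ‖ζ‖ ^ 2) *
        (‖resolventElem S θ ζ e e'‖ₑ * ‖resolventElem S θ ζ f e'‖ₑ) := by
  have hη : 0 ≤ 1 - ‖ζ‖ ^ 2 := by nlinarith [norm_nonneg ζ]
  have happ : ∀ e e' : DirEdge G,
      (((geomOp (ζ • unitaryOp (randomWalk S θ))).adjoint (ket e) : EdgeSpace G) e') =
        (starRingEnd ℂ) (resolventElem S θ ζ e e') := fun e e' => by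
    rw [← inner_ket, ContinuousLinearMap.adjoint_inner_right, resolventElem, inner_conj_symm]
  have hsupp : Function.support (fun e' : DirEdge G => ENNReal.ofReal (1 - ‖ζ‖ ^ 2) *
      (‖resolventElem S θ ζ e e'‖ₑ * ‖resolventElem S θ ζ f e'‖ₑ)) ⊆
      {e' : DirEdge G | G.Reachable e.1.1 e'.1.1} := by
    intro e' he'
    by_contra h
    exact he' (by simp [resolventElem_eq_zero hζ θ h])
  rw [tsum_subtype_eq_of_support_subset hsupp, ENNReal.tsum_mul_left, poissonElem_eq hζ, enorm_mul,
    ← ofReal_norm ((1 - ‖ζ‖ ^ 2 : ℝ) : ℂ), Complex.norm_of_nonneg hη]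
  gcongr
  rw [lp.inner_eq_tsum]
  refine enorm_tsum_le_tsum_enorm.trans (ENNReal.tsum_le_tsum fun e' => ?_)
  rw [happ, happ]
  simp [enorm_mul, mul_comm]

end Scattering

end ScatteringWalk

namespace ScatteringWalk
open Filter Topology AddCircle

/-! ### Dynamical localization -/

section CauchySchwarz

theorem lintegral_const_mul_mul_le {Ω : Type*} [MeasurableSpace Ω] {P : Measure Ω}
    {f h : Ω → ℝ≥0∞} (hf : Measurable f) (hh : Measurable h) {η A B : ℝ≥0∞}
    (hA : ∫⁻ w, η * f w ^ 2 ∂P ≤ A ^ 2) (hB : ∫⁻ w, η * h w ^ 2 ∂P ≤ B ^ 2) :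
    ∫⁻ w, η * (f w * h w) ∂P ≤ A * B := by
  have h1 := ENNReal.lintegral_mul_le_Lp_mul_Lq (η • P) Real.HolderConjugate.two_two
    hf.aemeasurable hh.aemeasurable
  have hr : ∀ C : ℝ≥0∞, (C ^ 2) ^ (1 / 2 : ℝ) = C := fun C => by
    rw [← ENNReal.rpow_natCast, ← ENNReal.rpow_mul]
    norm_num
  rw [lintegral_const_mul (f := fun w => f w * h w) _ (hf.mul hh)]
  rw [lintegral_const_mul _ (hf.pow_const 2)] at hA
  rw [lintegral_const_mul _ (hh.pow_const 2)] at hB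
  simp only [lintegral_smul_measure, smul_eq_mul, ENNReal.rpow_two, Pi.mul_apply] at h1
  refine h1.trans ?_
  rw [← hr A, ← hr B]
  gcongr

end CauchySchwarz

variable {V : Type*} [DecidableEq V] {G : SimpleGraph V} [G.LocallyFinite] {S : ScatteringFamily G}
  {μ : Measure Torus} [IsProbabilityMeasure μ] {K : ℝ≥0∞}

theorem measurable_poissonElem_randomWalk (S : ScatteringFamily G) {r : ℝ} (hr0 : 0 ≤ r)
    (hr : r < 1) (e f : DirEdge G) :
    Measurable fun p : (V → Torus) × Torus =>
      poissonElem (randomWalk S p.1) (spectralParam r p.2) (ket e) (ket f) := by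
  have h : ∀ e f, Measurable fun p : (V → Torus) × Torus =>
      resolventElem S p.1 (spectralParam r p.2) e f :=
    measurable_resolventElem S measurable_fst
      ((continuous_spectralParam r).measurable.comp measurable_snd)
      fun p => by rwa [norm_spectralParam hr0]
  exact ((h e f).add (Complex.continuous_conj.measurable.comp (h f e))).sub measurable_const

theorem measurable_poissonMass_randomWalk (S : ScatteringFamily G) {r : ℝ} (hr0 : 0 ≤ r)
    (hr : r < 1) (e f : DirEdge G) :
    Measurable fun θ : V → Torus => poissonMass (randomWalk S θ) r (ket e) (ket f) :=
  (measurable_poissonElem_randomWalk S hr0 hr e f).enorm.lintegral_prod_right'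

/-- The amplitude in the bound on second moments. -/
noncomputable def momentBound (K : ℝ≥0∞) (d : ℕ) (ρ : ℝ≥0∞) : ℝ≥0∞ :=
  ((2 * d : ℕ) * (K ^ 2 * 26) * (K ^ 2 * 18) + 1) * ρ⁻¹ ^ 2

/-- The bound is put as a square for Cauchy–Schwarz. In `momentBound` the added one gives `C ≤ (C +
1)²`, and `ρ⁻²` repairs the exponent `dist - 1`. -/
theorem secondMoment_le_distWeight (hK : μ ≤ K • haarAddCircle) {ζ : ℂ} (hζ : ‖ζ‖ < 1) {d : ℕ}
    (hd : ∀ x : V, G.degree x ≤ d) {φ : ℝ} (hφ : 0 ≤ φ)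
    (hS : ∀ x z y, ‖(S x).1 z y - (1 : Matrix _ _ ℂ) z y‖ ≤ φ) {ρ : ℝ≥0∞} (hρ0 : ρ ≠ 0)
    (hρ1 : ρ ≤ 1) (hρ : decayRate K d φ ≤ ρ ^ 4) (e f : DirEdge G) :
    ∫⁻ θ, ENNReal.ofReal (1 - ‖ζ‖ ^ 2) * ‖resolventElem S θ ζ e f‖ₑ ^ 2
      ∂(Measure.infinitePi fun _ : V => μ) ≤
      (momentBound K d ρ * distWeight G (ρ ^ 2) e.1.1 f.1.1) ^ 2 := by
  by_cases h : G.Reachable e.1.1 f.1.1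
  · refine (secondMoment_le_of_dist hK hζ hd hφ hS h).trans ?_
    rw [distWeight_of_reachable _ h, momentBound]
    set C := ((2 * d : ℕ) : ℝ≥0∞) * (K ^ 2 * 26) * (K ^ 2 * 18)
    have hC : C ≤ (C + 1) ^ 2 := by
      rw [sq]
      exact (le_self_add (b := 1)).trans (le_mul_of_one_le_right' le_add_self)
    have hinv : ρ⁻¹ * ρ = 1 :=
      ENNReal.inv_mul_cancel hρ0 (ne_top_of_le_ne_top ENNReal.one_ne_top hρ1)
    have hpow : (ρ ^ 4) ^ (G.dist e.1.1 f.1.1 - 1) ≤ (ρ⁻¹ ^ 2 * (ρ ^ 2) ^ G.dist e.1.1 f.1.1) ^ 2 := by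
      rcases Nat.eq_zero_or_pos (G.dist e.1.1 f.1.1) with h0 | h0
      · rw [h0]
        simp only [zero_tsub, pow_zero, mul_one]
        exact one_le_pow₀ (one_le_pow₀ (ENNReal.one_le_inv.2 hρ1))
      · obtain ⟨m, hm⟩ := Nat.exists_eq_add_of_le' h0
        rw [hm, Nat.add_sub_cancel]
        refine le_of_eq ?_
        calc (ρ ^ 4) ^ m = ((ρ⁻¹ * ρ) ^ 2 * (ρ ^ 2) ^ m) ^ 2 := by rw [hinv]; ring
          _ = _ := by ring
    calc C * decayRate K d φ ^ (G.dist e.1.1 f.1.1 - 1)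
        ≤ (C + 1) ^ 2 * (ρ⁻¹ ^ 2 * (ρ ^ 2) ^ G.dist e.1.1 f.1.1) ^ 2 := by
          exact mul_le_mul' hC ((pow_le_pow_left' hρ _).trans hpow)
      _ = _ := by ring
  · simp [resolventElem_eq_zero hζ _ h]

/-- By Tonelli a fixed spectral parameter suffices; Cauchy–Schwarz in the randomness is applied to
each intermediate edge. The bound does not see `r`. -/
theorem lintegral_poissonMass_le (hK : μ ≤ K • haarAddCircle) {d : ℕ}
    (hd : ∀ x : V, G.degree x ≤ d) {φ : ℝ} (hφ : 0 ≤ φ)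
    (hS : ∀ x z y, ‖(S x).1 z y - (1 : Matrix _ _ ℂ) z y‖ ≤ φ) {ρ : ℝ≥0∞} (hρ0 : ρ ≠ 0)
    (hρ1 : ρ ≤ 1) (hρd : (d : ℝ≥0∞) * ρ ≤ 2⁻¹) (hρ : decayRate K d φ ≤ ρ ^ 4) {r : ℝ} (hr0 : 0 ≤ r)
    (hr : r < 1) (e f : DirEdge G) :
    ∫⁻ θ, poissonMass (randomWalk S θ) r (ket e) (ket f) ∂(Measure.infinitePi fun _ : V => μ) ≤
      momentBound K d ρ ^ 2 * (4 * d : ℕ) * distWeight G ρ e.1.1 f.1.1 := by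
  have hm := measurable_poissonElem_randomWalk S hr0 hr e f
  have hcount : Countable {e' : DirEdge G | G.Reachable e.1.1 e'.1.1} :=
    (countable_reachable hd e.1.1).to_subtype
  have hX : ∀ ζ : ℂ, ‖ζ‖ < 1 → ∀ e f, Measurable fun θ : V → Torus => ‖resolventElem S θ ζ e f‖ₑ :=
    fun ζ hζ e f => (measurable_resolventElem S measurable_id measurable_const (fun _ => hζ)
      e f).enorm
  have key : ∀ α : Torus, ∫⁻ θ, ‖poissonElem (randomWalk S θ) (spectralParam r α) (ket e)
      (ket f)‖ₑ ∂(Measure.infinitePi fun _ : V => μ) ≤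
      momentBound K d ρ ^ 2 * (4 * d : ℕ) * distWeight G ρ e.1.1 f.1.1 := by
    intro α
    have hζ : ‖spectralParam r α‖ < 1 := by rwa [norm_spectralParam hr0]
    calc _ ≤ ∫⁻ θ, ∑' e' : {e' : DirEdge G | G.Reachable e.1.1 e'.1.1},
          ENNReal.ofReal (1 - ‖spectralParam r α‖ ^ 2) *
            (‖resolventElem S θ (spectralParam r α) e e'‖ₑ *
              ‖resolventElem S θ (spectralParam r α) f e'‖ₑ)
          ∂(Measure.infinitePi fun _ : V => μ) :=
          lintegral_mono fun θ => enorm_poissonElem_le hζ θ e f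
      _ = ∑' e' : {e' : DirEdge G | G.Reachable e.1.1 e'.1.1}, ∫⁻ θ,
          ENNReal.ofReal (1 - ‖spectralParam r α‖ ^ 2) *
            (‖resolventElem S θ (spectralParam r α) e e'‖ₑ *
              ‖resolventElem S θ (spectralParam r α) f e'‖ₑ)
          ∂(Measure.infinitePi fun _ : V => μ) :=
          lintegral_tsum fun e' =>
            (((hX _ hζ e e').mul (hX _ hζ f e')).const_mul _).aemeasurable
      _ ≤ ∑' e' : {e' : DirEdge G | G.Reachable e.1.1 e'.1.1}, momentBound K d ρ ^ 2 *
          (distWeight G ρ e.1.1 f.1.1 * distWeight G ρ e.1.1 e'.1.1.1) := by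
          refine ENNReal.tsum_le_tsum fun e' => ?_
          refine (lintegral_const_mul_mul_le (hX _ hζ e e') (hX _ hζ f e')
            (secondMoment_le_distWeight hK hζ hd hφ hS hρ0 hρ1 hρ e e')
            (secondMoment_le_distWeight hK hζ hd hφ hS hρ0 hρ1 hρ f e')).trans ?_
          rw [mul_mul_mul_comm, ← sq]
          exact mul_le_mul_right (distWeight_mul_le hρ1 _ _ _) _
      _ ≤ ∑' e' : DirEdge G, momentBound K d ρ ^ 2 *
          (distWeight G ρ e.1.1 f.1.1 * distWeight G ρ e.1.1 e'.1.1) :=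
          ENNReal.tsum_comp_le_tsum_of_injective Subtype.val_injective _
      _ ≤ _ := by
          rw [ENNReal.tsum_mul_left, ENNReal.tsum_mul_left, mul_assoc,
            mul_comm (distWeight G ρ e.1.1 f.1.1)]
          gcongr
          exact tsum_distWeight_le hd hρd _
  calc _ = ∫⁻ α : Torus, ∫⁻ θ,
        ‖poissonElem (randomWalk S θ) (spectralParam r α) (ket e) (ket f)‖ₑ
        ∂(Measure.infinitePi fun _ : V => μ) ∂haarAddCircle :=
        lintegral_lintegral_swap hm.enorm.aemeasurable
    _ ≤ ∫⁻ _ : Torus, momentBound K d ρ ^ 2 * (4 * d : ℕ) * distWeight G ρ e.1.1 f.1.1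
        ∂haarAddCircle := lintegral_mono key
    _ = _ := by simp

/-- The supremum is dominated pathwise by a lower limit of Poisson masses, and Fatou carries the
uniform mean bound to `r → 1`. -/
theorem lintegral_iSup_inner_zpow_spectralProjection_le (hK : μ ≤ K • haarAddCircle) {d : ℕ}
    (hd : ∀ x : V, G.degree x ≤ d) {φ : ℝ} (hφ : 0 ≤ φ)
    (hS : ∀ x z y, ‖(S x).1 z y - (1 : Matrix _ _ ℂ) z y‖ ≤ φ) {ρ : ℝ≥0∞} (hρ0 : ρ ≠ 0)
    (hρ1 : ρ ≤ 1) (hρd : (d : ℝ≥0∞) * ρ ≤ 2⁻¹) (hρ : decayRate K d φ ≤ ρ ^ 4)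
    {I : Set Circle} (hI : MeasurableSet I) (e f : DirEdge G) :
    ∫⁻ θ, ⨆ n : ℤ, ‖inner ℂ (ket e) ((randomWalk S θ ^ n)
      (spectralProjection (randomWalk S θ) I (ket f)))‖ₑ ∂(Measure.infinitePi fun _ : V => μ) ≤
      momentBound K d ρ ^ 2 * (4 * d : ℕ) * distWeight G ρ e.1.1 f.1.1 :=
  calc _ ≤ ∫⁻ θ, liminf (fun k => poissonMass (randomWalk S θ) (radius k) (ket e) (ket f)) atTop
        ∂(Measure.infinitePi fun _ : V => μ) :=
        lintegral_mono fun θ => iSup_le fun n =>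
          inner_zpow_spectralProjection_le (randomWalk S θ) (ket e) (ket f) hI n
    _ ≤ liminf (fun k => ∫⁻ θ, poissonMass (randomWalk S θ) (radius k) (ket e) (ket f)
        ∂(Measure.infinitePi fun _ : V => μ)) atTop :=
        lintegral_liminf_le fun k =>
          measurable_poissonMass_randomWalk S (radius_nonneg k) (radius_lt_one k) e f
    _ ≤ liminf (fun _ : ℕ => momentBound K d ρ ^ 2 * (4 * d : ℕ) * distWeight G ρ e.1.1 f.1.1)
        atTop := liminf_le_liminf (Eventually.of_forall fun k =>
          lintegral_poissonMass_le hK hd hφ hS hρ0 hρ1 hρd hρ (radius_nonneg k) (radius_lt_one k)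
            e f)
    _ = _ := liminf_const _

theorem measurable_inner_zpow_spectralProjection (S : ScatteringFamily G) {I : Set Circle}
    (hI : MeasurableSet I) (n : ℤ) (e f : DirEdge G) :
    Measurable fun θ : V → Torus => inner ℂ (ket e) ((randomWalk S θ ^ n)
      (spectralProjection (randomWalk S θ) I (ket f))) := by
  have h := measurable_inner_spectralProjection (W := fun θ : V → Torus => randomWalk S θ)
    (e := fun θ => (randomWalk S θ ^ (-n)) (ket e)) (f := fun _ => ket f) hI
    (fun m => by
      simp_rw [← zpow_add_apply, inner_zpow_zpow]
      exact measurable_inner_randomWalk_zpow S _ e e)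
    (fun m => by
      simp_rw [inner_zpow_zpow]
      exact measurable_inner_randomWalk_zpow S _ e f)
    (fun m => measurable_inner_randomWalk_zpow S m f f)
  simpa only [inner_zpow_left, neg_neg] using h

/-! ### Choice of the constants -/

theorem exists_le_smul_haarAddCircle {τ : Torus → ℝ} (hτ : MemLp τ ∞ volume) :
    ∃ K : ℝ≥0∞, K ≠ ∞ ∧
      (volume.withDensity fun θ => ENNReal.ofReal (τ θ)) ≤ K • (haarAddCircle : Measure Torus) := by
  refine ⟨eLpNormEssSup τ volume * ENNReal.ofReal (2 * Real.pi),
    ENNReal.mul_ne_top ?_ ENNReal.ofReal_ne_top, ?_⟩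
  · have h := hτ.2
    rw [eLpNorm_exponent_top] at h
    exact h.ne
  · rw [mul_smul]
    change _ ≤ eLpNormEssSup τ volume • (volume : Measure Torus)
    rw [← withDensity_const]
    refine withDensity_mono ?_
    filter_upwards [enorm_ae_le_eLpNormEssSup τ volume] with θ hθ
    refine le_trans ?_ hθ
    rw [← ofReal_norm]
    exact ENNReal.ofReal_le_ofReal (Real.le_norm_self _)

theorem exists_decayRate_le {K : ℝ≥0∞} (hK : K ≠ ∞) (d : ℕ) {ρ : ℝ} (hρ : 0 < ρ) :
    ∃ φ : ℝ, 0 < φ ∧ decayRate K d φ ≤ ENNReal.ofReal ρ ^ 4 := by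
  set M : ℝ≥0∞ := (2 * d : ℕ) * (K ^ 2 * (3 + 76 * d : ℕ)) with hM
  have hMt : M ≠ ∞ := by finiteness
  have hpos : 0 < M.toReal + 1 := by positivity
  -- The fourth power undoes the exponent `1/4`; the added one avoids division by zero.
  refine ⟨(ρ ^ 4 / (M.toReal + 1)) ^ 4, by positivity, ?_⟩
  have h1 : ENNReal.ofReal ((ρ ^ 4 / (M.toReal + 1)) ^ 4) ^ (1 / 4 : ℝ) =
      ENNReal.ofReal (ρ ^ 4 / (M.toReal + 1)) := by
    rw [ENNReal.ofReal_pow (by positivity), ← ENNReal.rpow_natCast, ← ENNReal.rpow_mul]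
    norm_num
  rw [decayRate, h1, ← mul_assoc, ← hM, ← ENNReal.ofReal_toReal hMt,
    ← ENNReal.ofReal_mul ENNReal.toReal_nonneg, ENNReal.toReal_ofReal ENNReal.toReal_nonneg,
    ← ENNReal.ofReal_pow hρ.le]
  refine ENNReal.ofReal_le_ofReal ?_
  rw [mul_div_assoc', div_le_iff₀ hpos, mul_comm]
  gcongr
  linarith

end ScatteringWalk

/-! ### Assembly of the theorem -/

theorem mainTheorem1 {V : Type*} [DecidableEq V] (G : SimpleGraph V) [G.LocallyFinite]
    (d : ℕ) (hd : ∀ x : V, G.degree x ≤ d)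
    (τ : ScatteringWalk.Torus → ℝ) (hτ_nonneg : 0 ≤ᵐ[volume] τ) (hτ : MemLp τ ∞ volume)
    (μ : Measure ScatteringWalk.Torus) [IsProbabilityMeasure μ]
    (hμ : μ = volume.withDensity fun θ => ENNReal.ofReal (τ θ))
    {Ω : Type*} [MeasurableSpace Ω] (P : Measure Ω) [IsProbabilityMeasure P]
    (ω : V → Ω → ScatteringWalk.Torus) (hω_meas : ∀ x : V, Measurable (ω x))
    (hω_indep : iIndepFun ω P) (hω_law : ∀ x : V, P.map (ω x) = μ)
    (g : ℝ) (hg : 0 < g) :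
    ∃ φ : ℝ, 0 < φ ∧ ∃ c : ℝ, 0 < c ∧
      ∀ S : ScatteringWalk.ScatteringFamily G, ScatteringWalk.scatteringDist S 1 ≤ φ →
        ∀ (x y x' y' : V) (hxy : G.Adj x y) (hxy' : G.Adj x' y')
          (I : Set Circle), MeasurableSet I →
          AEMeasurable (fun w : Ω => ⨆ n : ℤ,
            ‖inner ℂ (ScatteringWalk.ket ⟨(x, y), hxy⟩)
              (((ScatteringWalk.randomWalk S fun v => ω v w) ^ n)
                (ScatteringWalk.spectralProjection (ScatteringWalk.randomWalk S fun v => ω v w) I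
                  (ScatteringWalk.ket ⟨(x', y'), hxy'⟩)))‖ₑ) P ∧
          ∫⁻ w : Ω, ⨆ n : ℤ,
            ‖inner ℂ (ScatteringWalk.ket ⟨(x, y), hxy⟩)
              (((ScatteringWalk.randomWalk S fun v => ω v w) ^ n)
                (ScatteringWalk.spectralProjection (ScatteringWalk.randomWalk S fun v => ω v w) I
                  (ScatteringWalk.ket ⟨(x', y'), hxy'⟩)))‖ₑ ∂P
            ≤ ENNReal.ofReal (c * ScatteringWalk.expDecay G g x x') := by
  obtain ⟨K, hK, hμK⟩ := ScatteringWalk.exists_le_smul_haarAddCircle hτ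
  rw [← hμ] at hμK
  -- The first bound gives the decay rate `g`, the second the summability over a graph of degree at
  -- most `d`.
  set ρ : ℝ := min (Real.exp (-g)) (1 / (2 * (d + 1))) with hρ
  have hρ0 : 0 < ρ := lt_min (Real.exp_pos _) (by positivity)
  have hρg : ρ ≤ Real.exp (-g) := min_le_left _ _
  have hρ1 : ENNReal.ofReal ρ ≤ 1 :=
    ENNReal.ofReal_le_one.2 (hρg.trans (Real.exp_le_one_iff.2 (by linarith)))
  have hρ0' : ENNReal.ofReal ρ ≠ 0 := (ENNReal.ofReal_pos.2 hρ0).ne'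
  have hρd : (d : ℝ≥0∞) * ENNReal.ofReal ρ ≤ 2⁻¹ := by
    have h : (d : ℝ) * ρ ≤ 2⁻¹ := by
      calc (d : ℝ) * ρ ≤ (d + 1) * (1 / (2 * (d + 1))) := by
            gcongr
            · linarith
            · exact min_le_right _ _
        _ = 2⁻¹ := by field_simp
    rw [← ENNReal.ofReal_natCast, ← ENNReal.ofReal_mul (Nat.cast_nonneg d),
      show (2 : ℝ≥0∞)⁻¹ = ENNReal.ofReal 2⁻¹ by
        rw [ENNReal.ofReal_inv_of_pos two_pos, ENNReal.ofReal_ofNat]]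
    exact ENNReal.ofReal_le_ofReal h
  obtain ⟨φ, hφ, hrate⟩ := ScatteringWalk.exists_decayRate_le hK d hρ0
  set L : ℝ≥0∞ := ScatteringWalk.momentBound K d (ENNReal.ofReal ρ) ^ 2 * (4 * d : ℕ) with hL
  have hLt : L ≠ ∞ := by
    have : (ENNReal.ofReal ρ)⁻¹ ≠ ∞ := ENNReal.inv_ne_top.2 hρ0'
    rw [hL, ScatteringWalk.momentBound]
    finiteness
  -- The added one keeps `c` positive when `d = 0`, where `L` vanishes.
  refine ⟨φ, hφ, L.toReal + 1, by positivity, fun S hS x y x' y' hxy hxy' I hI => ?_⟩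
  -- Independence and the common law make the phase configuration distributed by the product
  -- measure, on which the estimates were proved.
  have hlaw : P.map (fun w v => ω v w) = Measure.infinitePi fun _ : V => μ := by
    rw [hω_indep.map_fun_eq_infinitePi_map hω_meas]
    simp only [hω_law]
  have hmω : Measurable fun (w : Ω) (v : V) => ω v w := measurable_pi_lambda _ hω_meas
  have hmeas : Measurable fun θ : V → ScatteringWalk.Torus => ⨆ n : ℤ,
      ‖inner ℂ (ScatteringWalk.ket ⟨(x, y), hxy⟩) ((ScatteringWalk.randomWalk S θ ^ n)
        (ScatteringWalk.spectralProjection (ScatteringWalk.randomWalk S θ) I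
          (ScatteringWalk.ket ⟨(x', y'), hxy'⟩)))‖ₑ :=
    Measurable.iSup fun n =>
      (ScatteringWalk.measurable_inner_zpow_spectralProjection S hI n _ _).enorm
  refine ⟨(hmeas.comp hmω).aemeasurable, ?_⟩
  rw [← lintegral_map hmeas hmω, hlaw]
  refine (ScatteringWalk.lintegral_iSup_inner_zpow_spectralProjection_le hμK hd hφ.le
    (fun x z y => (ScatteringWalk.norm_entry_sub_one_le_scatteringDist S hd x z y).trans hS)
    hρ0' hρ1 hρd hrate hI _ _).trans ?_
  rw [ENNReal.ofReal_mul (by positivity)]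
  gcongr
  · rw [← hL, ← ENNReal.ofReal_toReal hLt, ENNReal.toReal_ofReal ENNReal.toReal_nonneg]
    exact ENNReal.ofReal_le_ofReal (by linarith)
  · exact ScatteringWalk.distWeight_le_expDecay (ENNReal.ofReal_le_ofReal hρg) _ _
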